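/- **Setting.** Let $k$ be a commutative ring with unit, $P$ a finite poset with elements $1,\dots,N$, and $(G_i)_{i\in P}$ a family of discrete groups (trivial, finite or infinite). The *amalgam of the groups $G_i$ and the poset $P$* is the category $\mathcal C$ with object set $P$, with $\mathrm{Mor}(i,i)=G_i$, with exactly one morphism $e_{ij}$ from $i$ to $j$ if $i\prec j$ and no morphism if $i\not\preceq j$; composition (written from left to right) is the product of $G_i$ on $\mathrm{Mor}(i,i)$, and $g\,e_{ij}=e_{ij}=e_{ij}h$, $e_{ij}e_{jl}=e_{il}$ for $g\in G_i$, $h\in G_j$. The category algebra $k[\mathcal C]$ is the free $k$-module on the morphisms, the product of two morphisms being their composite if they are composable and $0$ otherwise. For a unital $k$-algebra $A$, $HH^*(A;A)$ is the cohomology of the complex $\mathrm{Hom}_k(A^{\otimes n},A)$, $n\ge0$, with $$(\delta f)(a_1,\dots,a_{n+1})=a_1f(a_2,\dots,a_{n+1})+\sum_{j=1}^n(-1)^jf(\dots,a_ja_{j+1},\dots)+(-1)^{n+1}f(a_1,\dots,a_n)a_{n+1},$$ and the Gerstenhaber product is $(f\cdot g)(a_1,\dots,a_{p+q})=f(a_1,\dots,a_p)\,g(a_{p+1},\dots,a_{p+q})$.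 For a category $\mathcal D$, $H^*(B\mathcal D;k)$ is the cohomology of the complex of $k$-valued functions on the simplices of the nerve of $\mathcal D$. A group $G$ is viewed as a category with one object, with $BG$ its classifying space. If $A$ has a $k$-basis $\mathcal B$, a cochain $f\in\mathrm{Hom}_k(A^{\otimes n},A)$ is *strictly autopoietic* if for all $\varphi_1,\dots,\varphi_n\in\mathcal B$ there is $\lambda\in k$ with $f(\varphi_1\otimes\cdots\otimes\varphi_n)=\lambda\,\varphi_1\cdots\varphi_n$ (for $n=0$: $f(1)\in k\cdot 1_A$). For $A=k[G]$ ($\mathcal B=G$), $AP(k[G]^{\otimes *})$ denotes the complex of strictly autopoietic cochains. For $A=k[\mathcal C]$ with the basis of morphisms, the *autopoietic cochains* are the strictly autopoietic ones in degrees $n\ge1$, and in degree $0$ the cochains with value in the $k$-span of the identity morphisms. Let $\Psi$ send a simplicial $n$-cochain $\gamma$ of $B\mathcal C$ to the Hochschild cochain of $k[\mathcal C]$ with $$\Psi(\gamma)(\alpha_1\otimes\cdots\otimes\alpha_n)=\gamma(\alpha_1,\dots,\alpha_n)\,\alpha_1\cdots\alpha_n$$ for composable morphisms $\alpha_1,\dots,\alpha_n$,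 and $0$ for non-composable ones, $n\ge1$; for $n=0$, $\Psi(\gamma)(1)=\sum_i\gamma(i)\,\mathrm{id}_i$. Define $\Psi$ for a group $G$ by $\Psi(\gamma)(g_1\otimes\cdots\otimes g_n)=\gamma(g_1,\dots,g_n)\,g_1\cdots g_n$, $n\ge0$. **Theorem.** 1. $\Psi$ is an isomorphism of cochain complexes from the simplicial cochains of $B\mathcal C$ onto the autopoietic Hochschild cochains of $k[\mathcal C]$. It preserves units, carries the simplicial cup product to the Gerstenhaber product, and, in positive degrees, carries Steenrod's cup-one product $$(\alpha\cup_1\beta)(\sigma)=\sum_{j=0}^{p-1}(-1)^{(p-1-j)(q-1)}\,\alpha(\sigma|_{0,\dots,j,\,j+q,\dots,p+q-1})\,\beta(\sigma|_{j,\dots,j+q})$$ to the pre-Lie product $$(f\circ g)(a_1,\dots,a_{p+q-1})=\sum_{j=0}^{p-1}(-1)^{(p-1-j)(q-1)}f(a_1,\dots,a_j,\,g(a_{j+1},\dots,a_{j+q}),\,a_{j+q+1},\dots,a_{p+q-1}).$$ 2. For every $i$, $\Psi$ is an isomorphism of cochain complexes from the simplicial cochains of $BG_i$ onto $AP(k[G_i]^{\otimes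 *})$, and the induced map $H^*(BG_i;k)\to HH^*(k[G_i];k[G_i])$ is injective. Its image, the module of classes of strictly autopoietic cocycles, is denoted $H^*(BG_i)$ below. 3. In every degree there is an isomorphism of $k$-modules $$HH^*(k[\mathcal C];k[\mathcal C])\;\cong\;H^*(B\mathcal C;k)\oplus\bigoplus_{i=1}^N HH^*(k[G_i];k[G_i])/H^*(BG_i),$$ whose restriction to the summand $H^*(B\mathcal C;k)$ is induced by $\Psi$. Thus this summand consists of the classes of the autopoietic cocycles and is a subalgebra: the class of $\alpha\cup\beta$ corresponds to the class of $\Psi(\alpha)\cdot\Psi(\beta)$. 4. For the poset algebra $k[P]$ (the category algebra of the poset $P$, i.e. the case of trivial groups), $\Psi$ induces an isomorphism $H^*(BP;k)\cong HH^*(k[P];k[P])$. -/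

import Mathlib

open CategoryTheory

universe w v u

noncomputable section

/-! ### Cohomology of a sequence of modules -/

section Sequence

variable {k : Type*} [CommRing k] {M : ℕ → Type*} [∀ n, AddCommGroup (M n)] [∀ n, Module k (M n)]

/-- The `n`-cocycles of a sequence `M 0 → M 1 → M 2 → ⋯` of `k`-linear maps. -/
def cocycles (d : ∀ n, M n →ₗ[k] M (n + 1)) (n : ℕ) : Submodule k (M n) :=
  LinearMap.ker (d n)

/-- The `n`-coboundaries of a sequence `0 → M 0 → M 1 → M 2 → ⋯` of `k`-linear maps. -/
def coboundaries (d : ∀ n, M n →ₗ[k] M (n + 1)) : ∀ n, Submodule k (M n)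
  | 0 => ⊥
  | n + 1 => LinearMap.range (d n)

/-- The `n`-th cohomology module: cocycles modulo coboundaries. -/
abbrev Cohomology (d : ∀ n, M n →ₗ[k] M (n + 1)) (n : ℕ) : Type _ :=
  cocycles d n ⧸ (coboundaries d n).submoduleOf (cocycles d n)

/-- The cohomology class of a cocycle. -/
def cohomologyClass (d : ∀ n, M n →ₗ[k] M (n + 1)) (n : ℕ) : cocycles d n →ₗ[k] Cohomology d n :=
  ((coboundaries d n).submoduleOf (cocycles d n)).mkQ

end Sequence

/-! ### Simplicial cohomology -/

section Simplicial

open Simplicial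

variable (k : Type w) [CommRing k] (X : SSet.{u})

/-- Simplicial `n`-cochains: `Hom_k(k[X_n], k)`, i.e. functions on the set of `n`-simplices. -/
abbrev SimplicialCochain (n : ℕ) : Type (max u w) := X _⦋n⦌ → k

/-- The simplicial coboundary, `(d γ)(σ) = ∑ (-1)^i γ(d_i σ)`. -/
def simplicialD (n : ℕ) : SimplicialCochain k X n →ₗ[k] SimplicialCochain k X (n + 1) where
  toFun γ := fun σ => ∑ i : Fin (n + 2), (-1 : k) ^ (i : ℕ) * γ (X.δ i σ)
  map_add' γ γ' := by
    ext σ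
    simp [mul_add, Finset.sum_add_distrib]
  map_smul' c γ := by
    ext σ
    simp [Finset.mul_sum, mul_left_comm]

/-- The simplicial cohomology `H^n(X; k)`. -/
abbrev SimplicialCohomology (n : ℕ) : Type (max u w) := Cohomology (simplicialD k X) n

variable {k X}

/-- The simplicial cup product (front `p`-face times back `q`-face). -/
def simplicialCup {p q : ℕ} (α : SimplicialCochain k X p) (β : SimplicialCochain k X q) :
    SimplicialCochain k X (p + q) := fun σ =>
  α (X.map (SimplexCategory.subinterval 0 p (by lia)).op σ) *
    β (X.map (SimplexCategory.subinterval p q le_rfl).op σ)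

/-- The inclusion of the vertices `0, …, j, j + q + 1, …, p + q + 1` in `{0, …, p + q + 1}`. -/
def skipInterval (p q : ℕ) (j : Fin (p + 1)) : ⦋p + 1⦌ ⟶ ⦋p + q + 1⦌ :=
  SimplexCategory.mkHom
    { toFun := fun l => ⟨if (l : ℕ) ≤ j then l else l + q, by
        have := l.isLt
        split_ifs <;> lia⟩
      monotone' := by
        intro l m h
        have h' : (l : ℕ) ≤ m := h
        simp only [Fin.mk_le_mk]
        split_ifs <;> lia }

/-- Steenrod's cup-one product of cochains of positive degrees `p + 1` and `q + 1`. -/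
def simplicialCupOne {p q : ℕ} (α : SimplicialCochain k X (p + 1))
    (β : SimplicialCochain k X (q + 1)) : SimplicialCochain k X (p + q + 1) := fun σ =>
  ∑ j : Fin (p + 1), (-1 : k) ^ ((p - (j : ℕ)) * q) *
    (α (X.map (skipInterval p q j).op σ) *
      β (X.map (SimplexCategory.subinterval (j : ℕ) (q + 1) (by lia)).op σ))

end Simplicial

/-! ### Hochschild cohomology -/

section Hochschild

variable (k : Type w) [CommRing k] (A : Type v) [Ring A] [Algebra k A]

/-- Hochschild `n`-cochains: `Hom_k(A^{⊗ n}, A)`, as `k`-multilinear maps. -/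
abbrev HochschildCochain (n : ℕ) : Type v := MultilinearMap k (fun _ : Fin n => A) A

variable {k A}

/-- `a ↦ a₀ f(a₁, …, aₙ)`. -/
def leftMul {n : ℕ} (f : HochschildCochain k A n) : HochschildCochain k A (n + 1) :=
  MultilinearMap.mk' (fun a => a 0 * f (fun i => a i.succ))
    (by
      intro a t x y
      have key : ∀ z (s : Fin n), (fun i : Fin n => Function.update a s.succ z i.succ) =
          Function.update (fun i : Fin n => a i.succ) s z := fun z s => by
        ext i; simp [Function.update_apply]
      refine Fin.cases ?_ (fun s => ?_) t
      · simp [add_mul]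
      · simp [key, mul_add, Function.update_of_ne (Fin.succ_ne_zero s).symm])
    (by
      intro a t c x
      have key : ∀ z (s : Fin n), (fun i : Fin n => Function.update a s.succ z i.succ) =
          Function.update (fun i : Fin n => a i.succ) s z := fun z s => by
        ext i; simp [Function.update_apply]
      refine Fin.cases ?_ (fun s => ?_) t
      · simp
      · simp [key, Function.update_of_ne (Fin.succ_ne_zero s).symm])

/-- `a ↦ f(a₀, …, aₙ₋₁) aₙ`. -/
def rightMul {n : ℕ} (f : HochschildCochain k A n) : HochschildCochain k A (n + 1) :=
  MultilinearMap.mk' (fun a => f (fun i => a i.castSucc) * a (Fin.last n))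
    (by
      intro a t x y
      have key : ∀ z (s : Fin n), (fun i : Fin n => Function.update a s.castSucc z i.castSucc) =
          Function.update (fun i : Fin n => a i.castSucc) s z := fun z s => by
        ext i; simp [Function.update_apply]
      refine Fin.lastCases ?_ (fun s => ?_) t
      · simp [mul_add]
      · simp [key, add_mul, Function.update_of_ne (Fin.castSucc_ne_last s).symm])
    (by
      intro a t c x
      have key : ∀ z (s : Fin n), (fun i : Fin n => Function.update a s.castSucc z i.castSucc) =
          Function.update (fun i : Fin n => a i.castSucc) s z := fun z s => by
        ext i; simp [Function.update_apply]
      refine Fin.lastCases ?_ (fun s => ?_) t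
      · simp
      · simp [key, Function.update_of_ne (Fin.castSucc_ne_last s).symm])

lemma contractNth_update (k : Type*) [CommRing k] {A : Type*} [Ring A] [Algebra k A] {n : ℕ}
    (j : Fin n) (a : Fin (n + 1) → A) (t : Fin (n + 1)) :
    ∃ (s : Fin n) (L : A →ₗ[k] A), ∀ x,
      Fin.contractNth j.castSucc (· * ·) (Function.update a t x) =
        Function.update (Fin.contractNth j.castSucc (· * ·) a) s (L x) := by
  rcases lt_trichotomy (t : ℕ) j with h | h | h
  · refine ⟨⟨t, by lia⟩, LinearMap.id, fun x => ?_⟩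
    ext l
    simp only [Fin.contractNth, Function.update_apply, Fin.ext_iff]
    simp only [Fin.val_castSucc, Fin.val_succ, LinearMap.id_apply]
    split_ifs <;> first | rfl | lia
  · refine ⟨j, LinearMap.mulRight k (a j.succ), fun x => ?_⟩
    ext l
    by_cases hl : l = j
    · subst hl
      simp [Fin.contractNth, Function.update_apply, Fin.ext_iff, h]
    · rw [Function.update_of_ne hl]
      have hl' : (l : ℕ) ≠ j := fun e => hl (Fin.ext e)
      simp only [Fin.contractNth, Function.update_apply, Fin.ext_iff]
      simp only [Fin.val_castSucc, Fin.val_succ]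
      split_ifs <;> first | rfl | lia
  · by_cases h' : (t : ℕ) = j + 1
    · refine ⟨j, LinearMap.mulLeft k (a j.castSucc), fun x => ?_⟩
      ext l
      by_cases hl : l = j
      · subst hl
        simp [Fin.contractNth, Function.update_apply, Fin.ext_iff, h']
      · rw [Function.update_of_ne hl]
        have hl' : (l : ℕ) ≠ j := fun e => hl (Fin.ext e)
        simp only [Fin.contractNth, Function.update_apply, Fin.ext_iff]
        simp only [Fin.val_castSucc, Fin.val_succ]
        split_ifs <;> first | rfl | lia
    · refine ⟨⟨t - 1, by lia⟩, LinearMap.id, fun x => ?_⟩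
      ext l
      simp only [Fin.contractNth, Function.update_apply, Fin.ext_iff]
      simp only [Fin.val_castSucc, Fin.val_succ, LinearMap.id_apply]
      split_ifs <;> first | rfl | lia

/-- `a ↦ f(a₀, …, aⱼ aⱼ₊₁, …, aₙ)`. -/
def contractMul {n : ℕ} (j : Fin n) (f : HochschildCochain k A n) :
    HochschildCochain k A (n + 1) :=
  MultilinearMap.mk' (fun a => f (Fin.contractNth j.castSucc (· * ·) a))
    (by
      intro a t x y
      obtain ⟨s, L, h⟩ := contractNth_update k j a t
      simp [h])
    (by
      intro a t c x
      obtain ⟨s, L, h⟩ := contractNth_update k j a t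
      simp [h])

variable (k A) in
/-- The Hochschild coboundary. -/
def hochschildD (n : ℕ) : HochschildCochain k A n →ₗ[k] HochschildCochain k A (n + 1) where
  toFun f := leftMul f + ∑ j : Fin n, (-1 : k) ^ ((j : ℕ) + 1) • contractMul j f +
    (-1 : k) ^ (n + 1) • rightMul f
  map_add' f g := by
    ext a
    simp [leftMul, rightMul, contractMul, mul_add, add_mul, Finset.sum_add_distrib]
    abel
  map_smul' c f := by
    ext a
    simp [leftMul, rightMul, contractMul, Finset.smul_sum, smul_comm c]

lemma hochschildD_apply (n : ℕ) (f : HochschildCochain k A n) (a : Fin (n + 1) → A) :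
    hochschildD k A n f a = a 0 * f (fun i => a i.succ) +
      ∑ j : Fin n, (-1 : k) ^ ((j : ℕ) + 1) • f (Fin.contractNth j.castSucc (· * ·) a) +
      (-1 : k) ^ (n + 1) • (f (fun i => a i.castSucc) * a (Fin.last n)) := by
  simp [hochschildD, leftMul, rightMul, contractMul]

variable (k A) in
/-- The Hochschild cohomology `HH^n(A; A)`, computed from the standard complex. -/
abbrev HochschildCohomology (n : ℕ) : Type v := Cohomology (hochschildD k A) n

/-- The Gerstenhaber (cup) product of Hochschild cochains. -/
def gerstenhaberProduct {p q : ℕ} (f : HochschildCochain k A p) (g : HochschildCochain k A q) :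
    HochschildCochain k A (p + q) :=
  MultilinearMap.mk' (fun a => f (fun i => a (Fin.castAdd q i)) * g (fun i => a (Fin.natAdd p i)))
    (by
      intro a t x y
      refine Fin.addCases (fun s => ?_) (fun s => ?_) t
      · have h1 : ∀ z, (fun i => Function.update a (Fin.castAdd q s) z (Fin.castAdd q i)) =
            Function.update (fun i => a (Fin.castAdd q i)) s z := fun z => by
          ext i; simp [Function.update_apply]
        have h2 : ∀ z, (fun i => Function.update a (Fin.castAdd q s) z (Fin.natAdd p i)) =
            fun i => a (Fin.natAdd p i) := fun z => by
          ext i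
          rw [Function.update_of_ne]
          simp only [ne_eq, Fin.ext_iff, Fin.val_natAdd, Fin.val_castAdd]
          lia
        simp [h1, h2, add_mul]
      · have h1 : ∀ z, (fun i => Function.update a (Fin.natAdd p s) z (Fin.natAdd p i)) =
            Function.update (fun i => a (Fin.natAdd p i)) s z := fun z => by
          ext i; simp [Function.update_apply]
        have h2 : ∀ z, (fun i => Function.update a (Fin.natAdd p s) z (Fin.castAdd q i)) =
            fun i => a (Fin.castAdd q i) := fun z => by
          ext i
          rw [Function.update_of_ne]
          simp only [ne_eq, Fin.ext_iff, Fin.val_natAdd, Fin.val_castAdd]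
          lia
        simp [h1, h2, mul_add])
    (by
      intro a t c x
      refine Fin.addCases (fun s => ?_) (fun s => ?_) t
      · have h1 : ∀ z, (fun i => Function.update a (Fin.castAdd q s) z (Fin.castAdd q i)) =
            Function.update (fun i => a (Fin.castAdd q i)) s z := fun z => by
          ext i; simp [Function.update_apply]
        have h2 : ∀ z, (fun i => Function.update a (Fin.castAdd q s) z (Fin.natAdd p i)) =
            fun i => a (Fin.natAdd p i) := fun z => by
          ext i
          rw [Function.update_of_ne]
          simp only [ne_eq, Fin.ext_iff, Fin.val_natAdd, Fin.val_castAdd]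
          lia
        simp [h1, h2]
      · have h1 : ∀ z, (fun i => Function.update a (Fin.natAdd p s) z (Fin.natAdd p i)) =
            Function.update (fun i => a (Fin.natAdd p i)) s z := fun z => by
          ext i; simp [Function.update_apply]
        have h2 : ∀ z, (fun i => Function.update a (Fin.natAdd p s) z (Fin.castAdd q i)) =
            fun i => a (Fin.castAdd q i) := fun z => by
          ext i
          rw [Function.update_of_ne]
          simp only [ne_eq, Fin.ext_iff, Fin.val_natAdd, Fin.val_castAdd]
          lia
        simp [h1, h2])

/-- The value at `a` of Gerstenhaber's pre-Lie product of cochains of positive degrees `p + 1` and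
`q + 1`: the signed sum over `j` of the partial compositions
`f(a₀, …, aⱼ₋₁, g(aⱼ, …, aⱼ₊q), aⱼ₊q₊₁, …, aₚ₊q)`. -/
def preLie {p q : ℕ} (f : HochschildCochain k A (p + 1)) (g : HochschildCochain k A (q + 1))
    (a : Fin (p + q + 1) → A) : A :=
  ∑ j : Fin (p + 1), (-1 : k) ^ ((p - (j : ℕ)) * q) •
    f (fun l => if (l : ℕ) < j then a ⟨l, by lia⟩
      else if l = j then g (fun r => a ⟨j + r, by lia⟩)
      else a ⟨l + q, by lia⟩)

variable (k) in
/-- The cochains `f` with `f(b_{φ₁}, …, b_{φₙ}) = λ b_{φ₁} ⋯ b_{φₙ}`, where `λ ∈ k` may depend on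
`φ₁, …, φₙ`. For a basis `b` these are the strictly autopoietic cochains;
for `n = 0` the condition is `f() = λ 1`, and it is dropped for autopoietic cochains. -/
def strictlyAutopoietic {Ω : Type*} (b : Ω → A) (n : ℕ) :
    Submodule k (HochschildCochain k A n) where
  carrier := {f | ∀ φ : Fin n → Ω, ∃ c : k,
    f (fun i => b (φ i)) = c • (List.ofFn fun i => b (φ i)).prod}
  add_mem' := by
    intro f g hf hg φ
    obtain ⟨c, hc⟩ := hf φ
    obtain ⟨c', hc'⟩ := hg φ
    exact ⟨c + c', by rw [add_apply, hc, hc', add_smul]⟩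
  zero_mem' := fun φ => ⟨0, by simp⟩
  smul_mem' := by
    intro c f hf φ
    obtain ⟨c', hc'⟩ := hf φ
    exact ⟨c * c', by rw [smul_apply, hc', mul_smul]⟩

variable (k) in
/-- The submodule of `HH^n(A; A)` of classes of strictly autopoietic cocycles, i.e. the image of the
`n`-th cohomology of the complex of strictly autopoietic cochains. -/
def strictlyAutopoieticClasses {Ω : Type*} (b : Ω → A) (n : ℕ) :
    Submodule k (HochschildCohomology k A n) :=
  ((strictlyAutopoietic k b n).submoduleOf (cocycles (hochschildD k A) n)).map
    (cohomologyClass (hochschildD k A) n)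

/-- For a basis `b` of `A`, the linear map sending `γ : Ωⁿ → k` to the cochain
`b_{φ₁} ⊗ ⋯ ⊗ b_{φₙ} ↦ γ(φ₁, …, φₙ) b_{φ₁} ⋯ b_{φₙ}`. -/
def coherentCochain {Ω : Type*} (b : Module.Basis Ω k A) (n : ℕ) :
    ((Fin n → Ω) → k) →ₗ[k] HochschildCochain k A n where
  toFun γ := ((Basis.piTensorProduct fun _ : Fin n => b).constr k fun φ =>
    γ φ • (List.ofFn fun i => b (φ i)).prod).compMultilinearMap (PiTensorProduct.tprod k)
  map_add' γ γ' := by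
    refine Module.Basis.ext_multilinear (fun _ => b) fun φ => ?_
    simp [← Basis.piTensorProduct_apply, add_smul]
  map_smul' c γ := by
    refine Module.Basis.ext_multilinear (fun _ => b) fun φ => ?_
    simp [← Basis.piTensorProduct_apply, mul_smul]

lemma coherentCochain_apply {Ω : Type*} (b : Module.Basis Ω k A) (n : ℕ) (γ : (Fin n → Ω) → k)
    (φ : Fin n → Ω) :
    coherentCochain b n γ (fun i => b (φ i)) = γ φ • (List.ofFn fun i => b (φ i)).prod := by
  simp [coherentCochain, ← Basis.piTensorProduct_apply]

end Hochschild

/-! ### Category algebras -/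

section CategoryAlgebra

variable (k : Type w) [CommRing k] (C : Type u) [Category.{v} C]

/-- The category algebra `k[C]`: the free `k`-module on the morphisms of `C`; the product of two
morphisms is their composite (from left to right) if they are composable and `0` otherwise. -/
def CategoryAlgebra : Type (max u v w) := Arrow C →₀ k

namespace CategoryAlgebra

instance : AddCommGroup (CategoryAlgebra k C) := inferInstanceAs (AddCommGroup (Arrow C →₀ k))

instance : Module k (CategoryAlgebra k C) := inferInstanceAs (Module k (Arrow C →₀ k))

/-- The basis of `k[C]` given by the morphisms of `C`. -/
def basis : Module.Basis (Arrow C) k (CategoryAlgebra k C) :=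
  (Finsupp.basisSingleOne : Module.Basis (Arrow C) k (Arrow C →₀ k))

open Classical in
/-- The product of two basis elements. -/
def arrowMul (f g : Arrow C) : CategoryAlgebra k C :=
  if h : f.right = g.left then basis k C (Arrow.mk (f.hom ≫ eqToHom h ≫ g.hom)) else 0

/-- The product of `k[C]` as a bilinear map. -/
def mulHom : CategoryAlgebra k C →ₗ[k] CategoryAlgebra k C →ₗ[k] CategoryAlgebra k C :=
  (basis k C).constr k fun f => (basis k C).constr k fun g => arrowMul k C f g

instance : Mul (CategoryAlgebra k C) := ⟨fun x y => mulHom k C x y⟩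

instance [Fintype C] : One (CategoryAlgebra k C) := ⟨∑ i : C, basis k C (Arrow.mk (𝟙 i))⟩

variable {k C}

lemma mul_def (x y : CategoryAlgebra k C) : x * y = mulHom k C x y := rfl

lemma one_def [Fintype C] : (1 : CategoryAlgebra k C) = ∑ i : C, basis k C (Arrow.mk (𝟙 i)) := rfl

lemma mulHom_basis (f g : Arrow C) :
    mulHom k C (basis k C f) (basis k C g) = arrowMul k C f g := by
  simp [mulHom]

lemma basis_mul_basis (f g : Arrow C) : basis k C f * basis k C g = arrowMul k C f g :=
  mulHom_basis f g

lemma arrowMul_of_comp {X Y Z : C} (f : X ⟶ Y) (g : Y ⟶ Z) :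
    arrowMul k C (Arrow.mk f) (Arrow.mk g) = basis k C (Arrow.mk (f ≫ g)) := by
  simp [arrowMul]

lemma arrowMul_of_ne {X Y Y' Z : C} (f : X ⟶ Y) (g : Y' ⟶ Z) (h : Y ≠ Y') :
    arrowMul k C (Arrow.mk f) (Arrow.mk g) = 0 := by
  simp [arrowMul, h]

lemma induction_linear {p : CategoryAlgebra k C → Prop} (x : CategoryAlgebra k C) (zero : p 0)
    (add : ∀ x y, p x → p y → p (x + y)) (smul : ∀ (c : k) (f : Arrow C), p (c • basis k C f)) :
    p x := by
  refine Finsupp.induction_linear (motive := p) x zero add fun f c => ?_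
  have h : (c • basis k C f : CategoryAlgebra k C) = Finsupp.single f c := by
    change c • (Finsupp.basisSingleOne : Module.Basis (Arrow C) k (Arrow C →₀ k)) f = _
    simp
  exact h ▸ smul c f

lemma arrowMul_assoc {X Y Y' Z Z' W : C} (f : X ⟶ Y) (g : Y' ⟶ Z) (h : Z' ⟶ W) :
    mulHom k C (arrowMul k C (Arrow.mk f) (Arrow.mk g)) (basis k C (Arrow.mk h)) =
      mulHom k C (basis k C (Arrow.mk f)) (arrowMul k C (Arrow.mk g) (Arrow.mk h)) := by
  by_cases hY : Y = Y' <;> by_cases hZ : Z = Z'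
  · subst hY hZ
    simp only [arrowMul_of_comp, mulHom_basis, Category.assoc]
  · subst hY
    simp only [arrowMul_of_comp, arrowMul_of_ne _ _ hZ, mulHom_basis, map_zero]
  · subst hZ
    simp only [arrowMul_of_comp, arrowMul_of_ne _ _ hY, mulHom_basis, map_zero,
      LinearMap.zero_apply]
  · simp only [arrowMul_of_ne _ _ hY, arrowMul_of_ne _ _ hZ, map_zero, LinearMap.zero_apply]

lemma mulHom_assoc (x y z : CategoryAlgebra k C) :
    mulHom k C (mulHom k C x y) z = mulHom k C x (mulHom k C y z) := by
  refine induction_linear (p := fun x => mulHom k C (mulHom k C x y) z =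
    mulHom k C x (mulHom k C y z)) x (by simp) (fun x x' hx hx' => by simp [hx, hx'])
    fun a f => ?_
  refine induction_linear (p := fun y => mulHom k C (mulHom k C (a • basis k C f) y) z =
    mulHom k C (a • basis k C f) (mulHom k C y z)) y (by simp)
    (fun y y' hy hy' => by simp only [map_add, LinearMap.add_apply, hy, hy']) fun b g => ?_
  refine induction_linear (p := fun z => mulHom k C (mulHom k C (a • basis k C f)
    (b • basis k C g)) z = mulHom k C (a • basis k C f) (mulHom k C (b • basis k C g) z))
    z (by simp) (fun z z' hz hz' => by simp only [map_add, hz, hz']) fun c h => ?_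
  simp only [map_smul, LinearMap.smul_apply, mulHom_basis]
  rw [show mulHom k C (arrowMul k C f g) (basis k C h) = mulHom k C (basis k C f)
    (arrowMul k C g h) from arrowMul_assoc f.hom g.hom h.hom]

lemma mulHom_one [Fintype C] (x : CategoryAlgebra k C) : mulHom k C x 1 = x := by
  refine induction_linear (p := fun x => mulHom k C x 1 = x) x (by simp)
    (fun x x' hx hx' => by simp [hx, hx']) fun a f => ?_
  simp only [one_def, map_smul, map_sum, LinearMap.smul_apply, mulHom_basis]
  rw [Finset.sum_eq_single f.right]
  · have h := arrowMul_of_comp (k := k) f.hom (𝟙 f.right)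
    rw [Category.comp_id] at h
    exact congrArg (fun y : CategoryAlgebra k C => a • y) h
  · intro i _ hi
    rw [show arrowMul k C f (Arrow.mk (𝟙 i)) = 0 from arrowMul_of_ne f.hom (𝟙 i) hi.symm,
      smul_zero]
  · simp

lemma one_mulHom [Fintype C] (x : CategoryAlgebra k C) : mulHom k C 1 x = x := by
  refine induction_linear (p := fun x => mulHom k C 1 x = x) x (by simp)
    (fun x x' hx hx' => by simp [hx, hx']) fun a f => ?_
  simp only [one_def, map_smul, map_sum, LinearMap.sum_apply, mulHom_basis]
  rw [Finset.sum_eq_single f.left]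
  · have h := arrowMul_of_comp (k := k) (𝟙 f.left) f.hom
    rw [Category.id_comp] at h
    exact congrArg (fun y : CategoryAlgebra k C => a • y) h
  · intro i _ hi
    exact arrowMul_of_ne (k := k) (𝟙 i) f.hom hi
  · simp

instance [Fintype C] : Ring (CategoryAlgebra k C) :=
  { (inferInstance : AddCommGroup (CategoryAlgebra k C)),
    (inferInstance : Mul (CategoryAlgebra k C)), (inferInstance : One (CategoryAlgebra k C)) with
    left_distrib := fun x y z => by simp only [mul_def, map_add]
    right_distrib := fun x y z => by simp [mul_def]
    zero_mul := fun x => by simp [mul_def]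
    mul_zero := fun x => by simp [mul_def]
    mul_assoc := mulHom_assoc (k := k) (C := C)
    one_mul := one_mulHom (k := k) (C := C)
    mul_one := mulHom_one (k := k) (C := C) }

instance [Fintype C] : Algebra k (CategoryAlgebra k C) :=
  Algebra.ofModule (fun c x y => by simp [mul_def]) (fun c x y => by simp [mul_def])

end CategoryAlgebra

open Simplicial in
/-- The tuple of morphisms `(σ₀ → σ₁, …, σₙ₋₁ → σₙ)` of a simplex `σ` of the nerve. -/
def nerveArrows (n : ℕ) (σ : (nerve C) _⦋n⦌) : Fin n → Arrow C := fun i =>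
  let F : ComposableArrows C n := σ
  Arrow.mk (F.map' i (i + 1))

open Simplicial in
/-- The `0`-simplex of the nerve given by an object. -/
def nerveVertex (i : C) : (nerve C) _⦋0⦌ := ComposableArrows.mk₀ i

/-- The map `Ψ` from simplicial cochains on the nerve of `C` to Hochschild cochains of `k[C]`.
For `n > 0`, `Ψ(γ)(α₁ ⊗ ⋯ ⊗ αₙ) = γ(α₁, …, αₙ) α₁ ⋯ αₙ` if the morphisms `α₁, …, αₙ` form
an `n`-simplex of the nerve, and `0` otherwise. For `n = 0`, `Ψ(γ)` is the element
`∑ i, γ(i) id_i`. -/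
def categoryPsi [Fintype C] : ∀ n : ℕ, SimplicialCochain k (nerve C) n →ₗ[k]
    HochschildCochain k (CategoryAlgebra k C) n := fun n => match n with
  | 0 =>
    { toFun := fun γ => MultilinearMap.constOfIsEmpty k _
        (∑ i : C, γ (nerveVertex C i) • CategoryAlgebra.basis k C (Arrow.mk (𝟙 i)))
      map_add' := fun γ γ' => by ext; simp [add_smul, Finset.sum_add_distrib]
      map_smul' := fun c γ => by ext; simp [mul_smul, Finset.smul_sum] }
  | n + 1 => coherentCochain (CategoryAlgebra.basis k C) (n + 1) ∘ₗ
      Function.ExtendByZero.linearMap k (nerveArrows C (n + 1))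

/-- The autopoietic Hochschild cochains of `k[C]`; in degree `0`, the elements of the span of
the identity morphisms. -/
def categoryAutopoietic [Fintype C] :
    ∀ n : ℕ, Submodule k (HochschildCochain k (CategoryAlgebra k C) n) := fun n => match n with
  | 0 =>
    { carrier := {f | f Fin.elim0 ∈ Submodule.span k
        (Set.range fun i : C => CategoryAlgebra.basis k C (Arrow.mk (𝟙 i)))}
      add_mem' := fun {f g} hf hg => by
        rw [Set.mem_ofPred_eq] at hf hg ⊢
        rw [add_apply]
        exact Submodule.add_mem _ hf hg
      zero_mem' := by
        rw [Set.mem_ofPred_eq, zero_apply]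
        exact Submodule.zero_mem _
      smul_mem' := fun c f hf => by
        rw [Set.mem_ofPred_eq] at hf ⊢
        rw [smul_apply]
        exact Submodule.smul_mem _ c hf }
  | n + 1 => strictlyAutopoietic k (CategoryAlgebra.basis k C) (n + 1)

end CategoryAlgebra

/-! ### Group rings -/

section GroupRing

variable (k : Type w) [CommRing k] (G : Type v) [Group G]

/-- The group `G` as a category with one object; as composition of morphisms is written from left to
right (`f ≫ g`), composition in this category is the multiplication of `G`. -/
abbrev GroupCategory : Type := SingleObj Gᵐᵒᵖ

variable {G} in
open Simplicial in
/-- The simplex `(g₁, …, gₙ)` of the nerve of `G`. -/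
def groupSimplex {n : ℕ} (g : Fin n → G) : (nerve (GroupCategory G)) _⦋n⦌ :=
  ComposableArrows.mkOfObjOfMapSucc (C := GroupCategory G) (fun _ => SingleObj.star _)
    fun i => MulOpposite.op (g i)

/-- The map `Ψ` from simplicial cochains on the nerve of `G` to Hochschild cochains of `k[G]`,
`Ψ(γ)(g₁ ⊗ ⋯ ⊗ gₙ) = γ(g₁, …, gₙ) g₁ ⋯ gₙ`. -/
def groupPsi (n : ℕ) : SimplicialCochain k (nerve (GroupCategory G)) n →ₗ[k]
    HochschildCochain k (MonoidAlgebra k G) n :=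
  coherentCochain (MonoidAlgebra.basis G k) n ∘ₗ LinearMap.funLeft k k groupSimplex

end GroupRing

/-! ### Amalgams of groups and posets -/

section Amalgam

variable {P : Type u} [PartialOrder P]

/-- The objects of the amalgam of the groups `G i` and the poset `P`: the elements of `P`. -/
def Amalgam (_G : P → Type v) : Type u := P

namespace Amalgam

variable (G : P → Type v)

instance [Fintype P] : Fintype (Amalgam G) := inferInstanceAs (Fintype P)

/-- The morphisms of the amalgam: the elements of `G i` from `i` to `i`, and one morphism
`e_{ij}` from `i` to `j` for `i < j`. -/
inductive Hom : P → P → Type (max u v)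
  | grp {i : P} (g : G i) : Hom i i
  | arr {i j : P} (h : i < j) : Hom i j

variable {G} [∀ i, Group (G i)]

/-- The identity of `i` is the neutral element of `G i`. -/
def Hom.id (i : P) : Hom G i i := .grp 1

/-- Composition from left to right: the product in `G i`, and `g e_{ij} = e_{ij} = e_{ij} h` and
`e_{ij} e_{jl} = e_{il}`. -/
def Hom.comp : ∀ {i j l : P}, Hom G i j → Hom G j l → Hom G i l
  | _, _, _, .grp g, .grp h => .grp (g * h)
  | _, _, _, .grp _, .arr h => .arr h
  | _, _, _, .arr h, .grp _ => .arr h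
  | _, _, _, .arr h, .arr h' => .arr (h.trans h')

lemma Hom.id_comp {i j : P} (f : Hom G i j) : (Hom.id i).comp f = f := by
  cases f <;> simp [Hom.id, Hom.comp]

lemma Hom.comp_id {i j : P} (f : Hom G i j) : f.comp (Hom.id j) = f := by
  cases f <;> simp [Hom.id, Hom.comp]

lemma Hom.comp_assoc {i j l m : P} (f : Hom G i j) (g : Hom G j l) (h : Hom G l m) :
    (f.comp g).comp h = f.comp (g.comp h) := by
  cases f <;> cases g <;> cases h <;> simp [Hom.comp, mul_assoc]

instance : Category.{max u v} (Amalgam G) where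
  Hom i j := Hom G i j
  id i := Hom.id (G := G) i
  comp f g := Hom.comp f g
  id_comp f := Hom.id_comp f
  comp_id f := Hom.comp_id f
  assoc f g h := Hom.comp_assoc f g h

end Amalgam

end Amalgam

end

noncomputable section

/-! ### Functoriality of cohomology -/

section Sequence

variable {k : Type*} [CommRing k] {M M' : ℕ → Type*} [∀ n, AddCommGroup (M n)]
  [∀ n, Module k (M n)] [∀ n, AddCommGroup (M' n)] [∀ n, Module k (M' n)]
  {d : ∀ n, M n →ₗ[k] M (n + 1)} {d' : ∀ n, M' n →ₗ[k] M' (n + 1)}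

/-! The map `Ψ` has a retraction at the level of cochain complexes, available for every finite
category: `categoryRho` evaluates a Hochschild cochain on a simplex and adds up the coefficients of
the value at all morphisms from the first to the last vertex. Multiplying by a morphism moves the
source or target and preserves such a coefficient sum, so this is a cochain map. Hence `Ψ` is
injective on cohomology. For a group ring the same construction is `groupRho`, where the sum of
coefficients is the augmentation.

The complement is governed by two facts about the amalgam. First, antisymmetry of the poset prevents
a composite that starts and ends at `i` from leaving `i`. Therefore `projection` onto the corner
`k[G_i]` is multiplicative, and restriction of cochains to `k[G_i]` is a cochain map. Second, the
morphisms `e_{ij}` absorb group elements, so an element `z` of the group ring acts on them by its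
augmentation. Extension by zero from `k[G_i]` to the category algebra therefore commutes with the
coboundary on cochains with values in the augmentation ideal. Every cocycle `f` of `k[G_i]` has this
property after subtracting `Ψ(ρ f)`, which is exactly what passing to the quotient by `H^*(BG_i)`
allows. This proves that `decomposition`, formed from the retraction and the restrictions, is
surjective.

For injectivity, a cocycle in the kernel is first corrected by coboundaries so that its retraction
and all its restrictions vanish as cochains. A homotopy built from the identity idempotents shows
that a cocycle depends, up to coboundary, only on the components of its values on composable tuples
that go from the source to the target (`mem_coboundaries_of_idem_mul_idem`). If source and target
are equal, the whole simplex lies in one group and the component is seen by a restriction. If they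
differ, there is only one morphism between them and the component is seen by its coefficient sum. So
the corrected cocycle is a coboundary. For a poset algebra the second case covers everything.

The product formulas are checked on basis tuples: on a simplex both sides are multiples of its long
edge, while on non-composable tuples both vanish. -/

lemma mem_cocycles {n : ℕ} {x : M n} : x ∈ cocycles d n ↔ d n x = 0 := Iff.rfl

lemma cohomologyClass_eq_zero_iff {n : ℕ} (z : cocycles d n) :
    cohomologyClass d n z = 0 ↔ (z : M n) ∈ coboundaries d n := by
  rw [cohomologyClass, Submodule.mkQ_apply, Submodule.Quotient.mk_eq_zero]
  rfl

lemma cohomologyClass_surjective (n : ℕ) : Function.Surjective (cohomologyClass d n) :=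
  Submodule.mkQ_surjective _

lemma map_mem_coboundaries {φ : ∀ n, M n →ₗ[k] M' n}
    (hφ : ∀ n x, d' n (φ n x) = φ (n + 1) (d n x)) {n : ℕ} {x : M n}
    (hx : x ∈ coboundaries d n) : φ n x ∈ coboundaries d' n := by
  cases n with
  | zero =>
    rw [show x = 0 from hx, map_zero]
    exact Submodule.zero_mem _
  | succ n =>
    obtain ⟨y, rfl⟩ := hx
    exact ⟨φ n y, hφ n y⟩

lemma map_mem_cocycles {φ : ∀ n, M n →ₗ[k] M' n}
    (hφ : ∀ n x, d' n (φ n x) = φ (n + 1) (d n x)) {n : ℕ} {x : M n}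
    (hx : x ∈ cocycles d n) : φ n x ∈ cocycles d' n := by
  rw [mem_cocycles] at hx ⊢
  rw [hφ, hx, map_zero]

/-- The map on cohomology induced by a map of cochain complexes. -/
def cohomologyMap (φ : ∀ n, M n →ₗ[k] M' n) (hφ : ∀ n x, d' n (φ n x) = φ (n + 1) (d n x))
    (n : ℕ) : Cohomology d n →ₗ[k] Cohomology d' n :=
  Submodule.mapQ _ _ ((φ n).restrict fun _ => map_mem_cocycles hφ)
    fun _ hx => map_mem_coboundaries hφ hx

lemma cohomologyMap_class (φ : ∀ n, M n →ₗ[k] M' n)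
    (hφ : ∀ n x, d' n (φ n x) = φ (n + 1) (d n x)) (n : ℕ) (z : cocycles d n) :
    cohomologyMap φ hφ n (cohomologyClass d n z) =
      cohomologyClass d' n ⟨φ n z, map_mem_cocycles hφ z.2⟩ := rfl

end Sequence

/-! ### The Hochschild coboundary in recursive form -/

section Hochschild

variable {k : Type w} [CommRing k] {A : Type v} [Ring A] [Algebra k A]

/-- The Hochschild coboundary without its first term `a₀ f(a₁, …, aₙ)`. -/
def hochschildTail (n : ℕ) : HochschildCochain k A n →ₗ[k] HochschildCochain k A (n + 1) where
  toFun f := hochschildD k A n f - leftMul f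
  map_add' f g := by ext a; simp [leftMul, mul_add]; abel
  map_smul' c f := by ext a; simp [leftMul, smul_sub]

lemma hochschildTail_apply (n : ℕ) (f : HochschildCochain k A n) (a : Fin (n + 1) → A) :
    hochschildTail n f a =
      ∑ j : Fin n, (-1 : k) ^ ((j : ℕ) + 1) • f (Fin.contractNth j.castSucc (· * ·) a) +
      (-1 : k) ^ (n + 1) • (f (fun i => a i.castSucc) * a (Fin.last n)) := by
  change hochschildD k A n f a - a 0 * f (fun i => a i.succ) = _
  rw [hochschildD_apply]
  abel

lemma hochschildD_eq (n : ℕ) (f : HochschildCochain k A n) (a : Fin (n + 1) → A) :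
    hochschildD k A n f a = a 0 * f (Fin.tail a) + hochschildTail n f a := by
  rw [hochschildTail_apply, hochschildD_apply, add_assoc]
  rfl

lemma hochschildTail_zero (f : HochschildCochain k A 0) (a : Fin 1 → A) :
    hochschildTail 0 f a = -(f Fin.elim0 * a 0) := by
  rw [hochschildTail_apply]
  simp [Subsingleton.elim (fun i : Fin 0 => a i.castSucc) Fin.elim0]

lemma contractNth_zero_cons_cons {n : ℕ} (a b : A) (c : Fin n → A) :
    Fin.contractNth (0 : Fin (n + 1)).castSucc (· * ·) (Fin.cons a (Fin.cons b c) : Fin (n + 2) → A)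
      = Fin.cons (a * b) c := by
  ext i
  refine Fin.cases ?_ (fun i => ?_) i
  · simp [Fin.contractNth]
  · simp [Fin.contractNth]

lemma contractNth_succ_cons {n : ℕ} (j : Fin (n + 1)) (a : A) (c : Fin (n + 1) → A) :
    Fin.contractNth j.succ (· * ·) (Fin.cons a c : Fin (n + 2) → A)
      = Fin.cons a (Fin.contractNth j (· * ·) c) := by
  ext i
  refine Fin.cases ?_ (fun i => ?_) i
  · simp [Fin.contractNth]
  · simp only [Fin.contractNth, Fin.val_succ, Fin.cons_succ, Fin.castSucc_succ,
      add_lt_add_iff_right, add_left_inj]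

/-- Without its first term the coboundary satisfies a recursion under currying in the first
argument, because no remaining term pulls that argument out of the cochain. This recursion drives
the induction for the homotopy. -/
lemma hochschildTail_cons_cons (n : ℕ) (f : HochschildCochain k A (n + 1)) (a b : A)
    (c : Fin n → A) :
    hochschildTail (n + 1) f (Fin.cons a (Fin.cons b c)) =
      -f (Fin.cons (a * b) c) - hochschildTail n (f.curryLeft a) (Fin.cons b c) := by
  rw [hochschildTail_apply, hochschildTail_apply, Fin.sum_univ_succ, contractNth_zero_cons_cons]
  have h : (fun i : Fin (n + 1) => (Fin.cons a (Fin.cons b c) : Fin (n + 2) → A) i.castSucc) =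
      Fin.cons a (fun i : Fin n => (Fin.cons b c : Fin (n + 1) → A) i.castSucc) := by
    ext i
    refine Fin.cases ?_ (fun i => ?_) i
    · rfl
    · simp
  simp only [← Fin.succ_castSucc, contractNth_succ_cons, h, MultilinearMap.curryLeft_apply,
    ← Fin.succ_last, Fin.cons_succ]
  simp only [Fin.val_zero, zero_add, pow_one, neg_smul, one_smul, Fin.val_succ,
    pow_succ _ ((_ : ℕ) + 1), mul_neg, mul_one, Finset.sum_neg_distrib]
  abel

/-! ### The homotopy onto cochains normalised with respect to idempotents -/

variable (k A) in
/-- Currying of Hochschild cochains in the first argument. -/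
def cochainCurry (n : ℕ) :
    HochschildCochain k A (n + 1) ≃ₗ[k] (A →ₗ[k] HochschildCochain k A n) :=
  multilinearCurryLeftEquiv k (fun _ => A) A

lemma cochainCurry_symm_apply {n : ℕ} (F : A →ₗ[k] HochschildCochain k A n) (a : Fin (n + 1) → A) :
    (cochainCurry k A n).symm F a = F (a 0) (Fin.tail a) := rfl

lemma cochainCurry_apply {n : ℕ} (f : HochschildCochain k A (n + 1)) (x : A) :
    cochainCurry k A n f x = f.curryLeft x := rfl

variable {ι : Type*} [Fintype ι] (e : ι → A)

/-- The part `f ↦ f(eᵢ, a₁, …, aₙ) - ∑ⱼ f(eᵢ a₁ eⱼ, eⱼ, a₂, …, aₙ) + ⋯` starting at `i` of the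
homotopy between the identity and the normalisation of cochains. -/
def normHomotopyFrom : ∀ (n : ℕ) (_ : ι), HochschildCochain k A (n + 1) →ₗ[k] HochschildCochain k A n
  | 0, i => LinearMap.applyₗ (e i) ∘ₗ (cochainCurry k A 0).toLinearMap
  | n + 1, i => LinearMap.applyₗ (e i) ∘ₗ (cochainCurry k A (n + 1)).toLinearMap - ∑ j,
      (cochainCurry k A n).symm.toLinearMap ∘ₗ
        LinearMap.lcomp k _ (LinearMap.mulLeft k (e i) ∘ₗ LinearMap.mulRight k (e j)) ∘ₗ
          LinearMap.compRight k (normHomotopyFrom n j) ∘ₗ (cochainCurry k A (n + 1)).toLinearMap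

lemma normHomotopyFrom_zero (i : ι) (f : HochschildCochain k A 1) :
    normHomotopyFrom (k := k) e 0 i f = f.curryLeft (e i) := rfl

lemma normHomotopyFrom_cons (n : ℕ) (i : ι) (f : HochschildCochain k A (n + 2)) (a : A)
    (c : Fin n → A) :
    normHomotopyFrom e (n + 1) i f (Fin.cons a c) = f (Fin.cons (e i) (Fin.cons a c)) -
      ∑ j, normHomotopyFrom e n j (f.curryLeft (e i * a * e j)) c := by
  simp [normHomotopyFrom, sum_apply, mul_assoc, cochainCurry_symm_apply, cochainCurry_apply]

/-- The value at `a` of the normalisation of `f` starting at `i`,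
`f(a) ↦ ∑ f(eᵢ a₁ e_{i₁}, e_{i₁} a₂ e_{i₂}, …) e_{iₙ}`. -/
def normalizationFrom : ∀ (n : ℕ) (_ : ι), HochschildCochain k A n → (Fin n → A) → A
  | 0, i, f, a => f a * e i
  | n + 1, i, f, a =>
    ∑ j, normalizationFrom n j (f.curryLeft (e i * a 0 * e j)) (Fin.tail a)

lemma normHomotopyFrom_mulLeft (x : A) : ∀ (n : ℕ) (i : ι) (f : HochschildCochain k A (n + 1))
    (c : Fin n → A), normHomotopyFrom e n i ((LinearMap.mulLeft k x).compMultilinearMap f) c =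
      x * normHomotopyFrom e n i f c
  | 0, i, f, c => rfl
  | n + 1, i, f, c => by
    rw [← Fin.cons_self_tail c, normHomotopyFrom_cons, normHomotopyFrom_cons, mul_sub,
      Finset.mul_sum]
    congr 1
    refine Finset.sum_congr rfl fun j _ => ?_
    exact normHomotopyFrom_mulLeft x n j (f.curryLeft (e i * c 0 * e j)) _

/-- This supplies the term that `hochschildTail` omits. Fixing the first argument of `leftMul f` at
`y` gives `y` times `f`, and left multiplication of values passes through the homotopy. -/
lemma normHomotopyFrom_leftMul (he' : ∀ i, e i * e i = e i) (n : ℕ) (i : ι)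
    (f : HochschildCochain k A (n + 1)) (a : Fin (n + 1) → A) :
    e i * normHomotopyFrom e (n + 1) i (leftMul f) a =
      e i * f a - ∑ j, e i * a 0 * e j * normHomotopyFrom e n j f (Fin.tail a) := by
  obtain ⟨x, c, rfl⟩ : ∃ x c, a = Fin.cons x c := ⟨_, _, (Fin.cons_self_tail a).symm⟩
  rw [normHomotopyFrom_cons, mul_sub, Finset.mul_sum]
  congr 1
  · change e i * (e i * f (Fin.cons x c)) = _
    rw [← mul_assoc, he']
  · refine Finset.sum_congr rfl fun j _ => ?_
    have h : (leftMul f).curryLeft (e i * x * e j) =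
        (LinearMap.mulLeft k (e i * x * e j)).compMultilinearMap f := rfl
    rw [h, normHomotopyFrom_mulLeft]
    simp only [Fin.cons_zero, Fin.tail_cons, ← mul_assoc, he']

/-- The cochain `(a₁, …, aₙ) ↦ f(x a₁, a₂, …, aₙ)`. -/
def mulFirst {n : ℕ} (x : A) (f : HochschildCochain k A (n + 1)) : HochschildCochain k A (n + 1) :=
  (cochainCurry k A n).symm (cochainCurry k A n f ∘ₗ LinearMap.mulLeft k x)

lemma hochschildTail_curryLeft {n : ℕ} (f : HochschildCochain k A (n + 1)) (x : A) :
    (hochschildTail (n + 1) f).curryLeft x =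
      -mulFirst x f - hochschildTail n (f.curryLeft x) := by
  ext a
  rw [← Fin.cons_self_tail a]
  exact hochschildTail_cons_cons n f x _ _

lemma normHomotopyFrom_mulFirst (n : ℕ) (i : ι) (x : A) (f : HochschildCochain k A (n + 2)) (b : A)
    (c : Fin n → A) :
    normHomotopyFrom e (n + 1) i (mulFirst x f) (Fin.cons b c) =
      f (Fin.cons (x * e i) (Fin.cons b c)) -
      ∑ j, normHomotopyFrom e n j (f.curryLeft (x * e i * b * e j)) c := by
  rw [normHomotopyFrom_cons]
  congr 1
  refine Finset.sum_congr rfl fun j _ => ?_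
  rw [show (mulFirst x f).curryLeft (e i * b * e j) = f.curryLeft (x * (e i * b * e j)) from rfl]
  simp only [mul_assoc]

lemma normHomotopyFrom_curryLeft (n : ℕ) (i : ι) (f : HochschildCochain k A (n + 2)) (a : A) :
    (normHomotopyFrom e (n + 1) i f).curryLeft a = (f.curryLeft (e i)).curryLeft a -
      ∑ j, normHomotopyFrom e n j (f.curryLeft (e i * a * e j)) := by
  ext c
  rw [sub_apply, sum_apply]
  exact normHomotopyFrom_cons e n i f a c

/-- The homotopy identity, by induction on the degree after peeling off the first argument.
Idempotency keeps `e i * x * e j` fixed under multiplication by `e j`, and the sum being `1` removes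
an intermediate idempotent between two multiplied arguments. Orthogonality of the idempotents plays
no role. -/
lemma normHomotopyFrom_tail (he : ∑ i, e i = 1) (he' : ∀ i, e i * e i = e i) :
    ∀ (n : ℕ) (i : ι) (f : HochschildCochain k A (n + 1)) (a : Fin (n + 1) → A),
      normHomotopyFrom e (n + 1) i (hochschildTail (n + 1) f) a +
        hochschildTail n (normHomotopyFrom e n i f) a = - normalizationFrom e (n + 1) i f a := by
  have hsum : ∀ (F : A →+ A) (x y : A), ∑ j, F (x * e j * y) = F (x * y) := fun F x y => by
    rw [← map_sum, ← Finset.sum_mul, ← Finset.mul_sum, he, mul_one]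
  have hsum' : ∀ (F : A →+ A) (x : A), ∑ j, F (x * e j) = F x := fun F x => by
    simpa using hsum F x 1
  have hF : ∀ {m : ℕ} (f : HochschildCochain k A (m + 1)) (c : Fin m → A),
      ∃ F : A →+ A, ∀ x, F x = f (Fin.cons x c) := fun f c =>
    ⟨AddMonoidHom.mk' (fun x => f (Fin.cons x c)) fun x y => f.cons_add c x y, fun _ => rfl⟩
  intro n
  induction n with
  | zero =>
    intro i f a
    obtain ⟨x, c, rfl⟩ : ∃ x c, a = Fin.cons x c := ⟨_, _, (Fin.cons_self_tail a).symm⟩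
    rw [normHomotopyFrom_cons, hochschildTail_zero, hochschildTail_cons_cons, hochschildTail_zero]
    have h : ∀ j, normHomotopyFrom e 0 j ((hochschildTail (0 + 1) f).curryLeft (e i * x * e j)) c =
        -f (Fin.cons (e i * x * e j) c) + f (Fin.cons (e i * x * e j) c) * e j := fun j => by
      change hochschildTail (0 + 1) f (Fin.cons (e i * x * e j) (Fin.cons (e j) c)) = _
      rw [hochschildTail_cons_cons, hochschildTail_zero, mul_assoc _ (e j), he',
        Subsingleton.elim c Fin.elim0]
      simp
    obtain ⟨F, hF⟩ := hF f c
    have h1 := hsum' F (e i * x)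
    simp only [hF] at h1
    simp only [h, Finset.sum_add_distrib, Finset.sum_neg_distrib, h1, normalizationFrom]
    simp [normHomotopyFrom_zero, Subsingleton.elim c Fin.elim0]
    abel
  | succ n ih =>
    intro i f a
    obtain ⟨x, c, rfl⟩ : ∃ x c, a = Fin.cons x c := ⟨_, _, (Fin.cons_self_tail a).symm⟩
    obtain ⟨y, c, rfl⟩ : ∃ y d, c = Fin.cons y d := ⟨_, _, (Fin.cons_self_tail c).symm⟩
    rw [normHomotopyFrom_cons, hochschildTail_cons_cons, hochschildTail_cons_cons,
      hochschildTail_cons_cons, normHomotopyFrom_curryLeft, normHomotopyFrom_cons]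
    simp only [hochschildTail_curryLeft, map_sub, map_neg, map_sum, sub_apply, neg_apply, sum_apply,
      Finset.sum_sub_distrib, Finset.sum_neg_distrib, normHomotopyFrom_mulFirst]
    obtain ⟨F, hF⟩ := hF f (Fin.cons y c)
    have h1 := hsum' F (e i * x)
    -- These terms come from multiplying the first two arguments `x` and `y`; summing over the
    -- idempotent between them matches the corresponding term of the coboundary of the homotopy.
    have h2 : ∀ l, ∑ j, normHomotopyFrom e n l (f.curryLeft (e i * x * e j * y * e l)) c =
        normHomotopyFrom e n l (f.curryLeft (e i * (x * y) * e l)) c := fun l => by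
      have := hsum (AddMonoidHom.mk' (fun z => normHomotopyFrom e n l (f.curryLeft z) c)
        fun u v => by rw [map_add, map_add, add_apply]) (e i * x) (y * e l)
      simpa [mul_assoc] using this
    have h3 : ∀ j, e i * x * e j * e j = e i * x * e j := fun j => by rw [mul_assoc, he']
    simp only [hF] at h1
    simp only [h3, h1]
    rw [Finset.sum_comm]
    simp only [h2]
    have h4 : normalizationFrom e (n + 1 + 1) i f (Fin.cons x (Fin.cons y c)) =
      ∑ j, normalizationFrom e (n + 1) j (f.curryLeft (e i * x * e j)) (Fin.cons y c) := rfl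
    rw [h4, ← neg_inj, neg_neg, ← neg_inj, ← Finset.sum_neg_distrib]
    simp only [← ih, Finset.sum_add_distrib, MultilinearMap.curryLeft_apply]
    abel

lemma hochschildTail_mulLeft (x : A) (n : ℕ) (f : HochschildCochain k A n) (a : Fin (n + 1) → A) :
    hochschildTail n ((LinearMap.mulLeft k x).compMultilinearMap f) a =
      x * hochschildTail n f a := by
  simp [hochschildTail_apply, mul_add, Finset.mul_sum, mul_assoc]

/-- A Hochschild cocycle is cohomologous to its normalisation with respect to idempotents with
sum `1`. -/
lemma exists_eq_hochschildD_add_normalization (he : ∑ i, e i = 1) (he' : ∀ i, e i * e i = e i)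
    (n : ℕ) (f : HochschildCochain k A (n + 1)) (hf : hochschildD k A (n + 1) f = 0) :
    ∃ h : HochschildCochain k A n, ∀ a, f a =
      hochschildD k A n h a + ∑ i, e i * normalizationFrom e (n + 1) i f a := by
  -- The partial homotopies are glued by multiplying the value of the one starting at `i` on the
  -- left by `e i`.
  refine ⟨∑ i, (LinearMap.mulLeft k (e i)).compMultilinearMap (normHomotopyFrom e n i f),
    fun a => ?_⟩
  -- For a cocycle the truncated coboundary is minus the omitted first term, so the two homotopy
  -- identities combine.
  have h1 : hochschildTail (n + 1) f = -leftMul f := by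
    ext a
    have := congrArg (fun g => g a) hf
    simp only [hochschildD_eq, zero_apply] at this
    rw [neg_apply, eq_neg_iff_add_eq_zero, add_comm]
    exact this
  have h2 : ∀ i, e i * normalizationFrom e (n + 1) i f a = e i * f a -
      ∑ j, e i * (a 0 * (e j * normHomotopyFrom e n j f (Fin.tail a))) -
      e i * hochschildTail n (normHomotopyFrom e n i f) a := fun i => by
    have h := normHomotopyFrom_tail e he he' n i f a
    have h' := normHomotopyFrom_leftMul e he' n i f a
    rw [h1, map_neg, neg_apply] at h
    rw [← neg_neg (normalizationFrom e (n + 1) i f a), ← h]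
    simp only [← mul_assoc]
    rw [← h']
    noncomm_ring
  rw [hochschildD_eq]
  simp only [h2, Finset.sum_sub_distrib, sum_apply, map_sum, hochschildTail_mulLeft]
  simp only [LinearMap.compMultilinearMap_apply, LinearMap.mulLeft_apply, ← Finset.mul_sum,
    ← Finset.sum_mul, he, one_mul]
  abel

end Hochschild

/-! ### Hochschild cochains on tuples given by simplices -/

section Tuples

open Simplicial

variable {k : Type w} [CommRing k] {A : Type v} [Ring A] [Algebra k A]

lemma prod_ofFn_contractNth {M : Type*} [Monoid M] {n : ℕ} (j : Fin n) (a : Fin (n + 1) → M) :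
    (List.ofFn (Fin.contractNth j.castSucc (· * ·) a)).prod = (List.ofFn a).prod := by
  have h := congrFun (Fin.partialProd_contractNth a j.castSucc) (Fin.last n)
  have h' : ∀ {m : ℕ} (c : Fin m → M), Fin.partialProd c (Fin.last m) = (List.ofFn c).prod :=
    fun c => by simp [Fin.partialProd, List.take_of_length_le]
  rw [h'] at h
  rw [h, ← h', Function.comp_apply]
  congr 1
  rw [Fin.succAbove_of_le_castSucc, Fin.succ_last]
  simp [Fin.le_def]

/-- Compatibility of the Hochschild coboundary with `f ↦ v ∘ f ∘ u^{⊗ n}` for a multiplicative map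
`u` and a map `v` which is linear with respect to `u` on the values of `f`. -/
lemma hochschildD_comp {A' : Type*} [Ring A'] [Algebra k A'] (u : A →ₗ[k] A') (v : A' →ₗ[k] A)
    (hu : ∀ x y, u (x * y) = u x * u y) {n : ℕ} (f : HochschildCochain k A' n)
    (hl : ∀ a y, a * v (f y) = v (u a * f y)) (hr : ∀ a y, v (f y) * a = v (f y * u a)) :
    hochschildD k A n ((v.compMultilinearMap f).compLinearMap fun _ => u) =
      (v.compMultilinearMap (hochschildD k A' n f)).compLinearMap fun _ => u := by
  ext a
  have h : ∀ j : Fin n, (fun i => u (Fin.contractNth j.castSucc (· * ·) a i)) =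
      Fin.contractNth j.castSucc (· * ·) fun i => u (a i) := fun j => by
    ext i
    simp only [Fin.contractNth]
    split_ifs <;> simp [hu]
  simp [hochschildD_apply, hl, hr, h]

/-- A family of maps from the simplices of `X` to tuples of elements of a ring, such that the faces
correspond to removing the first or last entry or multiplying adjacent entries. -/
structure IsFaceCompatible {X : SSet.{u}} (arr : ∀ n, X _⦋n⦌ → Fin n → A) : Prop where
  zero (n : ℕ) (σ : X _⦋n + 1⦌) : arr n (X.δ 0 σ) = Fin.tail (arr (n + 1) σ)
  last (n : ℕ) (σ : X _⦋n + 1⦌) :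
    arr n (X.δ (Fin.last (n + 1)) σ) = fun i => arr (n + 1) σ i.castSucc
  mid (n : ℕ) (σ : X _⦋n + 1⦌) (j : Fin n) :
    arr n (X.δ j.castSucc.succ σ) = Fin.contractNth j.castSucc (· * ·) (arr (n + 1) σ)

lemma simplicialD_apply {X : SSet.{u}} (n : ℕ) (γ : SimplicialCochain k X n) (σ : X _⦋n + 1⦌) :
    simplicialD k X n γ σ = γ (X.δ 0 σ) +
      ∑ j : Fin n, (-1 : k) ^ ((j : ℕ) + 1) * γ (X.δ j.castSucc.succ σ) +
      (-1 : k) ^ (n + 1) * γ (X.δ (Fin.last (n + 1)) σ) := by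
  change ∑ i : Fin (n + 2), (-1 : k) ^ (i : ℕ) * γ (X.δ i σ) = _
  rw [Fin.sum_univ_succ, Fin.sum_univ_castSucc, ← add_assoc]
  simp

namespace IsFaceCompatible

variable {X : SSet.{u}} {arr : ∀ n, X _⦋n⦌ → Fin n → A} (h : IsFaceCompatible arr)

include h

lemma hochschildD_apply {n : ℕ} (f : HochschildCochain k A n) (σ : X _⦋n + 1⦌) :
    hochschildD k A n f (arr (n + 1) σ) = arr (n + 1) σ 0 * f (arr n (X.δ 0 σ)) +
      ∑ j : Fin n, (-1 : k) ^ ((j : ℕ) + 1) • f (arr n (X.δ j.castSucc.succ σ)) +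
      (-1 : k) ^ (n + 1) •
        (f (arr n (X.δ (Fin.last (n + 1)) σ)) * arr (n + 1) σ (Fin.last n)) := by
  rw [_root_.hochschildD_apply, h.zero, h.last]
  simp only [h.mid]
  rfl

/-- Each term of the coboundary is the full product of the simplex times the value of `γ` on one
face, with the simplicial sign. This serves for `Ψ` of categories and of groups alike. -/
lemma hochschildD_of_prod {n : ℕ} (f : HochschildCochain k A n) (γ : SimplicialCochain k X n)
    (hf : ∀ τ, f (arr n τ) = γ τ • (List.ofFn (arr n τ)).prod) (σ : X _⦋n + 1⦌) :
    hochschildD k A n f (arr (n + 1) σ) =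
      simplicialD k X n γ σ • (List.ofFn (arr (n + 1) σ)).prod := by
  rw [h.hochschildD_apply, simplicialD_apply]
  simp only [hf, add_smul, Finset.sum_smul]
  congr 1
  · congr 1
    · rw [h.zero, mul_smul_comm, List.ofFn_succ, List.prod_cons]
      rfl
    · refine Finset.sum_congr rfl fun j _ => ?_
      rw [h.mid, prod_ofFn_contractNth, mul_smul]
  · rw [h.last, smul_mul_assoc, mul_smul, List.ofFn_succ', List.concat_eq_append,
      List.prod_append, List.prod_singleton]

/-- The counterpart for retractions: a functional that absorbs the first and last entry on passing
to the outer faces, and does not see inner faces, turns the Hochschild coboundary into the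
simplicial one. -/
lemma simplicialD_of_linear (E : ∀ n, X _⦋n⦌ → A →ₗ[k] k)
    (hl : ∀ n (σ : X _⦋n + 1⦌) (z : A), E (n + 1) σ (arr (n + 1) σ 0 * z) = E n (X.δ 0 σ) z)
    (hr : ∀ n (σ : X _⦋n + 1⦌) (z : A),
      E (n + 1) σ (z * arr (n + 1) σ (Fin.last n)) = E n (X.δ (Fin.last (n + 1)) σ) z)
    (hm : ∀ n (σ : X _⦋n + 1⦌) (j : Fin n), E n (X.δ j.castSucc.succ σ) = E (n + 1) σ)
    {n : ℕ} (f : HochschildCochain k A n) :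
    simplicialD k X n (fun σ => E n σ (f (arr n σ))) =
      fun σ => E (n + 1) σ (hochschildD k A n f (arr (n + 1) σ)) := by
  ext σ
  rw [h.hochschildD_apply, simplicialD_apply]
  simp [hl, hr, hm]

end IsFaceCompatible

/-- Every term is a multiple of the full product, hence zero. For an inner term, either the
contracted entry already vanishes, or the contracted tuple is again a tuple of basis elements with
the same product. -/
lemma hochschildD_eq_zero_of_prod_eq_zero {Ω : Type*} (b : Ω → A)
    (hb : ∀ x y, b x * b y = 0 ∨ ∃ z, b x * b y = b z) {n : ℕ} {f : HochschildCochain k A n}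
    (hf : f ∈ strictlyAutopoietic k b n) (φ : Fin (n + 1) → Ω)
    (hφ : (List.ofFn fun i => b (φ i)).prod = 0) :
    hochschildD k A n f (fun i => b (φ i)) = 0 := by
  rw [hochschildD_apply]
  have h0 : b (φ 0) * f (fun i => b (φ i.succ)) = 0 := by
    obtain ⟨c, hc⟩ := hf fun i => φ i.succ
    rw [hc, mul_smul_comm]
    rw [List.ofFn_succ, List.prod_cons] at hφ
    rw [hφ, smul_zero]
  have hl : f (fun i => b (φ i.castSucc)) * b (φ (Fin.last n)) = 0 := by
    obtain ⟨c, hc⟩ := hf fun i => φ i.castSucc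
    rw [hc, smul_mul_assoc]
    rw [List.ofFn_succ', List.concat_eq_append, List.prod_append, List.prod_singleton] at hφ
    rw [hφ, smul_zero]
  have hm : ∀ j : Fin n, f (Fin.contractNth j.castSucc (· * ·) fun i => b (φ i)) = 0 := fun j => by
    have hj : Fin.contractNth j.castSucc (· * ·) (fun i => b (φ i)) j =
        b (φ j.castSucc) * b (φ j.succ) := by
      simp [Fin.contractNth]
    rcases hb (φ j.castSucc) (φ j.succ) with h | ⟨z, hz⟩
    · exact f.map_coord_zero j (hj.trans h)
    · obtain ⟨ψ, hψ⟩ : ∃ ψ : Fin n → Ω,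
          Fin.contractNth j.castSucc (· * ·) (fun i => b (φ i)) = fun i => b (ψ i) := by
        have : ∀ i, ∃ x, Fin.contractNth j.castSucc (· * ·) (fun i => b (φ i)) i = b x := fun i => by
          by_cases hi : i = j
          · exact ⟨z, by rw [hi, hj, hz]⟩
          · have hi' : (i : ℕ) ≠ j := fun h => hi (Fin.ext h)
            simp only [Fin.contractNth, Fin.val_castSucc]
            split_ifs
            exacts [⟨_, rfl⟩, ⟨_, rfl⟩]
        choose ψ hψ using this
        exact ⟨ψ, funext hψ⟩
      obtain ⟨c, hc⟩ := hf ψ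
      rw [hψ, hc, ← hψ, prod_ofFn_contractNth, hφ, smul_zero]
  simp [h0, hl, hm]

lemma range_coherentCochain {Ω : Type*} (b : Module.Basis Ω k A) (n : ℕ) :
    LinearMap.range (coherentCochain b n) = strictlyAutopoietic k b n := by
  ext f
  constructor
  · rintro ⟨γ, rfl⟩ φ
    exact ⟨γ φ, coherentCochain_apply b n γ φ⟩
  · intro hf
    choose γ hγ using hf
    refine ⟨γ, Module.Basis.ext_multilinear (fun _ => b) fun φ => ?_⟩
    rw [coherentCochain_apply, hγ]

end Tuples

/-! ### Simplices of the nerve and tuples of morphisms -/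

section Nerve

open Simplicial

variable {C : Type u} [Category.{v} C]

lemma val_succAbove {n : ℕ} (p : Fin (n + 1)) (i : Fin n) :
    (p.succAbove i : ℕ) = if (i : ℕ) < p then (i : ℕ) else i + 1 := by
  simp only [Fin.succAbove, Fin.lt_def, Fin.val_castSucc]
  split_ifs <;> rfl

/-- The `a`-th vertex of a simplex of the nerve. -/
def nerveObj {n : ℕ} (σ : (nerve C) _⦋n⦌) (a : Fin (n + 1)) : C :=
  (show ComposableArrows C n from σ).obj a

/-- The edge from the `a`-th to the `b`-th vertex of a simplex of the nerve. -/
def nerveEdge {n : ℕ} (σ : (nerve C) _⦋n⦌) (a b : Fin (n + 1)) (h : a ≤ b) : Arrow C :=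
  Arrow.mk ((show ComposableArrows C n from σ).map (homOfLE h))

lemma nerveEdge_congr {n : ℕ} (σ : (nerve C) _⦋n⦌) {a a' b b' : Fin (n + 1)} (ha : a = a')
    (hb : b = b') (h : a ≤ b) (h' : a' ≤ b') : nerveEdge σ a b h = nerveEdge σ a' b' h' := by
  subst ha hb
  rfl

lemma nerveArrows_apply {n : ℕ} (σ : (nerve C) _⦋n⦌) (i : Fin n) :
    nerveArrows C n σ i = nerveEdge σ i.castSucc i.succ (Fin.castSucc_le_succ i) := rfl

lemma nerveObj_map {m n : ℕ} (f : ⦋m⦌ ⟶ ⦋n⦌) (σ : (nerve C) _⦋n⦌) (a : Fin (m + 1)) :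
    nerveObj ((nerve C).map f.op σ) a = nerveObj σ (f.toOrderHom a) := rfl

lemma nerveEdge_map {m n : ℕ} (f : ⦋m⦌ ⟶ ⦋n⦌) (σ : (nerve C) _⦋n⦌) (a b : Fin (m + 1))
    (h : a ≤ b) : nerveEdge ((nerve C).map f.op σ) a b h =
      nerveEdge σ (f.toOrderHom a) (f.toOrderHom b) (f.toOrderHom.monotone h) := rfl

lemma nerveEdge_δ {n : ℕ} (σ : (nerve C) _⦋n + 1⦌) (j : Fin (n + 2)) (a b : Fin (n + 1))
    (h : a ≤ b) : nerveEdge ((nerve C).δ j σ) a b h =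
      nerveEdge σ (j.succAbove a) (j.succAbove b) (Fin.succAbove_le_succAbove_iff.2 h) := rfl

lemma nerveObj_δ {n : ℕ} (σ : (nerve C) _⦋n + 1⦌) (j : Fin (n + 2)) (a : Fin (n + 1)) :
    nerveObj ((nerve C).δ j σ) a = nerveObj σ (j.succAbove a) := rfl

lemma nerveEdge_self {n : ℕ} (σ : (nerve C) _⦋n⦌) (a : Fin (n + 1)) :
    nerveEdge σ a a le_rfl = Arrow.mk (𝟙 (nerveObj σ a)) := by
  simp only [nerveEdge, nerveObj]
  exact congrArg Arrow.mk (CategoryTheory.Functor.map_id _ _)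

/-- The simplex of the nerve obtained by adding a morphism in front. -/
def nerveCons {n : ℕ} (φ : Arrow C) (σ : (nerve C) _⦋n⦌) (h : φ.right = nerveObj σ 0) :
    (nerve C) _⦋n + 1⦌ :=
  (show ComposableArrows C n from σ).precomp (φ.hom ≫ eqToHom h)

lemma nerveArrows_nerveCons {n : ℕ} (φ : Arrow C) (σ : (nerve C) _⦋n⦌)
    (h : φ.right = nerveObj σ 0) :
    nerveArrows C (n + 1) (nerveCons φ σ h) = Fin.cons φ (nerveArrows C n σ) := by
  ext i
  refine Fin.cases ?_ (fun i => ?_) i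
  · obtain ⟨x, y, f⟩ := φ
    change y = _ at h
    subst h
    exact congrArg Arrow.mk (Category.comp_id f)
  · rfl

lemma nerve_ext_zero {σ τ : (nerve C) _⦋0⦌} (h : nerveObj σ 0 = nerveObj τ 0) : σ = τ :=
  ComposableArrows.ext₀ h

lemma nerve_ext_succ {n : ℕ} {σ τ : (nerve C) _⦋n + 1⦌}
    (h : nerveArrows C (n + 1) σ 0 = nerveArrows C (n + 1) τ 0)
    (h' : (nerve C).δ 0 σ = (nerve C).δ 0 τ) : σ = τ := by
  have h0 := congrArg Comma.left h
  have := Arrow.mk_eq_mk_iff _ _ |>.1 h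
  obtain ⟨h1, h2, h3⟩ := this
  exact ComposableArrows.ext_succ h1 h' h3

lemma nerveArrows_δ_zero {n : ℕ} (σ : (nerve C) _⦋n + 1⦌) :
    nerveArrows C n ((nerve C).δ 0 σ) = Fin.tail (nerveArrows C (n + 1) σ) := rfl

/-- Positive degree is essential: the empty tuple of morphisms does not remember the object of a
`0`-simplex. This is why degree `0` is treated separately throughout for categories. -/
lemma nerveArrows_injective (n : ℕ) : Function.Injective (nerveArrows C (n + 1)) := by
  induction n with
  | zero =>
    intro σ τ h
    refine nerve_ext_succ (congrFun h 0) (nerve_ext_zero ?_)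
    exact congrArg Comma.right (congrFun h 0)
  | succ n ih =>
    intro σ τ h
    refine nerve_ext_succ (congrFun h 0) (ih ?_)
    rw [nerveArrows_δ_zero, nerveArrows_δ_zero, h]

lemma nerveArrows_one_surjective : Function.Surjective (nerveArrows C 1) := fun φ => by
  refine ⟨nerveCons (φ 0) (nerveVertex C (φ 0).right) rfl,
    (nerveArrows_nerveCons _ _ _).trans ?_⟩
  ext i
  rw [show i = 0 from Fin.fin_one_eq_zero i]
  rfl

end Nerve

/-! ### The category algebra -/

namespace CategoryAlgebra

open Simplicial

variable {k : Type w} [CommRing k] {C : Type u} [Category.{v} C]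

lemma basis_mul_basis_of_comp {X Y Z : C} (f : X ⟶ Y) (g : Y ⟶ Z) :
    basis k C (Arrow.mk f) * basis k C (Arrow.mk g) = basis k C (Arrow.mk (f ≫ g)) := by
  rw [basis_mul_basis, arrowMul_of_comp]

lemma basis_mul_basis_of_ne {f g : Arrow C} (h : f.right ≠ g.left) :
    basis k C f * basis k C g = 0 := by
  rw [basis_mul_basis]
  exact arrowMul_of_ne f.hom g.hom h

lemma exists_basis_mul_basis {f g : Arrow C} (h : f.right = g.left) :
    ∃ l : Arrow C, l.left = f.left ∧ l.right = g.right ∧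
      basis k C f * basis k C g = basis k C l := by
  obtain ⟨x, y, f⟩ := f
  obtain ⟨y', z, g⟩ := g
  change y = y' at h
  subst h
  exact ⟨Arrow.mk (f ≫ g), rfl, rfl, basis_mul_basis_of_comp f g⟩

lemma basis_mul_basis_eq_zero_or (f g : Arrow C) :
    basis k C f * basis k C g = 0 ∨ ∃ l, basis k C f * basis k C g = basis k C l := by
  by_cases h : f.right = g.left
  · obtain ⟨l, -, -, hl⟩ := exists_basis_mul_basis (k := k) h
    exact Or.inr ⟨l, hl⟩
  · exact Or.inl (basis_mul_basis_of_ne h)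

variable (k) in
/-- The idempotent of `k[C]` given by an object. -/
def idem (x : C) : CategoryAlgebra k C := basis k C (Arrow.mk (𝟙 x))

open Classical in
lemma idem_mul_basis (x : C) (f : Arrow C) :
    idem k x * basis k C f = if f.left = x then basis k C f else 0 := by
  split_ifs with h
  · obtain ⟨y, z, f⟩ := f
    change y = x at h
    subst h
    exact (basis_mul_basis_of_comp (𝟙 y) f).trans
      (congrArg (fun g => basis k C (Arrow.mk g)) (Category.id_comp f))
  · exact basis_mul_basis_of_ne fun h' => h h'.symm

open Classical in
lemma basis_mul_idem (x : C) (f : Arrow C) :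
    basis k C f * idem k x = if f.right = x then basis k C f else 0 := by
  split_ifs with h
  · obtain ⟨y, z, f⟩ := f
    change z = x at h
    subst h
    exact (basis_mul_basis_of_comp f (𝟙 z)).trans
      (congrArg (fun g => basis k C (Arrow.mk g)) (Category.comp_id f))
  · exact basis_mul_basis_of_ne fun h' => h h'

lemma idem_mul_self (x : C) : idem k x * idem k x = idem k x := by
  simp [idem, basis_mul_basis_of_comp]

lemma sum_idem [Fintype C] : ∑ x : C, idem k x = (1 : CategoryAlgebra k C) := rfl

lemma edge_mul_edge {n : ℕ} (σ : (nerve C) _⦋n⦌) {a b c : Fin (n + 1)} (h : a ≤ b) (h' : b ≤ c) :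
    basis k C (nerveEdge σ a b h) * basis k C (nerveEdge σ b c h') =
      basis k C (nerveEdge σ a c (h.trans h')) :=
  (basis_mul_basis_of_comp _ _).trans (by rw [← Functor.map_comp]; rfl)

lemma prod_nerveArrows [Fintype C] (n : ℕ) (σ : (nerve C) _⦋n + 1⦌) :
    (List.ofFn fun i => basis k C (nerveArrows C (n + 1) σ i)).prod =
      basis k C (nerveEdge σ 0 (Fin.last (n + 1)) (Fin.zero_le _)) := by
  induction n with
  | zero =>
    simp
    rfl
  | succ n ih =>
    rw [List.ofFn_succ, List.prod_cons]
    have h := ih ((nerve C).δ 0 σ)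
    rw [nerveArrows_δ_zero] at h
    exact (congrArg _ h).trans (edge_mul_edge σ _ _)

/-- Either the tail is already non-composable, or its product is the long edge of a simplex and the
first morphism fails to compose with that edge. -/
lemma prod_eq_zero_of_notMem_range [Fintype C] (n : ℕ) (φ : Fin (n + 1) → Arrow C)
    (h : φ ∉ Set.range (nerveArrows C (n + 1))) :
    (List.ofFn fun i => basis k C (φ i)).prod = 0 := by
  induction n with
  | zero => exact (h (nerveArrows_one_surjective φ)).elim
  | succ n ih =>
    rw [List.ofFn_succ, List.prod_cons]
    by_cases h' : Fin.tail φ ∈ Set.range (nerveArrows C (n + 1))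
    · obtain ⟨τ, hτ⟩ := h'
      have hτ' : ∀ i : Fin (n + 1), φ i.succ = nerveArrows C (n + 1) τ i :=
        fun i => (congrFun hτ i).symm
      simp only [hτ', prod_nerveArrows]
      refine basis_mul_basis_of_ne fun h0 => h ⟨nerveCons (φ 0) τ h0,
        (nerveArrows_nerveCons _ _ _).trans ?_⟩
      rw [hτ, Fin.cons_self_tail]
    · rw [show (List.ofFn fun i : Fin (n + 1) => basis k C (φ i.succ)).prod = 0 from
        ih _ h', mul_zero]

variable (k C) in
lemma isFaceCompatible [Fintype C] : IsFaceCompatible (X := nerve C)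
    fun n σ i => basis k C (nerveArrows C n σ i) where
  zero n σ := rfl
  last n σ := by
    ext i
    simp only [nerveArrows_apply, nerveEdge_δ]
    exact congrArg _ (nerveEdge_congr σ (by simp) (by simp) _ _)
  mid n σ j := by
    ext i
    simp only [nerveArrows_apply, nerveEdge_δ, Fin.contractNth, Fin.val_castSucc]
    split_ifs with h1 h2
    · refine congrArg _ (nerveEdge_congr σ ?_ ?_ _ _)
      all_goals
        simp only [Fin.ext_iff, val_succAbove, Fin.val_castSucc, Fin.val_succ]
        split_ifs <;> omega
    · refine Eq.trans ?_ (edge_mul_edge σ _ (Fin.castSucc_le_succ i.succ)).symm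
      refine congrArg _ (nerveEdge_congr σ ?_ ?_ _ _)
      all_goals
        simp only [Fin.ext_iff, val_succAbove, Fin.val_castSucc, Fin.val_succ]
        split_ifs <;> omega
    · refine congrArg _ (nerveEdge_congr σ ?_ ?_ _ _)
      all_goals
        simp only [Fin.ext_iff, val_succAbove, Fin.val_castSucc, Fin.val_succ]
        split_ifs <;> omega

end CategoryAlgebra

/-! ### The map `Ψ` of a category -/

section CategoryPsi

open Simplicial CategoryAlgebra

variable {k : Type w} [CommRing k] {C : Type u} [Category.{v} C] [Fintype C]

lemma categoryPsi_zero_apply (γ : SimplicialCochain k (nerve C) 0)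
    (a : Fin 0 → CategoryAlgebra k C) :
    categoryPsi k C 0 γ a = ∑ x : C, γ (nerveVertex C x) • idem k x := rfl

lemma categoryPsi_succ_apply_basis (n : ℕ) (γ : SimplicialCochain k (nerve C) (n + 1))
    (φ : Fin (n + 1) → Arrow C) :
    categoryPsi k C (n + 1) γ (fun i => basis k C (φ i)) =
      Function.extend (nerveArrows C (n + 1)) γ 0 φ •
        (List.ofFn fun i => basis k C (φ i)).prod :=
  coherentCochain_apply _ _ _ _

lemma categoryPsi_succ_apply_simplex (n : ℕ) (γ : SimplicialCochain k (nerve C) (n + 1))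
    (σ : (nerve C) _⦋n + 1⦌) :
    categoryPsi k C (n + 1) γ (fun i => basis k C (nerveArrows C (n + 1) σ i)) =
      γ σ • (List.ofFn fun i => basis k C (nerveArrows C (n + 1) σ i)).prod := by
  rw [categoryPsi_succ_apply_basis, (nerveArrows_injective n).extend_apply]

lemma categoryPsi_succ_apply_of_notMem_range (n : ℕ) (γ : SimplicialCochain k (nerve C) (n + 1))
    {φ : Fin (n + 1) → Arrow C} (h : φ ∉ Set.range (nerveArrows C (n + 1))) :
    categoryPsi k C (n + 1) γ (fun i => basis k C (φ i)) = 0 := by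
  rw [categoryPsi_succ_apply_basis, prod_eq_zero_of_notMem_range n φ h, smul_zero]

lemma nerveVertex_nerveObj (σ : (nerve C) _⦋0⦌) : nerveVertex C (nerveObj σ 0) = σ :=
  nerve_ext_zero rfl

/-- Two cochains of positive degree agree if they agree on composable morphisms and vanish on
other tuples. -/
lemma hochschildCochain_ext {n : ℕ} {f g : HochschildCochain k (CategoryAlgebra k C) (n + 1)}
    (h : ∀ σ : (nerve C) _⦋n + 1⦌, f (fun i => basis k C (nerveArrows C (n + 1) σ i)) =
      g (fun i => basis k C (nerveArrows C (n + 1) σ i)))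
    (hf : ∀ φ, φ ∉ Set.range (nerveArrows C (n + 1)) → f (fun i => basis k C (φ i)) = 0)
    (hg : ∀ φ, φ ∉ Set.range (nerveArrows C (n + 1)) → g (fun i => basis k C (φ i)) = 0) :
    f = g := by
  refine Module.Basis.ext_multilinear (fun _ => basis k C) fun φ => ?_
  by_cases hφ : φ ∈ Set.range (nerveArrows C (n + 1))
  · obtain ⟨σ, rfl⟩ := hφ
    exact h σ
  · rw [hf φ hφ, hg φ hφ]

lemma idem_mul_sum (c : C → k) (x : C) : idem k x * ∑ y, c y • idem k y = c x • idem k x := by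
  classical
  rw [Finset.mul_sum, Finset.sum_eq_single x]
  · rw [mul_smul_comm, idem_mul_self]
  · intro y _ hy
    rw [mul_smul_comm, idem, idem, basis_mul_basis_of_ne (fun h => hy h.symm), smul_zero]
  · simp

lemma basis_mul_sum_idem (c : C → k) (φ : Arrow C) :
    basis k C φ * ∑ y, c y • idem k y = c φ.right • basis k C φ := by
  classical
  simp [Finset.mul_sum, basis_mul_idem]

lemma sum_idem_mul_basis (c : C → k) (φ : Arrow C) :
    (∑ y, c y • idem k y) * basis k C φ = c φ.left • basis k C φ := by
  classical
  simp [Finset.sum_mul, idem_mul_basis]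

lemma hochschildD_zero_apply {A : Type v} [Ring A] [Algebra k A] (f : HochschildCochain k A 0)
    (a : Fin 1 → A) : hochschildD k A 0 f a = a 0 * f Fin.elim0 - f Fin.elim0 * a 0 := by
  rw [hochschildD_eq, hochschildTail_zero, sub_eq_add_neg,
    Subsingleton.elim (Fin.tail a) Fin.elim0]

/-- On composable tuples this is the face-by-face comparison; on the others both sides vanish with
the product. In degree `0` a weighted sum of identities acts on a morphism by the weight of its
target on one side and of its source on the other. -/
lemma hochschildD_categoryPsi (n : ℕ) (γ : SimplicialCochain k (nerve C) n) :
    hochschildD k (CategoryAlgebra k C) n (categoryPsi k C n γ) =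
      categoryPsi k C (n + 1) (simplicialD k (nerve C) n γ) := by
  cases n with
  | zero =>
    refine Module.Basis.ext_multilinear (fun _ => basis k C) fun φ => ?_
    rw [hochschildD_zero_apply, categoryPsi_zero_apply, basis_mul_sum_idem, sum_idem_mul_basis]
    obtain ⟨σ, rfl⟩ := nerveArrows_one_surjective φ
    rw [categoryPsi_succ_apply_simplex, simplicialD_apply]
    simp only [List.ofFn_succ, List.ofFn_zero, List.prod_cons, List.prod_nil, mul_one]
    rw [← sub_smul, ← nerveVertex_nerveObj ((nerve C).δ 0 σ),
      ← nerveVertex_nerveObj ((nerve C).δ (Fin.last 1) σ)]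
    simp [sub_eq_add_neg]
    rfl
  | succ n =>
    refine hochschildCochain_ext (fun σ => ?_) (fun φ hφ => ?_)
      fun φ hφ => categoryPsi_succ_apply_of_notMem_range _ _ hφ
    · rw [categoryPsi_succ_apply_simplex]
      exact (isFaceCompatible k C).hochschildD_of_prod _ γ
        (categoryPsi_succ_apply_simplex n γ) σ
    · refine hochschildD_eq_zero_of_prod_eq_zero _ basis_mul_basis_eq_zero_or
        (fun ψ => ⟨_, categoryPsi_succ_apply_basis n γ ψ⟩) φ
        (prod_eq_zero_of_notMem_range _ φ hφ)

lemma range_categoryPsi (n : ℕ) :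
    LinearMap.range (categoryPsi k C n) = categoryAutopoietic k C n := by
  cases n with
  | zero =>
    ext f
    change _ ↔ f Fin.elim0 ∈ Submodule.span k (Set.range fun x : C => idem k x)
    rw [Submodule.mem_span_range_iff_exists_fun]
    constructor
    · rintro ⟨γ, rfl⟩
      exact ⟨fun x => γ (nerveVertex C x), rfl⟩
    · rintro ⟨c, hc⟩
      refine ⟨fun σ => c (nerveObj σ 0), ?_⟩
      ext a
      rw [categoryPsi_zero_apply, Subsingleton.elim a Fin.elim0, ← hc]
      rfl
  | succ n =>
    refine le_antisymm ?_ fun f hf => ?_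
    · rintro _ ⟨γ, rfl⟩ φ
      exact ⟨_, categoryPsi_succ_apply_basis n γ φ⟩
    · choose c hc using hf
      -- Only the scalars on composable tuples are kept; the others multiply a zero product.
      refine ⟨fun σ => c (nerveArrows C (n + 1) σ), hochschildCochain_ext (fun σ => ?_)
        (fun φ hφ => categoryPsi_succ_apply_of_notMem_range _ _ hφ) fun φ hφ => ?_⟩
      · rw [categoryPsi_succ_apply_simplex, hc]
      · rw [hc, prod_eq_zero_of_notMem_range n φ hφ, smul_zero]

lemma categoryPsi_one : categoryPsi k C 0 (fun _ => 1) Fin.elim0 = 1 := by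
  simp [categoryPsi_zero_apply, sum_idem]

/-! ### The retraction of `Ψ` -/

open Classical in
variable (k) in
/-- The sum of the coefficients at the morphisms from `x` to `y`. -/
def coeffSum (x y : C) : CategoryAlgebra k C →ₗ[k] k :=
  (basis k C).constr k fun φ => if φ.left = x ∧ φ.right = y then 1 else 0

open Classical in
lemma coeffSum_basis (x y : C) (φ : Arrow C) :
    coeffSum k x y (basis k C φ) = if φ.left = x ∧ φ.right = y then 1 else 0 := by
  simp [coeffSum]

open Classical in
-- Composition with `φ` sends each morphism from the target of `φ` to `y` to one from the source of
-- `φ` to `y`. It may identify morphisms, but their total coefficient is unchanged.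
lemma coeffSum_basis_mul (y : C) (φ : Arrow C) (z : CategoryAlgebra k C) :
    coeffSum k φ.left y (basis k C φ * z) = coeffSum k φ.right y z := by
  revert z
  rw [← funext_iff]
  refine congrArg DFunLike.coe ((basis k C).ext (f₁ := coeffSum k φ.left y ∘ₗ
    LinearMap.mulLeft k (basis k C φ)) (f₂ := coeffSum k φ.right y) fun ψ => ?_)
  simp only [LinearMap.comp_apply, LinearMap.mulLeft_apply]
  by_cases h : φ.right = ψ.left
  · obtain ⟨l, h1, h2, h3⟩ := exists_basis_mul_basis (k := k) h
    rw [h3, coeffSum_basis, coeffSum_basis, h1, h2, h]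
    exact if_congr (and_congr_left fun _ => iff_of_true rfl rfl) rfl rfl
  · rw [basis_mul_basis_of_ne h, map_zero, coeffSum_basis, if_neg fun h' => h h'.1.symm]

open Classical in
lemma coeffSum_mul_basis (x : C) (φ : Arrow C) (z : CategoryAlgebra k C) :
    coeffSum k x φ.right (z * basis k C φ) = coeffSum k x φ.left z := by
  revert z
  rw [← funext_iff]
  refine congrArg DFunLike.coe ((basis k C).ext (f₁ := coeffSum k x φ.right ∘ₗ
    LinearMap.mulRight k (basis k C φ)) (f₂ := coeffSum k x φ.left) fun ψ => ?_)
  simp only [LinearMap.comp_apply, LinearMap.mulRight_apply]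
  by_cases h : ψ.right = φ.left
  · obtain ⟨l, h1, h2, h3⟩ := exists_basis_mul_basis (k := k) h
    rw [h3, coeffSum_basis, coeffSum_basis, h1, h2, h]
    exact if_congr (and_congr_right fun _ => iff_of_true rfl rfl) rfl rfl
  · rw [basis_mul_basis_of_ne h, map_zero, coeffSum_basis, if_neg fun h' => h h'.2]

variable (k C) in
/-- The map from Hochschild cochains of `k[C]` to simplicial cochains of the nerve of `C` which
sums the coefficients of the values on composable morphisms. -/
def categoryRho (n : ℕ) :
    HochschildCochain k (CategoryAlgebra k C) n →ₗ[k] SimplicialCochain k (nerve C) n where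
  toFun f := fun σ => coeffSum k (nerveObj σ 0) (nerveObj σ (Fin.last n))
    (f fun i => basis k C (nerveArrows C n σ i))
  map_add' f g := by ext σ; simp
  map_smul' c f := by ext σ; simp

lemma categoryRho_apply (n : ℕ) (f : HochschildCochain k (CategoryAlgebra k C) n)
    (σ : (nerve C) _⦋n⦌) : categoryRho k C n f σ =
      coeffSum k (nerveObj σ 0) (nerveObj σ (Fin.last n))
        (f fun i => basis k C (nerveArrows C n σ i)) := rfl

lemma simplicialD_categoryRho (n : ℕ) (f : HochschildCochain k (CategoryAlgebra k C) n) :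
    simplicialD k (nerve C) n (categoryRho k C n f) =
      categoryRho k C (n + 1) (hochschildD k (CategoryAlgebra k C) n f) := by
  refine (isFaceCompatible k C).simplicialD_of_linear
    (fun n σ => coeffSum k (nerveObj σ 0) (nerveObj σ (Fin.last n))) ?_ ?_ ?_ f
  · intro n σ z
    exact coeffSum_basis_mul _ (nerveArrows C (n + 1) σ 0) z
  · intro n σ z
    rw [nerveObj_δ, nerveObj_δ]
    simp only [Fin.succAbove_last, Fin.castSucc_zero]
    exact coeffSum_mul_basis _ (nerveArrows C (n + 1) σ (Fin.last n)) z
  · intro n σ j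
    rw [nerveObj_δ, nerveObj_δ]
    congr 2
    · ext
      simp only [val_succAbove, Fin.val_last, Fin.val_succ, Fin.val_castSucc]
      split_ifs <;> omega

/-- The value of `Ψ(γ)` on a simplex of positive degree is a multiple of a single morphism, the long
edge, whose coefficient sum is `1`; in degree `0` only the identity of the vertex contributes. -/
lemma categoryRho_categoryPsi (n : ℕ) (γ : SimplicialCochain k (nerve C) n) :
    categoryRho k C n (categoryPsi k C n γ) = γ := by
  ext σ
  rw [categoryRho_apply]
  cases n with
  | zero =>
    rw [categoryPsi_zero_apply, map_sum, Finset.sum_eq_single (nerveObj σ 0)]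
    · rw [nerveVertex_nerveObj, map_smul, idem, coeffSum_basis, if_pos ⟨rfl, rfl⟩]
      simp
    · intro x _ hx
      rw [map_smul, idem, coeffSum_basis, if_neg fun h => hx h.1, smul_zero]
    · simp
  | succ n =>
    rw [categoryPsi_succ_apply_simplex, prod_nerveArrows, map_smul, coeffSum_basis,
      if_pos ⟨rfl, rfl⟩, smul_eq_mul, mul_one]

lemma categoryPsi_injective (n : ℕ) : Function.Injective (categoryPsi k C n) :=
  Function.LeftInverse.injective (categoryRho_categoryPsi n)

end CategoryPsi

/-! ### Normalised cocycles -/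

section Normalised

open Simplicial CategoryAlgebra

variable {k : Type w} [CommRing k] {C : Type u} [Category.{v} C] [Fintype C]

/-- The idempotents inserted between the arguments kill every tuple that is not composable. The left
factor `c` is arbitrary because the recursion moves the starting object while the idempotent on the
far left stays the same. -/
lemma mul_normalizationFrom_eq_zero (n : ℕ) : ∀ (x : C) (c : CategoryAlgebra k C)
    (f : HochschildCochain k (CategoryAlgebra k C) n),
    (∀ σ : (nerve C) _⦋n⦌, nerveObj σ 0 = x →
      c * (f (fun i => basis k C (nerveArrows C n σ i)) * idem k (nerveObj σ (Fin.last n))) = 0) →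
    ∀ φ : Fin n → Arrow C,
      c * normalizationFrom (idem k) n x f (fun i => basis k C (φ i)) = 0 := by
  classical
  induction n with
  | zero =>
    intro x c f h φ
    have := h (nerveVertex C x) rfl
    rwa [Subsingleton.elim (fun i => basis k C (nerveArrows C 0 (nerveVertex C x) i))
      (fun i => basis k C (φ i))] at this
  | succ n ih =>
    intro x c f h φ
    change c * ∑ y, normalizationFrom (idem k) n y
      (f.curryLeft (idem k x * basis k C (φ 0) * idem k y)) (fun i => basis k C (φ i.succ)) = 0
    rw [Finset.mul_sum]
    refine Finset.sum_eq_zero fun y _ => ih y c _ (fun τ hτ => ?_) fun i => φ i.succ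
    rw [idem_mul_basis]
    split_ifs with h1
    · rw [basis_mul_idem]
      split_ifs with h2
      · have := h (nerveCons (φ 0) τ (h2.trans hτ.symm)) h1
        have hcons : (fun i => basis k C (nerveArrows C (n + 1)
            (nerveCons (φ 0) τ (h2.trans hτ.symm)) i)) = Fin.cons (basis k C (φ 0))
              fun i => basis k C (nerveArrows C n τ i) := by
          rw [nerveArrows_nerveCons]
          funext i
          refine Fin.cases ?_ (fun i => ?_) i <;> rfl
        rw [hcons] at this
        exact this
      · simp
    · simp

/-- A Hochschild cocycle of a category algebra is a coboundary if the components of its values on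
composable morphisms from the source to the target vanish. -/
lemma mem_coboundaries_of_idem_mul_idem {n : ℕ}
    {f : HochschildCochain k (CategoryAlgebra k C) n}
    (hf : f ∈ cocycles (hochschildD k (CategoryAlgebra k C)) n)
    (h : ∀ σ : (nerve C) _⦋n⦌, idem k (nerveObj σ 0) *
      (f (fun i => basis k C (nerveArrows C n σ i)) * idem k (nerveObj σ (Fin.last n))) = 0) :
    f ∈ coboundaries (hochschildD k (CategoryAlgebra k C)) n := by
  have key : ∀ φ : Fin n → Arrow C, ∑ x, idem k x *
      normalizationFrom (idem k) n x f (fun i => basis k C (φ i)) = 0 := fun φ =>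
    Finset.sum_eq_zero fun x _ => mul_normalizationFrom_eq_zero n x _ f
      (fun σ hσ => hσ ▸ h σ) φ
  cases n with
  | zero =>
    change f = 0
    ext a
    have h0 := key Fin.elim0
    -- In degree `0` there are no nonzero coboundaries, so `f` itself must vanish. Being a cocycle
    -- it is central, hence equal to the sum of its diagonal components, which are zero by
    -- hypothesis.
    have h1 : ∀ x : C, idem k x * f a = f a * idem k x := fun x => by
      have := congrArg (fun g => g fun _ => idem k x) hf
      simp only [hochschildD_zero_apply, zero_apply, sub_eq_zero] at this
      rwa [Subsingleton.elim a Fin.elim0]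
    have h2 : ∀ x : C, idem k x * (f a * idem k x) = idem k x * f a := fun x => by
      rw [← h1, ← mul_assoc, idem_mul_self]
    rw [zero_apply, ← one_mul (f a), ← sum_idem, Finset.sum_mul, ← h0]
    refine Finset.sum_congr rfl fun x _ => ?_
    rw [← h2, Subsingleton.elim a fun i => basis k C (Fin.elim0 i)]
    rfl
  | succ n =>
    obtain ⟨g, hg⟩ := exists_eq_hochschildD_add_normalization (idem k) sum_idem idem_mul_self n f hf
    refine ⟨g, Module.Basis.ext_multilinear (fun _ => basis k C) fun φ => ?_⟩
    rw [hg, key, add_zero]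

end Normalised

/-! ### Products -/

section Products

open Simplicial CategoryAlgebra

lemma nerveArrows_right {C : Type u} [Category.{v} C] {n : ℕ} (σ : (nerve C) _⦋n⦌) (i : Fin n) :
    (nerveArrows C n σ i).right = nerveObj σ i.succ := rfl

lemma nerveArrows_left {C : Type u} [Category.{v} C] {n : ℕ} (σ : (nerve C) _⦋n⦌) (i : Fin n) :
    (nerveArrows C n σ i).left = nerveObj σ i.castSucc := rfl

lemma mem_range_nerveArrows_iff {C : Type u} [Category.{v} C] (n : ℕ) (φ : Fin (n + 1) → Arrow C) :
    φ ∈ Set.range (nerveArrows C (n + 1)) ↔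
      ∀ i j : Fin (n + 1), (i : ℕ) + 1 = j → (φ i).right = (φ j).left := by
  constructor
  · rintro ⟨σ, rfl⟩ i j h
    rw [nerveArrows_right, nerveArrows_left]
    congr 1
    ext
    simpa using h
  · induction n with
    | zero => exact fun _ => nerveArrows_one_surjective φ
    | succ n ih =>
      intro h
      obtain ⟨τ, hτ⟩ := ih (Fin.tail φ) fun i j hij => h i.succ j.succ (by simpa using hij)
      have h0 : (φ 0).right = nerveObj τ 0 :=
        (h 0 1 rfl).trans (congrArg Comma.left (congrFun hτ 0)).symm
      refine ⟨nerveCons (φ 0) τ h0, (nerveArrows_nerveCons _ _ _).trans ?_⟩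
      rw [hτ, Fin.cons_self_tail]

variable {k : Type w} [CommRing k]

/-! ### Cup product and Gerstenhaber product -/

section Cup

variable {C : Type u} [Category.{v} C] [Fintype C]

lemma nerveArrows_subinterval {n : ℕ} (σ : (nerve C) _⦋n⦌) (j l : ℕ) (h : j + l ≤ n) (i : Fin l) :
    nerveArrows C l ((nerve C).map (SimplexCategory.subinterval j l h).op σ) i =
      nerveArrows C n σ ⟨j + i, by omega⟩ := by
  refine nerveEdge_congr σ ?_ ?_ _ _ <;> ext <;> change (_ : ℕ) + j = _ <;> simp <;> omega

lemma nerveEdge_subinterval {n : ℕ} (σ : (nerve C) _⦋n⦌) (j l : ℕ) (h : j + l ≤ n) :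
    nerveEdge ((nerve C).map (SimplexCategory.subinterval j l h).op σ) 0 (Fin.last l)
      (Fin.zero_le _) = nerveEdge σ ⟨j, by omega⟩ ⟨j + l, by omega⟩ (by simp) := by
  refine nerveEdge_congr σ ?_ ?_ _ _ <;> ext <;> change (_ : ℕ) + j = _ <;> simp <;> omega

lemma nerveObj_subinterval {n : ℕ} (σ : (nerve C) _⦋n⦌) (j l : ℕ) (h : j + l ≤ n)
    (a : Fin (l + 1)) :
    nerveObj ((nerve C).map (SimplexCategory.subinterval j l h).op σ) a =
      nerveObj σ ⟨j + a, by omega⟩ := by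
  rw [nerveObj_map]
  congr 1
  ext
  change (_ : ℕ) + j = _
  simp
  omega

lemma categoryPsi_succ_apply_edge (n : ℕ) (γ : SimplicialCochain k (nerve C) (n + 1))
    (σ : (nerve C) _⦋n + 1⦌) :
    categoryPsi k C (n + 1) γ (fun i => basis k C (nerveArrows C (n + 1) σ i)) =
      γ σ • basis k C (nerveEdge σ 0 (Fin.last (n + 1)) (Fin.zero_le _)) := by
  rw [categoryPsi_succ_apply_simplex, prod_nerveArrows]

/-- Makes degree `0` behave like positive degrees: although `Ψ(γ)` is then a sum over all objects,
multiplying by a morphism selects the single summand at its source. -/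
lemma categoryPsi_mul_basis (n : ℕ) (γ : SimplicialCochain k (nerve C) n)
    (σ : (nerve C) _⦋n⦌) (χ : Arrow C) (h : nerveObj σ (Fin.last n) = χ.left) :
    categoryPsi k C n γ (fun i => basis k C (nerveArrows C n σ i)) * basis k C χ =
      γ σ • (basis k C (nerveEdge σ 0 (Fin.last n) (Fin.zero_le _)) * basis k C χ) := by
  classical
  cases n with
  | zero =>
    have h0 : nerveEdge σ 0 (Fin.last 0) (Fin.zero_le _) = Arrow.mk (𝟙 χ.left) :=
      (nerveEdge_self σ 0).trans (by rw [← h]; rfl)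
    have h1 : idem k χ.left * basis k C χ = basis k C χ := by rw [idem_mul_basis, if_pos rfl]
    have h2 : nerveVertex C χ.left = σ := nerve_ext_zero h.symm
    rw [categoryPsi_zero_apply, sum_idem_mul_basis, h0, ← idem, h1, h2]
  | succ n => rw [categoryPsi_succ_apply_edge, smul_mul_assoc]

lemma basis_mul_categoryPsi (n : ℕ) (γ : SimplicialCochain k (nerve C) n)
    (σ : (nerve C) _⦋n⦌) (χ : Arrow C) (h : χ.right = nerveObj σ 0) :
    basis k C χ * categoryPsi k C n γ (fun i => basis k C (nerveArrows C n σ i)) =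
      γ σ • (basis k C χ * basis k C (nerveEdge σ 0 (Fin.last n) (Fin.zero_le _))) := by
  classical
  cases n with
  | zero =>
    have h0 : nerveEdge σ 0 (Fin.last 0) (Fin.zero_le _) = Arrow.mk (𝟙 χ.right) :=
      (nerveEdge_self σ 0).trans (by rw [h])
    have h1 : basis k C χ * idem k χ.right = basis k C χ := by rw [basis_mul_idem, if_pos rfl]
    have h2 : nerveVertex C χ.right = σ := nerve_ext_zero h
    rw [categoryPsi_zero_apply, basis_mul_sum_idem, h0, ← idem, h1, h2]
  | succ n => rw [categoryPsi_succ_apply_edge, mul_smul_comm]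

lemma gerstenhaberProduct_apply_simplex {p q : ℕ} (f : HochschildCochain k (CategoryAlgebra k C) p)
    (g : HochschildCochain k (CategoryAlgebra k C) q) (σ : (nerve C) _⦋p + q⦌) :
    gerstenhaberProduct f g (fun i => basis k C (nerveArrows C (p + q) σ i)) =
      f (fun i => basis k C (nerveArrows C p
        ((nerve C).map (SimplexCategory.subinterval 0 p (by lia)).op σ) i)) *
      g (fun i => basis k C (nerveArrows C q
        ((nerve C).map (SimplexCategory.subinterval p q le_rfl).op σ) i)) := by
  simp only [nerveArrows_subinterval, zero_add]
  rfl

lemma edge_front_mul_edge_back {p q : ℕ} (σ : (nerve C) _⦋p + q⦌) :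
    basis k C (nerveEdge ((nerve C).map (SimplexCategory.subinterval 0 p (by lia)).op σ) 0
        (Fin.last p) (Fin.zero_le _)) *
      basis k C (nerveEdge ((nerve C).map (SimplexCategory.subinterval p q le_rfl).op σ) 0
        (Fin.last q) (Fin.zero_le _)) =
      basis k C (nerveEdge σ 0 (Fin.last (p + q)) (Fin.zero_le _)) := by
  rw [nerveEdge_subinterval, nerveEdge_subinterval]
  refine Eq.trans ?_ (edge_mul_edge σ (b := ⟨p, by omega⟩) (by simp)
    (by simp [Fin.le_def]))
  congr 2
  exact nerveEdge_congr σ rfl (by simp) _ _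

lemma nerveObj_front_last {p q : ℕ} (σ : (nerve C) _⦋p + q⦌) :
    nerveObj ((nerve C).map (SimplexCategory.subinterval 0 p (by lia)).op σ) (Fin.last p) =
      nerveObj ((nerve C).map (SimplexCategory.subinterval p q le_rfl).op σ) 0 := by
  rw [nerveObj_subinterval, nerveObj_subinterval]
  simp

/-- A factor of positive degree evaluates to a multiple of an edge, which then serves as the
morphism absorbing a possible degree `0` value of the other factor. The next lemma treats the mirror
case. -/
lemma gerstenhaberProduct_succ_apply_simplex {p q : ℕ} (α : SimplicialCochain k (nerve C) p)
    (β : SimplicialCochain k (nerve C) (q + 1)) (σ : (nerve C) _⦋p + (q + 1)⦌) :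
    gerstenhaberProduct (categoryPsi k C p α) (categoryPsi k C (q + 1) β)
      (fun i => basis k C (nerveArrows C (p + (q + 1)) σ i)) =
      simplicialCup α β σ • basis k C (nerveEdge σ 0 (Fin.last (p + (q + 1))) (Fin.zero_le _)) := by
  rw [gerstenhaberProduct_apply_simplex, categoryPsi_succ_apply_edge, mul_smul_comm,
    categoryPsi_mul_basis _ _ _ _ (nerveObj_front_last σ), smul_smul,
    edge_front_mul_edge_back, mul_comm (β _)]
  rfl

lemma gerstenhaberProduct_zero_apply_simplex {p : ℕ} (α : SimplicialCochain k (nerve C) (p + 1))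
    (β : SimplicialCochain k (nerve C) 0) (σ : (nerve C) _⦋p + 1 + 0⦌) :
    gerstenhaberProduct (categoryPsi k C (p + 1) α) (categoryPsi k C 0 β)
      (fun i => basis k C (nerveArrows C (p + 1 + 0) σ i)) =
      simplicialCup α β σ • basis k C (nerveEdge σ 0 (Fin.last (p + 1 + 0)) (Fin.zero_le _)) := by
  rw [gerstenhaberProduct_apply_simplex, categoryPsi_succ_apply_edge, smul_mul_assoc,
    basis_mul_categoryPsi _ _ _ _ (nerveObj_front_last (p := p + 1) (q := 0) σ), smul_smul,
    edge_front_mul_edge_back]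
  rfl

lemma categoryPsi_simplicialCup (p q : ℕ) (α : SimplicialCochain k (nerve C) p)
    (β : SimplicialCochain k (nerve C) q) :
    categoryPsi k C (p + q) (simplicialCup α β) =
      gerstenhaberProduct (categoryPsi k C p α) (categoryPsi k C q β) := by
  cases q with
  | zero =>
    cases p with
    | zero =>
      ext a
      change ∑ x : C, simplicialCup α β (nerveVertex C x) • idem k x =
        (∑ x : C, α (nerveVertex C x) • idem k x) * ∑ x : C, β (nerveVertex C x) • idem k x
      rw [Finset.sum_mul]
      refine Finset.sum_congr rfl fun x _ => ?_
      rw [smul_mul_assoc, idem_mul_sum, smul_smul]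
      rfl
    | succ p =>
      refine hochschildCochain_ext (fun σ => ?_)
        (fun φ hφ => categoryPsi_succ_apply_of_notMem_range _ _ hφ) fun φ hφ => ?_
      · exact (categoryPsi_succ_apply_edge p _ σ).trans
          (gerstenhaberProduct_zero_apply_simplex α β σ).symm
      · change categoryPsi k C (p + 1) α (fun i => basis k C (φ i)) * _ = 0
        rw [categoryPsi_succ_apply_of_notMem_range _ _ hφ, zero_mul]
  | succ q =>
    refine hochschildCochain_ext (n := p + q) (fun σ => ?_)
      (fun φ hφ => categoryPsi_succ_apply_of_notMem_range (p + q) _ hφ) fun φ hφ => ?_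
    · exact (categoryPsi_succ_apply_edge (p + q) _ σ).trans
        (gerstenhaberProduct_succ_apply_simplex α β σ).symm
    · change categoryPsi k C p α (fun i => basis k C (φ (Fin.castAdd (q + 1) i))) *
        categoryPsi k C (q + 1) β (fun i => basis k C (φ (Fin.natAdd p i))) = 0
      -- The two blocks may each be composable although the whole tuple is not, so it is the product
      -- of the two block products that is shown to vanish.
      have h := prod_eq_zero_of_notMem_range (k := k) (p + q) φ hφ
      have h' : (List.ofFn fun i => basis k C (φ (Fin.castAdd (q + 1) i))).prod *
          (List.ofFn fun i : Fin (q + 1) => basis k C (φ (Fin.natAdd p i))).prod = 0 := by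
        rw [← List.prod_append]
        refine Eq.trans ?_ h
        congr 1
        exact (List.ofFn_add (n := p) (m := q + 1) (f := fun i => basis k C (φ i))).symm
      rw [categoryPsi_succ_apply_basis]
      cases p with
      | zero =>
        rw [List.ofFn_zero, List.prod_nil, one_mul] at h'
        rw [h', smul_zero, mul_zero]
      | succ p => rw [categoryPsi_succ_apply_basis, smul_mul_smul_comm, h', smul_zero]

end Cup

end Products

/-! ### The pre-Lie product -/

section PreLie

open Simplicial CategoryAlgebra

/-! ### Partial compositions as multilinear maps -/

section Multilinear

variable {k : Type w} [CommRing k] {A : Type v} [Ring A] [Algebra k A]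

/-- The tuple `(a₀, …, aⱼ₋₁, g(aⱼ, …, aⱼ₊q), aⱼ₊q₊₁, …, aₚ₊q)`. -/
def insertCochain {p q : ℕ} (g : HochschildCochain k A (q + 1)) (j : Fin (p + 1))
    (a : Fin (p + q + 1) → A) : Fin (p + 1) → A := fun l =>
  if (l : ℕ) < j then a ⟨l, by lia⟩
  else if l = j then g (fun r => a ⟨j + r, by lia⟩)
  else a ⟨l + q, by lia⟩

lemma preLie_eq {p q : ℕ} (f : HochschildCochain k A (p + 1)) (g : HochschildCochain k A (q + 1))
    (a : Fin (p + q + 1) → A) : preLie f g a =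
      ∑ j : Fin (p + 1), (-1 : k) ^ ((p - (j : ℕ)) * q) • f (insertCochain g j a) := rfl

lemma insertCochain_update {p q : ℕ} (g : HochschildCochain k A (q + 1)) (j : Fin (p + 1))
    (a : Fin (p + q + 1) → A) (t : Fin (p + q + 1)) :
    ∃ (s : Fin (p + 1)) (L : A →ₗ[k] A), ∀ x,
      insertCochain g j (Function.update a t x) = Function.update (insertCochain g j a) s (L x) := by
  rcases lt_or_ge (t : ℕ) j with h | h
  · refine ⟨⟨t, by lia⟩, LinearMap.id, fun x => ?_⟩
    have hg : (fun r : Fin (q + 1) => Function.update a t x ⟨j + r, by lia⟩) =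
        fun r : Fin (q + 1) => a ⟨j + r, by lia⟩ := by
      ext r
      rw [Function.update_of_ne]
      simp only [ne_eq, Fin.ext_iff]
      lia
    ext l
    simp only [insertCochain, hg]
    simp only [Function.update_apply, Fin.ext_iff, LinearMap.id_apply, insertCochain]
    split_ifs <;> first | rfl | lia
  · rcases lt_or_ge (t : ℕ) (j + q + 1) with h' | h'
    · refine ⟨j, g.toLinearMap (fun r => a ⟨j + r, by lia⟩) ⟨t - j, by lia⟩, fun x => ?_⟩
      have hg : (fun r : Fin (q + 1) => Function.update a t x ⟨j + r, by lia⟩) =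
          Function.update (fun r : Fin (q + 1) => a ⟨j + r, by lia⟩) ⟨t - j, by lia⟩ x := by
        ext r
        simp only [Function.update_apply, Fin.ext_iff]
        split_ifs <;> first | rfl | lia
      ext l
      by_cases hl : l = j
      · subst hl
        simp [insertCochain, hg]
      · rw [Function.update_of_ne hl]
        have hl' : (l : ℕ) ≠ j := fun e => hl (Fin.ext e)
        simp only [insertCochain, Function.update_apply, Fin.ext_iff]
        split_ifs <;> first | rfl | lia
    · refine ⟨⟨t - q, by lia⟩, LinearMap.id, fun x => ?_⟩
      have hg : (fun r : Fin (q + 1) => Function.update a t x ⟨j + r, by lia⟩) =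
          fun r : Fin (q + 1) => a ⟨j + r, by lia⟩ := by
        ext r
        rw [Function.update_of_ne]
        simp only [ne_eq, Fin.ext_iff]
        lia
      ext l
      simp only [insertCochain, hg]
      simp only [Function.update_apply, Fin.ext_iff, LinearMap.id_apply, insertCochain]
      split_ifs <;> first | rfl | lia

/-- The `j`-th partial composition of Hochschild cochains. -/
def partialComp {p q : ℕ} (f : HochschildCochain k A (p + 1)) (g : HochschildCochain k A (q + 1))
    (j : Fin (p + 1)) : HochschildCochain k A (p + q + 1) :=
  MultilinearMap.mk' (fun a => f (insertCochain g j a))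
    (by
      intro a t x y
      obtain ⟨s, L, h⟩ := insertCochain_update g j a t
      simp [h])
    (by
      intro a t c x
      obtain ⟨s, L, h⟩ := insertCochain_update g j a t
      simp [h])

/-- The pre-Lie product as a Hochschild cochain. -/
def preLieCochain {p q : ℕ} (f : HochschildCochain k A (p + 1))
    (g : HochschildCochain k A (q + 1)) : HochschildCochain k A (p + q + 1) :=
  ∑ j : Fin (p + 1), (-1 : k) ^ ((p - (j : ℕ)) * q) • partialComp f g j

lemma preLieCochain_apply {p q : ℕ} (f : HochschildCochain k A (p + 1))
    (g : HochschildCochain k A (q + 1)) (a : Fin (p + q + 1) → A) :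
    preLieCochain f g a = preLie f g a := by
  simp [preLieCochain, preLie_eq, sum_apply, partialComp]

end Multilinear

variable {k : Type w} [CommRing k] {C : Type u} [Category.{v} C] [Fintype C]

lemma skipInterval_apply (p q : ℕ) (j : Fin (p + 1)) (l : Fin (p + 2)) :
    ((skipInterval p q j).toOrderHom l : ℕ) = if (l : ℕ) ≤ j then (l : ℕ) else l + q := rfl

lemma nerveArrows_skipInterval {p q : ℕ} (j : Fin (p + 1)) (σ : (nerve C) _⦋p + q + 1⦌)
    (l : Fin (p + 1)) : nerveArrows C (p + 1) ((nerve C).map (skipInterval p q j).op σ) l =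
      nerveEdge σ ((skipInterval p q j).toOrderHom l.castSucc)
        ((skipInterval p q j).toOrderHom l.succ)
        ((skipInterval p q j).toOrderHom.monotone (Fin.castSucc_le_succ l)) := rfl

/-- On a simplex, inserting `Ψ(β)` composes a block of consecutive edges and scales by `β`. Up to
that scalar the result is the tuple of edges of the face that skips the interior vertices of the
block. -/
lemma insertCochain_categoryPsi {p q : ℕ} (β : SimplicialCochain k (nerve C) (q + 1))
    (j : Fin (p + 1)) (σ : (nerve C) _⦋p + q + 1⦌) :
    insertCochain (categoryPsi k C (q + 1) β) j
        (fun i => basis k C (nerveArrows C (p + q + 1) σ i)) =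
      Function.update (fun l => basis k C (nerveArrows C (p + 1)
        ((nerve C).map (skipInterval p q j).op σ) l)) j
        (β ((nerve C).map (SimplexCategory.subinterval (j : ℕ) (q + 1) (by lia)).op σ) •
          basis k C (nerveArrows C (p + 1) ((nerve C).map (skipInterval p q j).op σ) j)) := by
  ext l
  rw [Function.update_apply]
  have hl : l = j ↔ (l : ℕ) = j := Fin.ext_iff
  simp only [insertCochain]
  split_ifs with h1 h2 h2
  · lia
  · rw [nerveArrows_skipInterval]
    refine congrArg _ (nerveEdge_congr σ ?_ ?_ _ _)
    all_goals
      simp only [Fin.ext_iff, skipInterval_apply, Fin.val_castSucc, Fin.val_succ]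
      split_ifs <;> lia
  · have h3 := nerveArrows_subinterval σ j (q + 1) (by lia)
    simp only [← h3]
    rw [categoryPsi_succ_apply_edge, nerveEdge_subinterval, nerveArrows_skipInterval]
    congr 2
    refine nerveEdge_congr σ ?_ ?_ _ _
    all_goals
      simp only [Fin.ext_iff, skipInterval_apply, Fin.val_castSucc, Fin.val_succ]
      split_ifs <;> lia
  · rw [nerveArrows_skipInterval]
    refine congrArg _ (nerveEdge_congr σ ?_ ?_ _ _)
    all_goals
      simp only [Fin.ext_iff, skipInterval_apply, Fin.val_castSucc, Fin.val_succ]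
      split_ifs <;> lia

/-- If the inner block is not composable, the inserted value is zero. Otherwise the block may be
replaced by its composite without changing outer source and target, so the shortened tuple inherits
the failure of composability. -/
lemma partialComp_categoryPsi_of_notMem_range {p q : ℕ}
    (α : SimplicialCochain k (nerve C) (p + 1)) (β : SimplicialCochain k (nerve C) (q + 1))
    (j : Fin (p + 1)) (φ : Fin (p + q + 1) → Arrow C)
    (hφ : φ ∉ Set.range (nerveArrows C (p + q + 1))) :
    categoryPsi k C (p + 1) α
      (insertCochain (categoryPsi k C (q + 1) β) j fun i => basis k C (φ i)) = 0 := by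
  by_cases h : (fun r : Fin (q + 1) => φ ⟨j + r, by lia⟩) ∈ Set.range (nerveArrows C (q + 1))
  · obtain ⟨τ, hτ⟩ := h
    set χ : Arrow C := nerveEdge τ 0 (Fin.last (q + 1)) (Fin.zero_le _) with hχ
    have hl : χ.left = (φ ⟨j, by lia⟩).left := (congrArg Comma.left (congrFun hτ 0) :)
    have hr : χ.right = (φ ⟨j + q, by lia⟩).right :=
      (congrArg Comma.right (congrFun hτ (Fin.last q)) :)
    let ψ : Fin (p + 1) → Arrow C := fun l =>
      if (l : ℕ) < j then φ ⟨l, by lia⟩ else if l = j then χ else φ ⟨l + q, by lia⟩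
    have hψ : insertCochain (categoryPsi k C (q + 1) β) j (fun i => basis k C (φ i)) =
        Function.update (fun l => basis k C (ψ l)) j (β τ • basis k C (ψ j)) := by
      ext l
      rw [Function.update_apply]
      by_cases h2 : l = j
      · subst h2
        have h3 : (fun r : Fin (q + 1) => basis k C (φ ⟨l + r, by lia⟩)) =
            fun r => basis k C (nerveArrows C (q + 1) τ r) :=
          funext fun r => congrArg _ (congrFun hτ r).symm
        simp only [insertCochain, ψ, lt_irrefl, if_false, if_true]
        rw [h3, categoryPsi_succ_apply_edge]
      · simp only [insertCochain, ψ, if_neg h2]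
        split_ifs <;> rfl
    have hψ' : ψ ∉ Set.range (nerveArrows C (p + 1)) := fun h' => hφ <| by
      have h1 := (mem_range_nerveArrows_iff p ψ).1 h'
      have h2 := (mem_range_nerveArrows_iff q _).1 ⟨τ, hτ⟩
      refine (mem_range_nerveArrows_iff (p + q) φ).2 fun i i' hi => ?_
      have e1 : ∀ (l : ℕ) (hl : l < j), ψ ⟨l, by lia⟩ = φ ⟨l, by lia⟩ := fun l hl => if_pos hl
      have e2 : ψ j = χ := by simp [ψ]
      have e3 : ∀ (l : ℕ) (hl : j < l) (hl' : l < p + 1), ψ ⟨l, hl'⟩ = φ ⟨l + q, by lia⟩ :=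
        fun l hl hl' => (if_neg hl.le.not_gt).trans (if_neg fun h => hl.ne (Fin.ext_iff.1 h).symm)
      obtain ⟨i, hi'⟩ := i
      obtain ⟨_, hi''⟩ := i'
      obtain rfl := hi
      change i < p + q + 1 at hi'
      change i + 1 < p + q + 1 at hi''
      -- Adjacent pairs before the block, entering it, inside it, leaving it and after it; only
      -- pairs inside use composability of the block itself.
      rcases lt_trichotomy (i + 1) j with hj | hj | hj
      · rw [← e1 i (by lia), ← e1 (i + 1) hj]
        exact h1 _ _ rfl
      · have := h1 ⟨i, by lia⟩ j hj
        rw [e1 i (by lia), e2, hl] at this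
        simp only [← hj] at this
        exact this
      · rcases lt_trichotomy i (j + q) with hq | hq | hq
        · have := h2 ⟨i - j, by lia⟩ ⟨i - j + 1, by lia⟩ rfl
          simp only [show (j : ℕ) + (i - j) = i by lia,
            show (j : ℕ) + (i - j + 1) = i + 1 by lia] at this
          exact this
        · have := h1 j ⟨j + 1, by lia⟩ rfl
          rw [e2, e3 _ (by lia), hr] at this
          simp only [show (j : ℕ) + 1 + q = i + 1 by lia, ← hq] at this
          exact this
        · have := h1 ⟨i - q, by lia⟩ ⟨i - q + 1, by lia⟩ rfl
          rw [e3 _ (by lia), e3 _ (by lia)] at this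
          simp only [show i - q + q = i by lia, show i - q + 1 + q = i + 1 by lia] at this
          exact this
    rw [hψ, MultilinearMap.map_update_smul, Function.update_eq_self,
      categoryPsi_succ_apply_of_notMem_range _ _ hψ', smul_zero]
  · refine MultilinearMap.map_coord_zero _ j ?_
    simp only [insertCochain, lt_irrefl, if_false, if_true]
    exact categoryPsi_succ_apply_of_notMem_range _ _ h

lemma categoryPsi_simplicialCupOne (p q : ℕ) (α : SimplicialCochain k (nerve C) (p + 1))
    (β : SimplicialCochain k (nerve C) (q + 1)) (a : Fin (p + q + 1) → CategoryAlgebra k C) :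
    categoryPsi k C (p + q + 1) (simplicialCupOne α β) a =
      preLie (categoryPsi k C (p + 1) α) (categoryPsi k C (q + 1) β) a := by
  rw [← preLieCochain_apply]
  refine congrFun (congrArg DFunLike.coe (hochschildCochain_ext (fun σ => ?_)
    (fun φ hφ => categoryPsi_succ_apply_of_notMem_range _ _ hφ) fun φ hφ => ?_)) a
  · rw [preLieCochain_apply, preLie_eq, categoryPsi_succ_apply_edge]
    simp only [insertCochain_categoryPsi, MultilinearMap.map_update_smul, Function.update_eq_self,
      categoryPsi_succ_apply_edge, simplicialCupOne, Finset.sum_smul, smul_smul]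
    refine Finset.sum_congr rfl fun j _ => ?_
    congr 1
    · ring
    · rw [nerveEdge_map]
      refine congrArg _ (nerveEdge_congr σ ?_ ?_ _ _)
      all_goals
        simp only [Fin.ext_iff, skipInterval_apply, Fin.val_zero, Fin.val_last]
        split_ifs <;> lia
  · rw [preLieCochain_apply, preLie_eq]
    refine Finset.sum_eq_zero fun j _ => ?_
    rw [partialComp_categoryPsi_of_notMem_range α β j φ hφ, smul_zero]

end PreLie

/-! ### The cup product of cocycles -/

section CupCocycle

open Simplicial

variable {k : Type w} [CommRing k] {X : SSet.{u}}

lemma map_map_apply {m n l : ℕ} (f : ⦋m⦌ ⟶ ⦋n⦌) (g : ⦋n⦌ ⟶ ⦋l⦌) (h : ⦋m⦌ ⟶ ⦋l⦌) (w : f ≫ g = h)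
    (σ : X _⦋l⦌) : X.map f.op (X.map g.op σ) = X.map h.op σ := by
  subst w
  simp

lemma subinterval_comp_δ {m n j l j' l' : ℕ} (h : j + l ≤ m) (h' : j' + l' ≤ n)
    (f : ⦋l⦌ ⟶ ⦋l'⦌) (g : ⦋m⦌ ⟶ ⦋n⦌)
    (H : ∀ a : Fin (l + 1), (g.toOrderHom ⟨a + j, by lia⟩ : ℕ) = f.toOrderHom a + j')
    (σ : X _⦋n⦌) :
    X.map (SimplexCategory.subinterval j l h).op (X.map g.op σ) =
      X.map f.op (X.map (SimplexCategory.subinterval j' l' h').op σ) := by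
  rw [map_map_apply f _ _ rfl]
  exact map_map_apply (SimplexCategory.subinterval j l h) g (f ≫ SimplexCategory.subinterval j' l' h')
    (SimplexCategory.Hom.ext _ _ (OrderHom.ext _ _ (funext fun a => Fin.ext (H a)))) σ

lemma subinterval_subinterval {m n j l j' : ℕ} (h : j + l ≤ m) (h' : j' + l ≤ n) (g : ⦋m⦌ ⟶ ⦋n⦌)
    (H : ∀ a : Fin (l + 1), (g.toOrderHom ⟨a + j, by lia⟩ : ℕ) = a + j') (σ : X _⦋n⦌) :
    X.map (SimplexCategory.subinterval j l h).op (X.map g.op σ) =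
      X.map (SimplexCategory.subinterval j' l h').op σ := by
  exact map_map_apply (SimplexCategory.subinterval j l h) g (SimplexCategory.subinterval j' l h')
    (SimplexCategory.Hom.ext _ _ (OrderHom.ext _ _ (funext fun a => Fin.ext (H a)))) σ

lemma δ_subinterval {n j l j' l' : ℕ} (h : j + l ≤ n) (h' : j' + l' ≤ n) (f : ⦋l⦌ ⟶ ⦋l'⦌)
    (H : ∀ a : Fin (l + 1), (f.toOrderHom a : ℕ) + j' = a + j) (σ : X _⦋n⦌) :
    X.map f.op (X.map (SimplexCategory.subinterval j' l' h').op σ) =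
      X.map (SimplexCategory.subinterval j l h).op σ := by
  exact map_map_apply f (SimplexCategory.subinterval j' l' h') (SimplexCategory.subinterval j l h)
    (SimplexCategory.Hom.ext _ _ (OrderHom.ext _ _ (funext fun a => Fin.ext (H a)))) σ

lemma val_δ {n : ℕ} (i : Fin (n + 2)) (a : Fin (n + 1)) :
    ((SimplexCategory.δ i).toOrderHom a : ℕ) = if (a : ℕ) < i then (a : ℕ) else a + 1 :=
  val_succAbove i a

/-- The Leibniz argument, specialised to cocycles: the cocycle equation for `α` on the front face,
times `β`, and the one for `β` on the back face, times `α`, add up to the coboundary of the cup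
product. -/
lemma simplicialCup_mem_cocycles {p q : ℕ} {α : SimplicialCochain k X p}
    {β : SimplicialCochain k X q} (hα : α ∈ cocycles (simplicialD k X) p)
    (hβ : β ∈ cocycles (simplicialD k X) q) :
    simplicialCup α β ∈ cocycles (simplicialD k X) (p + q) := by
  rw [mem_cocycles] at hα hβ ⊢
  ext σ
  set F := X.map (SimplexCategory.subinterval 0 (p + 1) (by lia)).op σ with hF
  set B := X.map (SimplexCategory.subinterval p (q + 1) (by lia)).op σ with hB
  have h1 := congrFun hα F
  have h2 := congrFun hβ B
  change ∑ i : Fin (p + 2), (-1 : k) ^ (i : ℕ) * α (X.δ i F) = 0 at h1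
  change ∑ i : Fin (q + 2), (-1 : k) ^ (i : ℕ) * β (X.δ i B) = 0 at h2
  change ∑ i : Fin (p + q + 2), (-1 : k) ^ (i : ℕ) *
    (α (X.map (SimplexCategory.subinterval 0 p _).op (X.δ i σ)) *
      β (X.map (SimplexCategory.subinterval p q _).op (X.δ i σ))) = 0
  have e1 : X.δ (Fin.last (p + 1)) F =
      X.map (SimplexCategory.subinterval 0 p (by lia)).op σ :=
    δ_subinterval _ _ _ (fun a => by simp [val_δ]; lia) σ
  have e2 : X.δ 0 B = X.map (SimplexCategory.subinterval (p + 1) q (by lia)).op σ :=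
    δ_subinterval _ _ _ (fun a => by simp [val_δ]; lia) σ
  rw [Fin.sum_univ_castSucc, e1] at h1
  rw [Fin.sum_univ_succ, e2] at h2
  -- Faces `0, …, p` alter the front factor and faces `p + 1, …, p + q + 1` the back factor. The
  -- last face of `F` and face `0` of `B` are missing from this list.
  have hpq : p + 1 + (q + 1) = p + q + 2 := by lia
  rw [← Fin.sum_congr' _ hpq, Fin.sum_univ_add]
  have t1 : ∀ i : Fin (p + 1),
      α (X.map (SimplexCategory.subinterval 0 p (by lia)).op
        (X.δ ((Fin.castAdd (q + 1) i).cast hpq) σ)) *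
      β (X.map (SimplexCategory.subinterval p q le_rfl).op
        (X.δ ((Fin.castAdd (q + 1) i).cast hpq) σ)) =
      α (X.δ i.castSucc F) * β (X.map (SimplexCategory.subinterval (p + 1) q (by lia)).op σ) :=
    fun i => by
      congr 2
      · exact subinterval_comp_δ _ _ _ _ (fun a => by simp [val_δ]) σ
      · exact subinterval_subinterval _ _ _ (fun a => by simp [val_δ]; lia) σ
  have t2 : ∀ i : Fin (q + 1),
      α (X.map (SimplexCategory.subinterval 0 p (by lia)).op
        (X.δ ((Fin.natAdd (p + 1) i).cast hpq) σ)) *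
      β (X.map (SimplexCategory.subinterval p q le_rfl).op
        (X.δ ((Fin.natAdd (p + 1) i).cast hpq) σ)) =
      α (X.map (SimplexCategory.subinterval 0 p (by lia)).op σ) * β (X.δ i.succ B) :=
    fun i => by
      congr 2
      · exact subinterval_subinterval _ _ _ (fun a => by simp [val_δ]; lia) σ
      · exact subinterval_comp_δ _ _ _ _ (fun a => by
          simp only [val_δ, Fin.val_cast, Fin.val_natAdd, Fin.val_succ]
          split_ifs <;> lia) σ
  simp only [t1, t2]
  simp only [Fin.val_cast, Fin.val_castAdd, Fin.val_natAdd, Fin.val_castSucc, Fin.val_last,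
    Fin.val_zero, pow_zero, one_mul, Fin.val_succ] at h1 h2 ⊢
  have s1 := congrArg
    (· * β (X.map (SimplexCategory.subinterval (p + 1) q (by lia)).op σ)) h1
  -- The sign `(-1)^p` makes the two missing terms cancel.
  have s2 := congrArg
    (fun x => (-1) ^ p * (α (X.map (SimplexCategory.subinterval 0 p (by lia)).op σ) * x)) h2
  simp only [add_mul, mul_add, Finset.sum_mul, Finset.mul_sum, zero_mul, mul_zero] at s1 s2
  have s3 := congrArg₂ (· + ·) s1 s2
  rw [add_zero] at s3
  refine Eq.trans ?_ s3
  have u1 : ∀ i : Fin (q + 1), (-1 : k) ^ (p + 1 + (i : ℕ)) = (-1) ^ p * (-1) ^ ((i : ℕ) + 1) :=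
    fun i => by ring
  simp only [u1, mul_assoc, mul_left_comm (α _), pow_succ (-1 : k) p]
  ring

end CupCocycle

/-! ### The map `Ψ` of a group -/

section GroupPsi

open Simplicial

variable {k : Type w} [CommRing k] {G : Type v} [Group G]

/-- The group element on the edge from the `a`-th to the `b`-th vertex of a simplex. -/
def groupEdge {n : ℕ} (σ : (nerve (GroupCategory G)) _⦋n⦌) (a b : Fin (n + 1)) (h : a ≤ b) : G :=
  MulOpposite.unop ((show ComposableArrows (GroupCategory G) n from σ).map (homOfLE h) : Gᵐᵒᵖ)

/-- The tuple of group elements of a simplex of the nerve of `G`. -/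
def groupArrows (n : ℕ) (σ : (nerve (GroupCategory G)) _⦋n⦌) (i : Fin n) : G :=
  groupEdge σ i.castSucc i.succ (Fin.castSucc_le_succ i)

lemma groupEdge_congr {n : ℕ} (σ : (nerve (GroupCategory G)) _⦋n⦌) {a a' b b' : Fin (n + 1)}
    (ha : a = a') (hb : b = b') (h : a ≤ b) (h' : a' ≤ b') :
    groupEdge σ a b h = groupEdge σ a' b' h' := by
  subst ha hb
  rfl

lemma groupEdge_mul {n : ℕ} (σ : (nerve (GroupCategory G)) _⦋n⦌) {a b c : Fin (n + 1)}
    (h : a ≤ b) (h' : b ≤ c) :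
    groupEdge σ a b h * groupEdge σ b c h' = groupEdge σ a c (h.trans h') := by
  let F : ComposableArrows (GroupCategory G) n := σ
  have := congrArg MulOpposite.unop (show (F.map (homOfLE (h.trans h')) : Gᵐᵒᵖ) =
    (F.map (homOfLE h) ≫ F.map (homOfLE h') : _) from
      F.map_comp (homOfLE h) (homOfLE h'))
  exact this.symm

lemma groupEdge_δ {n : ℕ} (σ : (nerve (GroupCategory G)) _⦋n + 1⦌) (j : Fin (n + 2))
    (a b : Fin (n + 1)) (h : a ≤ b) : groupEdge ((nerve (GroupCategory G)).δ j σ) a b h =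
      groupEdge σ (j.succAbove a) (j.succAbove b) (Fin.succAbove_le_succAbove_iff.2 h) := rfl

lemma groupArrows_groupSimplex {n : ℕ} (g : Fin n → G) : groupArrows n (groupSimplex g) = g := by
  ext i
  exact congrArg MulOpposite.unop (ComposableArrows.mkOfObjOfMapSucc_map_succ
    (C := GroupCategory G) (fun _ => SingleObj.star _) (fun i => MulOpposite.op (g i)) i i.2)

/-- Unlike for general categories this includes degree `0`, since there is only one object. -/
lemma groupArrows_injective (n : ℕ) :
    Function.Injective (groupArrows n : (nerve (GroupCategory G)) _⦋n⦌ → Fin n → G) := by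
  intro σ τ h
  cases n with
  | zero => exact nerve_ext_zero rfl
  | succ n =>
    refine nerveArrows_injective n (funext fun i => ?_)
    exact congrArg (fun g : G => (Arrow.mk (show SingleObj.star Gᵐᵒᵖ ⟶ SingleObj.star Gᵐᵒᵖ from
      MulOpposite.op g))) (congrFun h i)

lemma groupSimplex_groupArrows {n : ℕ} (σ : (nerve (GroupCategory G)) _⦋n⦌) :
    groupSimplex (groupArrows n σ) = σ :=
  groupArrows_injective n (groupArrows_groupSimplex _)

lemma monoidAlgebra_basis_mul (g h : G) :
    MonoidAlgebra.basis G k g * MonoidAlgebra.basis G k h = MonoidAlgebra.basis G k (g * h) := by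
  simp [MonoidAlgebra.basis_apply, MonoidAlgebra.single_mul_single]

variable (k G) in
lemma isFaceCompatible_group : IsFaceCompatible (X := nerve (GroupCategory G))
    fun n σ i => MonoidAlgebra.basis G k (groupArrows n σ i) where
  zero n σ := rfl
  last n σ := by
    ext1 i
    simp only [groupArrows, groupEdge_δ]
    exact congrArg _ (groupEdge_congr σ (by simp) (by simp) _ _)
  mid n σ j := by
    ext1 i
    simp only [groupArrows, groupEdge_δ, Fin.contractNth, Fin.val_castSucc]
    split_ifs with h1 h2
    · refine congrArg _ (groupEdge_congr σ ?_ ?_ _ _)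
      all_goals
        simp only [Fin.ext_iff, val_succAbove, Fin.val_castSucc, Fin.val_succ]
        split_ifs <;> omega
    · rw [monoidAlgebra_basis_mul]
      refine congrArg _ (Eq.trans ?_ (groupEdge_mul σ _ (Fin.castSucc_le_succ i.succ)).symm)
      refine groupEdge_congr σ ?_ ?_ _ _
      all_goals
        simp only [Fin.ext_iff, val_succAbove, Fin.val_castSucc, Fin.val_succ]
        split_ifs <;> omega
    · refine congrArg _ (groupEdge_congr σ ?_ ?_ _ _)
      all_goals
        simp only [Fin.ext_iff, val_succAbove, Fin.val_castSucc, Fin.val_succ]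
        split_ifs <;> omega

variable (k G) in
/-- The augmentation of the group ring. -/
def augmentation : MonoidAlgebra k G →ₗ[k] k := (MonoidAlgebra.basis G k).constr k fun _ => (1 : k)

lemma augmentation_basis (g : G) : augmentation k G (MonoidAlgebra.basis G k g) = 1 :=
  Module.Basis.constr_basis _ _ _ _

lemma augmentation_basis_mul (g : G) (z : MonoidAlgebra k G) :
    augmentation k G (MonoidAlgebra.basis G k g * z) = augmentation k G z := by
  refine LinearMap.congr_fun ((MonoidAlgebra.basis G k).ext (f₁ := augmentation k G ∘ₗ
    LinearMap.mulLeft k (MonoidAlgebra.basis G k g)) (f₂ := augmentation k G) fun h => ?_) z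
  rw [LinearMap.comp_apply, LinearMap.mulLeft_apply, monoidAlgebra_basis_mul, augmentation_basis,
    augmentation_basis]

lemma augmentation_mul_basis (g : G) (z : MonoidAlgebra k G) :
    augmentation k G (z * MonoidAlgebra.basis G k g) = augmentation k G z := by
  refine LinearMap.congr_fun ((MonoidAlgebra.basis G k).ext (f₁ := augmentation k G ∘ₗ
    LinearMap.mulRight k (MonoidAlgebra.basis G k g)) (f₂ := augmentation k G) fun h => ?_) z
  rw [LinearMap.comp_apply, LinearMap.mulRight_apply, monoidAlgebra_basis_mul, augmentation_basis,
    augmentation_basis]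

lemma augmentation_prod (n : ℕ) (g : Fin n → G) :
    augmentation k G (List.ofFn fun i => MonoidAlgebra.basis G k (g i)).prod = 1 := by
  induction n with
  | zero =>
    rw [List.ofFn_zero, List.prod_nil, MonoidAlgebra.one_def, ← MonoidAlgebra.basis_apply,
      augmentation_basis]
  | succ n ih => rw [List.ofFn_succ, List.prod_cons, augmentation_basis_mul, ih]

variable (k G) in
/-- The map from Hochschild cochains of `k[G]` to simplicial cochains of the nerve of `G` given by
the augmentation. -/
def groupRho (n : ℕ) : HochschildCochain k (MonoidAlgebra k G) n →ₗ[k]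
    SimplicialCochain k (nerve (GroupCategory G)) n where
  toFun f := fun σ => augmentation k G (f fun i => MonoidAlgebra.basis G k (groupArrows n σ i))
  map_add' f g := by ext σ; simp
  map_smul' c f := by ext σ; simp

lemma groupRho_apply (n : ℕ) (f : HochschildCochain k (MonoidAlgebra k G) n)
    (σ : (nerve (GroupCategory G)) _⦋n⦌) : groupRho k G n f σ =
      augmentation k G (f fun i => MonoidAlgebra.basis G k (groupArrows n σ i)) := rfl

lemma groupPsi_apply_simplex (n : ℕ) (γ : SimplicialCochain k (nerve (GroupCategory G)) n)
    (σ : (nerve (GroupCategory G)) _⦋n⦌) :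
    groupPsi k G n γ (fun i => MonoidAlgebra.basis G k (groupArrows n σ i)) =
      γ σ • (List.ofFn fun i => MonoidAlgebra.basis G k (groupArrows n σ i)).prod := by
  refine (coherentCochain_apply (MonoidAlgebra.basis G k) n _ _).trans ?_
  rw [LinearMap.funLeft_apply, groupSimplex_groupArrows]

lemma groupHochschildCochain_ext {n : ℕ} {f g : HochschildCochain k (MonoidAlgebra k G) n}
    (h : ∀ σ : (nerve (GroupCategory G)) _⦋n⦌,
      f (fun i => MonoidAlgebra.basis G k (groupArrows n σ i)) =
        g (fun i => MonoidAlgebra.basis G k (groupArrows n σ i))) : f = g := by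
  refine Module.Basis.ext_multilinear (fun _ => MonoidAlgebra.basis G k) fun φ => ?_
  have := h (groupSimplex φ)
  rwa [groupArrows_groupSimplex] at this

lemma hochschildD_groupPsi (n : ℕ) (γ : SimplicialCochain k (nerve (GroupCategory G)) n) :
    hochschildD k (MonoidAlgebra k G) n (groupPsi k G n γ) =
      groupPsi k G (n + 1) (simplicialD k (nerve (GroupCategory G)) n γ) := by
  refine groupHochschildCochain_ext fun σ => ?_
  rw [groupPsi_apply_simplex]
  exact (isFaceCompatible_group k G).hochschildD_of_prod _ γ (groupPsi_apply_simplex n γ) σ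

lemma simplicialD_groupRho (n : ℕ) (f : HochschildCochain k (MonoidAlgebra k G) n) :
    simplicialD k (nerve (GroupCategory G)) n (groupRho k G n f) =
      groupRho k G (n + 1) (hochschildD k (MonoidAlgebra k G) n f) :=
  (isFaceCompatible_group k G).simplicialD_of_linear (fun _ _ => augmentation k G)
    (fun _ _ _ => augmentation_basis_mul _ _) (fun _ _ _ => augmentation_mul_basis _ _)
    (fun _ _ _ => rfl) f

lemma groupRho_groupPsi (n : ℕ) (γ : SimplicialCochain k (nerve (GroupCategory G)) n) :
    groupRho k G n (groupPsi k G n γ) = γ := by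
  ext σ
  rw [groupRho_apply, groupPsi_apply_simplex, map_smul, augmentation_prod, smul_eq_mul, mul_one]

lemma groupPsi_injective (n : ℕ) : Function.Injective (groupPsi k G n) :=
  Function.LeftInverse.injective (groupRho_groupPsi n)

lemma range_groupPsi (n : ℕ) : LinearMap.range (groupPsi k G n) =
    strictlyAutopoietic k (MonoidAlgebra.basis G k) n := by
  rw [groupPsi, LinearMap.range_comp_of_range_eq_top, range_coherentCochain]
  exact LinearMap.range_eq_top.2 (LinearMap.funLeft_surjective_of_injective _ _ _
    (Function.LeftInverse.injective groupArrows_groupSimplex))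

/-- The retraction given by the augmentation is a cochain map, so it carries a coboundary for `Ψ(γ)`
back to one for `γ`. -/
lemma mem_coboundaries_of_groupPsi {n : ℕ} {γ : SimplicialCochain k (nerve (GroupCategory G)) n}
    (h : groupPsi k G n γ ∈ coboundaries (hochschildD k (MonoidAlgebra k G)) n) :
    γ ∈ coboundaries (simplicialD k (nerve (GroupCategory G))) n := by
  rw [← groupRho_groupPsi n γ]
  exact map_mem_coboundaries simplicialD_groupRho h

end GroupPsi

/-! ### The endomorphism groups in the category algebra of an amalgam -/

namespace Amalgam

open Simplicial CategoryAlgebra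

variable {k : Type w} [CommRing k] {P : Type u} [PartialOrder P] {G : P → Type v} [∀ i, Group (G i)]

variable (G) in
/-- The element `i` of the poset as an object of the amalgam. -/
def vertex (i : P) : Amalgam G := i

/-- The element `g` of `G i` as a morphism of the amalgam. -/
def loop (i : P) (g : G i) : Arrow (Amalgam G) :=
  Arrow.mk (show vertex G i ⟶ vertex G i from Hom.grp g)

lemma loop_injective (i : P) : Function.Injective (loop (G := G) i) := fun g h hgh => by
  have h' : (Hom.grp g : Hom G i i) = Hom.grp h := Arrow.mk_injective _ _ hgh
  exact Hom.grp.inj h'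

lemma le_of_arrow (φ : Arrow (Amalgam G)) : LE.le (α := P) φ.left φ.right := by
  obtain ⟨x, y, f⟩ := φ
  change Hom G x y at f
  cases f with
  | grp g => exact le_refl (α := P) _
  | arr h => exact le_of_lt (α := P) h

lemma mem_range_loop_iff (i : P) (φ : Arrow (Amalgam G)) :
    φ ∈ Set.range (loop (G := G) i) ↔ φ.left = vertex G i ∧ φ.right = vertex G i := by
  constructor
  · rintro ⟨g, rfl⟩
    exact ⟨rfl, rfl⟩
  · obtain ⟨x, y, f⟩ := φ
    rintro ⟨h1, h2⟩
    change x = i at h1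
    change y = i at h2
    subst h1 h2
    change Hom G y y at f
    cases f with
    | grp g => exact ⟨g, rfl⟩
    | arr h => exact (lt_irrefl (α := P) _ h).elim

/-- Group elements occur only as endomorphisms; between distinct objects there is at most the
morphism `e_{ij}`. -/
lemma arrow_ext {φ ψ : Arrow (Amalgam G)} (hl : φ.left = ψ.left) (hr : φ.right = ψ.right)
    (h : φ.left ≠ φ.right) : φ = ψ := by
  obtain ⟨x, y, f⟩ := φ
  obtain ⟨x', y', g⟩ := ψ
  change x = x' at hl
  change y = y' at hr
  subst hl hr
  change x ≠ y at h
  change Hom G x y at f g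
  cases f with
  | grp _ => exact (h rfl).elim
  | arr _ =>
    cases g with
    | grp _ => exact (h rfl).elim
    | arr _ => rfl

/-! ### The corner algebras `k[G_i]` -/

variable (k G) in
/-- The inclusion of the group ring of `G i` in the category algebra. -/
def inclusion (i : P) : MonoidAlgebra k (G i) →ₗ[k] CategoryAlgebra k (Amalgam G) :=
  (MonoidAlgebra.basis (G i) k).constr k fun g => basis k _ (loop i g)

variable (k G) in
/-- The projection of the category algebra onto the group ring of `G i`. -/
def projection (i : P) : CategoryAlgebra k (Amalgam G) →ₗ[k] MonoidAlgebra k (G i) :=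
  (basis k (Amalgam G)).constr k (Function.extend (loop i) (MonoidAlgebra.basis (G i) k) 0)

lemma inclusion_basis (i : P) (g : G i) :
    inclusion k G i (MonoidAlgebra.basis (G i) k g) = basis k _ (loop i g) :=
  Module.Basis.constr_basis _ _ _ _

lemma projection_loop (i : P) (g : G i) :
    projection k G i (basis k _ (loop i g)) = MonoidAlgebra.basis (G i) k g := by
  rw [projection, Module.Basis.constr_basis, (loop_injective i).extend_apply]

lemma projection_of_ne (i : P) (φ : Arrow (Amalgam G)) (h : ¬(φ.left = vertex G i ∧ φ.right = vertex G i)) :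
    projection k G i (basis k _ φ) = 0 := by
  rw [projection, Module.Basis.constr_basis, Function.extend_apply']
  · rfl
  · exact fun h' => h ((mem_range_loop_iff i φ).1 h')

lemma projection_inclusion (i : P) (z : MonoidAlgebra k (G i)) :
    projection k G i (inclusion k G i z) = z :=
  LinearMap.congr_fun ((MonoidAlgebra.basis (G i) k).ext
    (f₁ := projection k G i ∘ₗ inclusion k G i) (f₂ := LinearMap.id) fun g => by
      rw [LinearMap.comp_apply, inclusion_basis, projection_loop, LinearMap.id_apply]) z

lemma projection_inclusion_of_ne {i j : P} (h : i ≠ j) (z : MonoidAlgebra k (G i)) :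
    projection k G j (inclusion k G i z) = 0 :=
  LinearMap.congr_fun ((MonoidAlgebra.basis (G i) k).ext
    (f₁ := projection k G j ∘ₗ inclusion k G i) (f₂ := 0) fun g => by
      rw [LinearMap.comp_apply, inclusion_basis, projection_of_ne _ _ fun h' => h h'.1,
        LinearMap.zero_apply]) z

lemma loop_mul_loop (i : P) (g h : G i) :
    basis k _ (loop i g) * basis k _ (loop i h) = basis k (Amalgam G) (loop i (g * h)) :=
  basis_mul_basis_of_comp _ _

variable [Fintype P]

lemma inclusion_mul (i : P) (x y : MonoidAlgebra k (G i)) :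
    inclusion k G i (x * y) = inclusion k G i x * inclusion k G i y := by
  suffices H : (LinearMap.mul k (MonoidAlgebra k (G i))).compr₂ (inclusion k G i) =
      (LinearMap.mul k (CategoryAlgebra k (Amalgam G))).compl₁₂ (inclusion k G i)
        (inclusion k G i) by
    simpa only [LinearMap.compr₂_apply, LinearMap.compl₁₂_apply, LinearMap.mul_apply'] using
      LinearMap.congr_fun₂ H x y
  refine LinearMap.ext_basis (MonoidAlgebra.basis (G i) k) (MonoidAlgebra.basis (G i) k)
    fun g h => ?_
  simp only [LinearMap.compr₂_apply, LinearMap.compl₁₂_apply, LinearMap.mul_apply',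
    monoidAlgebra_basis_mul, inclusion_basis, loop_mul_loop]

/-- The order matters here: a composite that begins and ends at `i` passes only through objects
between `i` and `i`, so both factors already lie in `G i`. -/
lemma projection_mul (i : P) (x y : CategoryAlgebra k (Amalgam G)) :
    projection k G i (x * y) = projection k G i x * projection k G i y := by
  suffices H : (LinearMap.mul k (CategoryAlgebra k (Amalgam G))).compr₂ (projection k G i) =
      (LinearMap.mul k (MonoidAlgebra k (G i))).compl₁₂ (projection k G i)
        (projection k G i) by
    simpa only [LinearMap.compr₂_apply, LinearMap.compl₁₂_apply, LinearMap.mul_apply'] using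
      LinearMap.congr_fun₂ H x y
  refine LinearMap.ext_basis (basis k (Amalgam G)) (basis k (Amalgam G)) fun φ ψ => ?_
  simp only [LinearMap.compr₂_apply, LinearMap.compl₁₂_apply, LinearMap.mul_apply']
  by_cases hφ : φ.left = vertex G i ∧ φ.right = vertex G i
  · obtain ⟨g, rfl⟩ := (mem_range_loop_iff i φ).2 hφ
    by_cases hψ : ψ.left = vertex G i ∧ ψ.right = vertex G i
    · obtain ⟨h, rfl⟩ := (mem_range_loop_iff i ψ).2 hψ
      rw [loop_mul_loop, projection_loop, projection_loop, projection_loop, monoidAlgebra_basis_mul]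
    · rw [projection_of_ne _ _ hψ, mul_zero]
      by_cases h : (loop i g).right = ψ.left
      · obtain ⟨l, h1, h2, h3⟩ := exists_basis_mul_basis (k := k) h
        rw [h3, projection_of_ne]
        exact fun h' => hψ ⟨h.symm, h2.symm.trans h'.2⟩
      · rw [basis_mul_basis_of_ne h, map_zero]
  · rw [projection_of_ne _ _ hφ, zero_mul]
    by_cases h : φ.right = ψ.left
    · obtain ⟨l, h1, h2, h3⟩ := exists_basis_mul_basis (k := k) h
      rw [h3, projection_of_ne]
      rintro ⟨h4, h5⟩
      -- The intermediate object is both above and below `i`, so antisymmetry makes `φ` an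
      -- endomorphism of `i`.
      have h6 := le_of_arrow φ
      have h7 := le_of_arrow ψ
      rw [← h2, h5, ← h] at h7
      rw [← h1, h4] at h6
      exact hφ ⟨h1.symm.trans h4, le_antisymm (α := P) h7 h6⟩
    · rw [basis_mul_basis_of_ne h, map_zero]

lemma projection_one (i : P) : projection k G i 1 = 1 := by
  rw [one_def, map_sum, Finset.sum_eq_single (vertex G i)]
  · exact projection_loop i 1
  · intro x _ hx
    exact projection_of_ne _ _ fun h => hx h.1
  · simp

lemma projection_prod (i : P) {n : ℕ} (a : Fin n → CategoryAlgebra k (Amalgam G)) :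
    projection k G i (List.ofFn a).prod = (List.ofFn fun j => projection k G i (a j)).prod := by
  induction n with
  | zero => simp [projection_one]
  | succ n ih => simp [List.ofFn_succ, projection_mul, ih]

lemma augmentation_projection (i : P) (x : CategoryAlgebra k (Amalgam G)) :
    augmentation k (G i) (projection k G i x) = coeffSum k (vertex G i) (vertex G i) x := by
  refine LinearMap.congr_fun ((basis k (Amalgam G)).ext
    (f₁ := augmentation k (G i) ∘ₗ projection k G i) fun φ => ?_) x
  rw [LinearMap.comp_apply, coeffSum_basis]
  split_ifs with h
  · obtain ⟨g, rfl⟩ := (mem_range_loop_iff i φ).2 h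
    rw [projection_loop, augmentation_basis]
  · rw [projection_of_ne _ _ h, map_zero]

lemma coeffSum_inclusion (x y : Amalgam G) (i : P) (z : MonoidAlgebra k (G i))
    (hz : augmentation k (G i) z = 0) : coeffSum k x y (inclusion k G i z) = 0 := by
  classical
  have h : coeffSum k x y ∘ₗ inclusion k G i =
      (if x = vertex G i ∧ y = vertex G i then (1 : k) else 0) • augmentation k (G i) :=
    (MonoidAlgebra.basis (G i) k).ext fun g => by
      rw [LinearMap.comp_apply, inclusion_basis, coeffSum_basis, LinearMap.smul_apply,
        augmentation_basis, smul_eq_mul, mul_one]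
      exact if_congr ⟨fun h => ⟨h.1.symm, h.2.symm⟩, fun h => ⟨h.1.symm, h.2.symm⟩⟩ rfl rfl
  have := LinearMap.congr_fun h z
  rwa [LinearMap.smul_apply, hz, smul_zero] at this

/-- A morphism arriving at `i` from another object absorbs group elements, so it acts on `z` through
the augmentation, which is zero. Morphisms not ending at `i` do not compose with `z`. -/
lemma mul_inclusion (i : P) (a : CategoryAlgebra k (Amalgam G)) (z : MonoidAlgebra k (G i))
    (hz : augmentation k (G i) z = 0) :
    a * inclusion k G i z = inclusion k G i (projection k G i a * z) := by
  refine LinearMap.congr_fun ((basis k (Amalgam G)).ext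
    (f₁ := LinearMap.mulRight k (inclusion k G i z))
    (f₂ := inclusion k G i ∘ₗ LinearMap.mulRight k z ∘ₗ projection k G i) fun φ => ?_) a
  simp only [LinearMap.comp_apply, LinearMap.mulRight_apply]
  by_cases h : φ.left = vertex G i ∧ φ.right = vertex G i
  · obtain ⟨g, rfl⟩ := (mem_range_loop_iff i φ).2 h
    rw [projection_loop, inclusion_mul, inclusion_basis]
  · rw [projection_of_ne _ _ h, zero_mul, map_zero]
    by_cases hr : φ.right = vertex G i
    · have h' : LinearMap.mulLeft k (basis k _ φ) ∘ₗ inclusion k G i =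
          (augmentation k (G i)).smulRight (basis k _ φ) :=
        (MonoidAlgebra.basis (G i) k).ext fun g => by
          rw [LinearMap.comp_apply, inclusion_basis, LinearMap.smulRight_apply,
            augmentation_basis, one_smul, LinearMap.mulLeft_apply]
          obtain ⟨l, h1, h2, h3⟩ := exists_basis_mul_basis (k := k) (f := φ) (g := loop i g) hr
          rw [h3, arrow_ext h1 (h2.trans hr.symm)]
          exact fun h4 => h ⟨h1.symm.trans (h4.trans h2), hr⟩
      have := LinearMap.congr_fun h' z
      rwa [LinearMap.smulRight_apply, hz, zero_smul] at this
    · have h' : LinearMap.mulLeft k (basis k _ φ) ∘ₗ inclusion k G i = 0 :=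
        (MonoidAlgebra.basis (G i) k).ext fun g => by
          rw [LinearMap.comp_apply, inclusion_basis, LinearMap.mulLeft_apply,
            basis_mul_basis_of_ne hr, LinearMap.zero_apply]
      exact LinearMap.congr_fun h' z

lemma inclusion_mul_right (i : P) (a : CategoryAlgebra k (Amalgam G)) (z : MonoidAlgebra k (G i))
    (hz : augmentation k (G i) z = 0) :
    inclusion k G i z * a = inclusion k G i (z * projection k G i a) := by
  refine LinearMap.congr_fun ((basis k (Amalgam G)).ext
    (f₁ := LinearMap.mulLeft k (inclusion k G i z))
    (f₂ := inclusion k G i ∘ₗ LinearMap.mulLeft k z ∘ₗ projection k G i) fun φ => ?_) a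
  simp only [LinearMap.comp_apply, LinearMap.mulLeft_apply]
  by_cases h : φ.left = vertex G i ∧ φ.right = vertex G i
  · obtain ⟨g, rfl⟩ := (mem_range_loop_iff i φ).2 h
    rw [projection_loop, inclusion_mul, inclusion_basis]
  · rw [projection_of_ne _ _ h, mul_zero, map_zero]
    by_cases hl : (vertex G i) = φ.left
    · have h' : LinearMap.mulRight k (basis k _ φ) ∘ₗ inclusion k G i =
          (augmentation k (G i)).smulRight (basis k _ φ) :=
        (MonoidAlgebra.basis (G i) k).ext fun g => by
          rw [LinearMap.comp_apply, inclusion_basis, LinearMap.smulRight_apply,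
            augmentation_basis, one_smul, LinearMap.mulRight_apply]
          obtain ⟨l, h1, h2, h3⟩ := exists_basis_mul_basis (k := k) (f := loop i g) (g := φ) hl
          rw [h3, arrow_ext (h1.trans hl) h2]
          exact fun h4 => h ⟨hl.symm, h2.symm.trans (h4.symm.trans h1)⟩
      have := LinearMap.congr_fun h' z
      rwa [LinearMap.smulRight_apply, hz, zero_smul] at this
    · have h' : LinearMap.mulRight k (basis k _ φ) ∘ₗ inclusion k G i = 0 :=
        (MonoidAlgebra.basis (G i) k).ext fun g => by
          rw [LinearMap.comp_apply, inclusion_basis, LinearMap.mulRight_apply,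
            basis_mul_basis_of_ne hl, LinearMap.zero_apply]
      exact LinearMap.congr_fun h' z

end Amalgam

/-! ### Hochschild cochains of the amalgam and of the group rings -/

namespace Amalgam

open Simplicial CategoryAlgebra

variable {k : Type w} [CommRing k] {P : Type u} [PartialOrder P] [Fintype P] {G : P → Type v}
  [∀ i, Group (G i)]

variable (k G) in
/-- Restriction of Hochschild cochains to the group ring of `G i`. -/
def restrict (i : P) (n : ℕ) : HochschildCochain k (CategoryAlgebra k (Amalgam G)) n →ₗ[k]
    HochschildCochain k (MonoidAlgebra k (G i)) n where
  toFun f := ((projection k G i).compMultilinearMap f).compLinearMap fun _ => inclusion k G i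
  map_add' f g := by ext a; simp
  map_smul' c f := by ext a; simp

lemma restrict_apply (i : P) (n : ℕ) (f : HochschildCochain k (CategoryAlgebra k (Amalgam G)) n)
    (a : Fin n → MonoidAlgebra k (G i)) :
    restrict k G i n f a = projection k G i (f fun j => inclusion k G i (a j)) := rfl

variable (k G) in
/-- Extension of Hochschild cochains from the group ring of `G i` by zero. -/
def extend (i : P) (n : ℕ) : HochschildCochain k (MonoidAlgebra k (G i)) n →ₗ[k]
    HochschildCochain k (CategoryAlgebra k (Amalgam G)) n where
  toFun f := ((inclusion k G i).compMultilinearMap f).compLinearMap fun _ => projection k G i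
  map_add' f g := by ext a; simp
  map_smul' c f := by ext a; simp

lemma extend_apply (i : P) (n : ℕ) (f : HochschildCochain k (MonoidAlgebra k (G i)) n)
    (a : Fin n → CategoryAlgebra k (Amalgam G)) :
    extend k G i n f a = inclusion k G i (f fun j => projection k G i (a j)) := rfl

lemma hochschildD_restrict (i : P) (n : ℕ)
    (f : HochschildCochain k (CategoryAlgebra k (Amalgam G)) n) :
    hochschildD k (MonoidAlgebra k (G i)) n (restrict k G i n f) =
      restrict k G i (n + 1) (hochschildD k (CategoryAlgebra k (Amalgam G)) n f) :=
  hochschildD_comp (inclusion k G i) (projection k G i) (inclusion_mul i) f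
    (fun a y => by rw [projection_mul, projection_inclusion])
    (fun a y => by rw [projection_mul, projection_inclusion])

/-- By multilinearity, vanishing of the retraction says that all values of `f` lie in the
augmentation ideal. -/
lemma augmentation_apply_eq_zero {i : P} {n : ℕ} {f : HochschildCochain k (MonoidAlgebra k (G i)) n}
    (hf : groupRho k (G i) n f = 0) (a : Fin n → MonoidAlgebra k (G i)) :
    augmentation k (G i) (f a) = 0 := by
  have h : (augmentation k (G i)).compMultilinearMap f = 0 := by
    refine Module.Basis.ext_multilinear (fun _ => MonoidAlgebra.basis (G i) k) fun φ => ?_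
    have := congrFun hf (groupSimplex φ)
    rwa [groupRho_apply, groupArrows_groupSimplex] at this
  exact congrArg (fun g => g a) h

/-- Only the two outer terms are in question: a general element of the category algebra multiplies
an included value. On the augmentation ideal that multiplication happens inside `k[G_i]`. -/
lemma hochschildD_extend {i : P} {n : ℕ} {f : HochschildCochain k (MonoidAlgebra k (G i)) n}
    (hf : groupRho k (G i) n f = 0) :
    hochschildD k (CategoryAlgebra k (Amalgam G)) n (extend k G i n f) =
      extend k G i (n + 1) (hochschildD k (MonoidAlgebra k (G i)) n f) :=
  hochschildD_comp (projection k G i) (inclusion k G i) (projection_mul i) f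
    (fun a y => mul_inclusion i a _ (augmentation_apply_eq_zero hf y))
    (fun a y => inclusion_mul_right i a _ (augmentation_apply_eq_zero hf y))

lemma restrict_extend (i : P) (n : ℕ) (f : HochschildCochain k (MonoidAlgebra k (G i)) n) :
    restrict k G i n (extend k G i n f) = f := by
  ext a
  simp only [restrict_apply, extend_apply, projection_inclusion]

lemma restrict_extend_of_ne {i j : P} (h : i ≠ j) (n : ℕ)
    (f : HochschildCochain k (MonoidAlgebra k (G i)) n) :
    restrict k G j n (extend k G i n f) = 0 := by
  ext a
  rw [restrict_apply, extend_apply, projection_inclusion_of_ne h, zero_apply]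

lemma categoryRho_extend {i : P} {n : ℕ} {f : HochschildCochain k (MonoidAlgebra k (G i)) n}
    (hf : groupRho k (G i) n f = 0) : categoryRho k (Amalgam G) n (extend k G i n f) = 0 := by
  ext σ
  rw [categoryRho_apply, extend_apply]
  exact coeffSum_inclusion _ _ i _ (augmentation_apply_eq_zero hf _)

lemma loop_groupArrows (i : P) {n : ℕ} (g : Fin n → G i) (hn : n ≠ 0) :
    (fun j => loop i (g j)) ∈ Set.range (nerveArrows (Amalgam G) n) := by
  obtain ⟨n, rfl⟩ := Nat.exists_eq_succ_of_ne_zero hn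
  exact (mem_range_nerveArrows_iff n _).2 fun _ _ _ => rfl

/-- The augmentation of the projection is the coefficient sum from `i` to `i`, and a simplex of `G
i` is a simplex of the amalgam with all vertices equal to `i`. -/
lemma groupRho_restrict_eq_zero (i : P) {n : ℕ}
    {f : HochschildCochain k (CategoryAlgebra k (Amalgam G)) n}
    (hf : categoryRho k (Amalgam G) n f = 0) : groupRho k (G i) n (restrict k G i n f) = 0 := by
  ext τ
  rw [groupRho_apply, restrict_apply, augmentation_projection]
  simp only [inclusion_basis]
  obtain ⟨σ, hσ, h0, h1⟩ : ∃ σ : (nerve (Amalgam G)) _⦋n⦌,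
      nerveArrows (Amalgam G) n σ = (fun j => loop i (groupArrows n τ j)) ∧
        nerveObj σ 0 = vertex G i ∧ nerveObj σ (Fin.last n) = vertex G i := by
    cases n with
    | zero => exact ⟨nerveVertex _ (vertex G i), Subsingleton.elim _ _, rfl, rfl⟩
    | succ n =>
      obtain ⟨σ, hσ⟩ := loop_groupArrows i (groupArrows (n + 1) τ) (Nat.succ_ne_zero n)
      exact ⟨σ, hσ, congrArg Comma.left (congrFun hσ 0),
        congrArg Comma.right (congrFun hσ (Fin.last n))⟩
  have h := congrFun hf σ
  rwa [categoryRho_apply, h0, h1, hσ] at h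

/-- Since the projection is multiplicative and unital, it preserves products of morphisms. Thus the
image of `Ψ` dies in the quotients by strictly autopoietic classes. -/
lemma restrict_categoryPsi_mem (i : P) (n : ℕ)
    (γ : SimplicialCochain k (nerve (Amalgam G)) n) :
    restrict k G i n (categoryPsi k (Amalgam G) n γ) ∈
      strictlyAutopoietic k (MonoidAlgebra.basis (G i) k) n := by
  intro φ
  rw [restrict_apply]
  cases n with
  | zero =>
    refine ⟨γ (nerveVertex _ (vertex G i)), ?_⟩
    rw [categoryPsi_zero_apply, map_sum, Finset.sum_eq_single (vertex G i)]
    · rw [map_smul]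
      exact congrArg _ (projection_loop i 1)
    · intro x _ hx
      rw [map_smul, idem, projection_of_ne _ _ fun h => hx h.1, smul_zero]
    · simp
  | succ n =>
    simp only [inclusion_basis]
    refine ⟨Function.extend (nerveArrows (Amalgam G) (n + 1)) γ 0 fun j => loop i (φ j), ?_⟩
    rw [categoryPsi_succ_apply_basis, map_smul, projection_prod]
    simp only [projection_loop]

/-! ### Cocycles detected by retraction and restrictions -/

lemma nerveObj_le {n : ℕ} (σ : (nerve (Amalgam G)) _⦋n⦌) {a b : Fin (n + 1)} (h : a ≤ b) :
    LE.le (α := P) (nerveObj σ a : Amalgam G) (nerveObj σ b : Amalgam G) :=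
  le_of_arrow (nerveEdge σ a b h)

lemma inclusion_projection (i : P) (z : CategoryAlgebra k (Amalgam G)) :
    idem k (vertex G i) * (z * idem k (vertex G i)) = inclusion k G i (projection k G i z) := by
  classical
  refine LinearMap.congr_fun ((basis k (Amalgam G)).ext
    (f₁ := LinearMap.mulLeft k (idem k (vertex G i)) ∘ₗ LinearMap.mulRight k (idem k (vertex G i)))
    (f₂ := inclusion k G i ∘ₗ projection k G i) fun φ => ?_) z
  simp only [LinearMap.comp_apply, LinearMap.mulLeft_apply, LinearMap.mulRight_apply]
  by_cases h : φ.left = vertex G i ∧ φ.right = vertex G i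
  · rw [basis_mul_idem, if_pos h.2, idem_mul_basis, if_pos h.1]
    obtain ⟨g, rfl⟩ := (mem_range_loop_iff i φ).2 h
    rw [projection_loop, inclusion_basis]
  · rw [projection_of_ne _ _ h, map_zero, basis_mul_idem]
    split_ifs with h2
    · rw [idem_mul_basis, if_neg fun h1 => h ⟨h1, h2⟩]
    · rw [mul_zero]

/-- If there is at most one morphism from `x` to `y`, the component of an element of a category
algebra from `x` to `y` is determined by its coefficient sum. -/
lemma idem_mul_idem_eq_coeffSum {C : Type u} [Category.{v} C] [Fintype C] (φ : Arrow C)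
    (hφ : ∀ ψ : Arrow C, ψ.left = φ.left → ψ.right = φ.right → ψ = φ) (z : CategoryAlgebra k C) :
    idem k φ.left * (z * idem k φ.right) = coeffSum k φ.left φ.right z • basis k C φ := by
  classical
  refine LinearMap.congr_fun ((basis k C).ext
    (f₁ := LinearMap.mulLeft k (idem k φ.left) ∘ₗ LinearMap.mulRight k (idem k φ.right))
    (f₂ := (coeffSum k φ.left φ.right).smulRight (basis k C φ)) fun ψ => ?_) z
  simp only [LinearMap.comp_apply, LinearMap.mulLeft_apply, LinearMap.mulRight_apply,
    LinearMap.smulRight_apply]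
  by_cases h : ψ.left = φ.left ∧ ψ.right = φ.right
  · obtain rfl := hφ ψ h.1 h.2
    rw [basis_mul_idem, if_pos rfl, idem_mul_basis, if_pos rfl, coeffSum_basis, if_pos ⟨rfl, rfl⟩,
      one_smul]
  · rw [coeffSum_basis, if_neg h, zero_smul, basis_mul_idem]
    split_ifs with h2
    · rw [idem_mul_basis, if_neg fun h1 => h ⟨h1, h2⟩]
    · rw [mul_zero]

lemma mem_coboundaries_of_categoryRho_of_restrict {n : ℕ}
    {f : HochschildCochain k (CategoryAlgebra k (Amalgam G)) n}
    (hf : f ∈ cocycles (hochschildD k (CategoryAlgebra k (Amalgam G))) n)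
    (h : categoryRho k (Amalgam G) n f = 0) (h' : ∀ i, restrict k G i n f = 0) :
    f ∈ coboundaries (hochschildD k (CategoryAlgebra k (Amalgam G))) n := by
  refine mem_coboundaries_of_idem_mul_idem hf fun σ => ?_
  by_cases hσ : nerveObj σ 0 = nerveObj σ (Fin.last n)
  · obtain ⟨i, hi⟩ : ∃ i : P, nerveObj σ 0 = vertex G i := ⟨(nerveObj σ 0 : Amalgam G), rfl⟩
    -- The vertices increase along the simplex, so equal end points force all of them to be equal.
    have hobj : ∀ a, nerveObj σ a = vertex G i := fun a =>
      le_antisymm (α := P) (le_of_le_of_eq (nerveObj_le σ (Fin.le_last a)) (hσ.symm.trans hi))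
        (le_of_eq_of_le hi.symm (nerveObj_le σ (Fin.zero_le a)))
    have hloop : ∀ j, ∃ g, loop i g = nerveArrows (Amalgam G) n σ j := fun j =>
      (mem_range_loop_iff i _).2 ⟨hobj _, hobj _⟩
    choose g hg using hloop
    rw [hobj, hobj, inclusion_projection]
    have := congrArg (fun F => F fun j => MonoidAlgebra.basis (G i) k (g j)) (h' i)
    simp only [restrict_apply, inclusion_basis, hg, zero_apply] at this
    rw [this, map_zero]
  -- With distinct end points there is a unique morphism between them, so the component is its
  -- coefficient sum, a value of the retraction.
  · have := idem_mul_idem_eq_coeffSum (k := k) (nerveEdge σ 0 (Fin.last n) (Fin.zero_le _))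
      (fun ψ h1 h2 => arrow_ext h1 h2 fun h3 => hσ (h1.symm.trans (h3.trans h2)))
      (f fun i => basis k (Amalgam G) (nerveArrows (Amalgam G) n σ i))
    refine this.trans ?_
    have h0 := congrFun h σ
    rw [categoryRho_apply] at h0
    change coeffSum k (nerveObj σ 0) (nerveObj σ (Fin.last n)) _ • _ = _
    rw [h0, Pi.zero_apply, zero_smul]

end Amalgam

/-! ### The decomposition of Hochschild cohomology -/

namespace Amalgam

open Simplicial CategoryAlgebra

variable {k : Type w} [CommRing k] {P : Type u} [PartialOrder P] [Fintype P] {G : P → Type v}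
  [∀ i, Group (G i)]

/-- Lifts a coboundary of one group ring to a coboundary of the amalgam that is invisible to the
retraction and to the other groups. This is used to correct the restrictions one group at a time. -/
lemma exists_mem_coboundaries_restrict_eq {i : P} {n : ℕ}
    {f : HochschildCochain k (MonoidAlgebra k (G i)) n}
    (hf : f ∈ coboundaries (hochschildD k (MonoidAlgebra k (G i))) n)
    (hcf : f ∈ cocycles (hochschildD k (MonoidAlgebra k (G i))) n)
    (hf' : groupRho k (G i) n f = 0) :
    ∃ F ∈ coboundaries (hochschildD k (CategoryAlgebra k (Amalgam G))) n,
      F ∈ cocycles (hochschildD k (CategoryAlgebra k (Amalgam G))) n ∧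
      categoryRho k (Amalgam G) n F = 0 ∧ restrict k G i n F = f ∧
        ∀ j, i ≠ j → restrict k G j n F = 0 := by
  cases n with
  | zero =>
    obtain rfl : f = 0 := hf
    exact ⟨0, Submodule.zero_mem _, Submodule.zero_mem _, map_zero _, map_zero _, fun _ _ => map_zero _⟩
  | succ n =>
    obtain ⟨h, rfl⟩ := hf
    -- The primitive is moved into the augmentation ideal so that it can be extended by zero. Its
    -- coboundary is unchanged because the subtracted part has coboundary `Ψ(ρ(δ h))`, which is zero
    -- by `hf'`.
    set h' := h - groupPsi k (G i) n (groupRho k (G i) n h) with hh'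
    have h1 : groupRho k (G i) n h' = 0 := by rw [hh', map_sub, groupRho_groupPsi, sub_self]
    have h2 : hochschildD k (MonoidAlgebra k (G i)) n h' =
        hochschildD k (MonoidAlgebra k (G i)) n h := by
      rw [hh', map_sub, hochschildD_groupPsi, simplicialD_groupRho, hf', map_zero, sub_zero]
    refine ⟨hochschildD k _ n (extend k G i n h'), ⟨_, rfl⟩, ?_, ?_, ?_, fun j hj => ?_⟩
    · rw [hochschildD_extend h1, h2, mem_cocycles, hochschildD_extend hf', mem_cocycles.1 hcf,
        map_zero]
    · rw [← simplicialD_categoryRho, categoryRho_extend h1, map_zero]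
    · rw [← hochschildD_restrict, restrict_extend, h2]
    · rw [← hochschildD_restrict, restrict_extend_of_ne hj, map_zero]

variable (k G) in
/-- The map from the Hochschild cohomology of the amalgam to the cohomology of its nerve and the
Hochschild cohomology of the group rings modulo the classes of strictly autopoietic cocycles. -/
def decomposition (n : ℕ) : HochschildCohomology k (CategoryAlgebra k (Amalgam G)) n →ₗ[k]
    SimplicialCohomology k (nerve (Amalgam G)) n ×
      (∀ i : P, HochschildCohomology k (MonoidAlgebra k (G i)) n ⧸
        strictlyAutopoieticClasses k (MonoidAlgebra.basis (G i) k) n) :=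
  (cohomologyMap (categoryRho k (Amalgam G)) simplicialD_categoryRho n).prod
    (LinearMap.pi fun i =>
      (strictlyAutopoieticClasses k (MonoidAlgebra.basis (G i) k) n).mkQ ∘ₗ
        cohomologyMap (restrict k G i) (hochschildD_restrict i) n)

lemma decomposition_class (n : ℕ)
    (f : cocycles (hochschildD k (CategoryAlgebra k (Amalgam G))) n) :
    decomposition k G n (cohomologyClass _ n f) =
      (cohomologyClass _ n ⟨_, map_mem_cocycles simplicialD_categoryRho f.2⟩,
        fun i => Submodule.Quotient.mk
          (cohomologyClass _ n ⟨_, map_mem_cocycles (hochschildD_restrict i) f.2⟩)) := rfl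

lemma class_mem_strictlyAutopoieticClasses {A : Type v} [Ring A] [Algebra k A] {Ω : Type*}
    {b : Ω → A} {n : ℕ} {f : cocycles (hochschildD k A) n}
    (hf : (f : HochschildCochain k A n) ∈ strictlyAutopoietic k b n) :
    cohomologyClass _ n f ∈ strictlyAutopoieticClasses k b n :=
  ⟨f, hf, rfl⟩

/-- The strictly autopoietic cocycles meet the kernel of the retraction trivially in cohomology, so
a class in both is zero. -/
lemma restrict_categoryRho_sub_mem_coboundaries (i : P) {n : ℕ}
    {f : HochschildCochain k (CategoryAlgebra k (Amalgam G)) n}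
    (hf : f ∈ cocycles (hochschildD k (CategoryAlgebra k (Amalgam G))) n)
    (hρ : categoryRho k (Amalgam G) n f = 0)
    (h : cohomologyClass (hochschildD k (MonoidAlgebra k (G i))) n
      ⟨_, map_mem_cocycles (hochschildD_restrict i) hf⟩ ∈
        strictlyAutopoieticClasses k (MonoidAlgebra.basis (G i) k) n) :
    restrict k G i n f ∈ coboundaries (hochschildD k (MonoidAlgebra k (G i))) n := by
  obtain ⟨z, hz, hzf⟩ := h
  replace hz : (z : HochschildCochain k _ n) ∈
    strictlyAutopoietic k (MonoidAlgebra.basis (G i) k) n := hz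
  rw [← range_groupPsi] at hz
  obtain ⟨γ, hγ⟩ := hz
  rw [eq_comm, ← sub_eq_zero, ← map_sub, cohomologyClass_eq_zero_iff] at hzf
  replace hzf : restrict k G i n f - z ∈
    coboundaries (hochschildD k (MonoidAlgebra k (G i))) n := hzf
  -- Applying `Ψ ∘ ρ` to the coboundary `restrict f - z` kills the first term and fixes `z`, so `-z`
  -- is a coboundary.
  have h1 := map_mem_coboundaries hochschildD_groupPsi (map_mem_coboundaries simplicialD_groupRho hzf)
  rw [← hγ, map_sub, groupRho_restrict_eq_zero i hρ, groupRho_groupPsi, zero_sub, map_neg,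
    hγ] at h1
  simpa using Submodule.sub_mem _ hzf h1

lemma decomposition_injective (n : ℕ) : Function.Injective (decomposition k G n) := by
  refine (injective_iff_map_eq_zero (decomposition k G n)).2 fun x hx => ?_
  obtain ⟨f, rfl⟩ := cohomologyClass_surjective n x
  rw [decomposition_class, Prod.mk_eq_zero] at hx
  obtain ⟨hx1, hx2⟩ := hx
  rw [cohomologyClass_eq_zero_iff] at hx1
  rw [cohomologyClass_eq_zero_iff]
  obtain ⟨f, hf⟩ := f
  change categoryRho k (Amalgam G) n f ∈ _ at hx1
  change f ∈ _
  -- Removing `Ψ(ρ f)` makes the retraction vanish exactly. It changes `f` by a coboundary, since `ρ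
  -- f` is one by assumption.
  set f₀ := categoryPsi k (Amalgam G) n (categoryRho k (Amalgam G) n f)
  have h₀ : f₀ ∈ coboundaries (hochschildD k (CategoryAlgebra k (Amalgam G))) n :=
    map_mem_coboundaries hochschildD_categoryPsi hx1
  have h₀' : f₀ ∈ cocycles (hochschildD k (CategoryAlgebra k (Amalgam G))) n :=
    map_mem_cocycles hochschildD_categoryPsi (map_mem_cocycles simplicialD_categoryRho hf)
  have hρ : categoryRho k (Amalgam G) n (f - f₀) = 0 := by
    rw [map_sub, categoryRho_categoryPsi, sub_self]
  have h₁ : f - f₀ ∈ cocycles (hochschildD k (CategoryAlgebra k (Amalgam G))) n :=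
    Submodule.sub_mem _ hf h₀'
  have hr : ∀ i, restrict k G i n (f - f₀) ∈
      coboundaries (hochschildD k (MonoidAlgebra k (G i))) n := fun i => by
    refine restrict_categoryRho_sub_mem_coboundaries i h₁ hρ ?_
    have h1 := (Submodule.Quotient.mk_eq_zero _).1 (congrFun hx2 i)
    have h2 := class_mem_strictlyAutopoieticClasses
      (f := ⟨_, map_mem_cocycles (hochschildD_restrict i) h₀'⟩)
      (restrict_categoryPsi_mem i n (categoryRho k (Amalgam G) n f))
    refine Eq.mp ?_ (Submodule.sub_mem _ h1 h2)
    rw [← map_sub]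
    congr 2
    exact Subtype.ext (map_sub _ _ _).symm
  -- The corrections `F i` do not interfere: each has zero retraction and zero restriction to the
  -- other groups, so their sum matches all restrictions at once.
  choose F hF hF0 hF1 hF2 hF3 using fun i => exists_mem_coboundaries_restrict_eq (hr i)
    (map_mem_cocycles (hochschildD_restrict i) h₁) (groupRho_restrict_eq_zero i hρ)
  have hsum : ∑ i, F i ∈ coboundaries (hochschildD k (CategoryAlgebra k (Amalgam G))) n :=
    Submodule.sum_mem _ fun i _ => hF i
  have hcoc : ∀ g ∈ coboundaries (hochschildD k (CategoryAlgebra k (Amalgam G))) n,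
    f - f₀ - g ∈ coboundaries (hochschildD k (CategoryAlgebra k (Amalgam G))) n →
      f ∈ coboundaries (hochschildD k (CategoryAlgebra k (Amalgam G))) n := fun g hg h => by
    simpa using Submodule.add_mem _ (Submodule.add_mem _ h hg) h₀
  refine hcoc _ hsum (mem_coboundaries_of_categoryRho_of_restrict ?_ ?_ fun j => ?_)
  · exact Submodule.sub_mem _ h₁ (Submodule.sum_mem _ fun i _ => hF0 i)
  · rw [map_sub, hρ, map_sum, Finset.sum_eq_zero fun i _ => hF1 i, sub_zero]
  · rw [map_sub, map_sum, Finset.sum_eq_single j (fun i _ hij => hF3 i j hij) (by simp), hF2,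
      sub_self]

lemma decomposition_surjective (n : ℕ) : Function.Surjective (decomposition k G n) := by
  rintro ⟨c, t⟩
  obtain ⟨γ, rfl⟩ := cohomologyClass_surjective n c
  have ht : ∀ i, ∃ f : cocycles (hochschildD k (MonoidAlgebra k (G i))) n,
      Submodule.Quotient.mk (cohomologyClass _ n f) = t i := fun i => by
    obtain ⟨x, hx⟩ := Submodule.Quotient.mk_surjective _ (t i)
    obtain ⟨f, rfl⟩ := cohomologyClass_surjective n x
    exact ⟨f, hx⟩
  choose f hf using ht
  -- These representatives of the given classes modulo `H^n(BG_i)` take values in the augmentation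
  -- ideal, so their extensions by zero are cocycles.
  let f' : ∀ i, HochschildCochain k (MonoidAlgebra k (G i)) n := fun i =>
    f i - groupPsi k (G i) n (groupRho k (G i) n (f i))
  have h1 : ∀ i, groupRho k (G i) n (f' i) = 0 := fun i => by
    rw [map_sub, groupRho_groupPsi, sub_self]
  have h2 : ∀ i, f' i ∈ cocycles (hochschildD k (MonoidAlgebra k (G i))) n := fun i =>
    Submodule.sub_mem _ (f i).2
      (map_mem_cocycles hochschildD_groupPsi (map_mem_cocycles simplicialD_groupRho (f i).2))
  have h3 : ∀ i, extend k G i n (f' i) ∈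
      cocycles (hochschildD k (CategoryAlgebra k (Amalgam G))) n := fun i => by
    rw [mem_cocycles, hochschildD_extend (h1 i), mem_cocycles.1 (h2 i), map_zero]
  have h4 : categoryPsi k (Amalgam G) n γ + ∑ i, extend k G i n (f' i) ∈
      cocycles (hochschildD k (CategoryAlgebra k (Amalgam G))) n :=
    Submodule.add_mem _ (map_mem_cocycles hochschildD_categoryPsi γ.2)
      (Submodule.sum_mem _ fun i _ => h3 i)
  refine ⟨cohomologyClass _ n ⟨_, h4⟩, ?_⟩
  rw [decomposition_class]
  refine Prod.ext ?_ (funext fun j => ?_)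
  · refine congrArg (cohomologyClass _ n) (Subtype.ext ?_)
    change categoryRho k (Amalgam G) n _ = γ
    rw [map_add, categoryRho_categoryPsi, map_sum,
      Finset.sum_eq_zero fun i _ => categoryRho_extend (h1 i), add_zero]
  · refine Eq.trans ?_ (hf j)
    refine (Submodule.Quotient.eq _).2 ?_
    rw [← map_sub]
    refine class_mem_strictlyAutopoieticClasses ?_
    change restrict k G j n (categoryPsi k (Amalgam G) n γ + ∑ i, extend k G i n (f' i)) - f j ∈ _
    rw [map_add, map_sum, Finset.sum_eq_single j
      (fun i _ hij => restrict_extend_of_ne hij n _) (by simp), restrict_extend]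
    have h5 : groupPsi k (G j) n (groupRho k (G j) n (f j)) ∈
        strictlyAutopoietic k (MonoidAlgebra.basis (G j) k) n := by
      rw [← range_groupPsi]
      exact ⟨_, rfl⟩
    -- The restriction of the constructed cocycle differs from `f j` by `restrict (Ψ γ) - Ψ(ρ (f
    -- j))`, a difference of strictly autopoietic cochains.
    have h6 := Submodule.sub_mem _ (restrict_categoryPsi_mem j n (γ : _ → k)) h5
    refine Eq.mp (congrArg (· ∈ strictlyAutopoietic k (MonoidAlgebra.basis (G j) k) n) ?_) h6
    simp only [f']
    abel

lemma decomposition_categoryPsi (n : ℕ) (γ : cocycles (simplicialD k (nerve (Amalgam G))) n) :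
    decomposition k G n
      (cohomologyClass _ n ⟨_, map_mem_cocycles hochschildD_categoryPsi γ.2⟩) =
      (cohomologyClass _ n γ, 0) := by
  rw [decomposition_class]
  refine Prod.ext ?_ (funext fun i => ?_)
  · exact congrArg (cohomologyClass _ n) (Subtype.ext (categoryRho_categoryPsi n γ.1))
  · exact (Submodule.Quotient.mk_eq_zero _).2
      (class_mem_strictlyAutopoieticClasses (restrict_categoryPsi_mem i n γ.1))

end Amalgam

/-! ### Posets -/

section Poset

open Simplicial CategoryAlgebra

variable {k : Type w} [CommRing k] {P : Type u} [PartialOrder P] [Fintype P]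

/-- Injectivity comes from the retraction. For surjectivity, hom-sets have at most one element, so
the components of `f - Ψ(ρ f)` from source to target are determined by vanishing coefficient sums,
and the difference is a coboundary. -/
lemma categoryPsi_poset_bijective (n : ℕ) : Function.Bijective
    (cohomologyMap (categoryPsi k P) hochschildD_categoryPsi n) := by
  constructor
  · rw [← LinearMap.ker_eq_bot, LinearMap.ker_eq_bot']
    intro x hx
    obtain ⟨γ, rfl⟩ := cohomologyClass_surjective n x
    rw [cohomologyMap_class, cohomologyClass_eq_zero_iff] at hx
    rw [cohomologyClass_eq_zero_iff, ← categoryRho_categoryPsi n γ.1]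
    exact map_mem_coboundaries simplicialD_categoryRho hx
  · intro x
    obtain ⟨f, rfl⟩ := cohomologyClass_surjective n x
    refine ⟨cohomologyClass _ n ⟨_, map_mem_cocycles simplicialD_categoryRho f.2⟩, ?_⟩
    rw [cohomologyMap_class, eq_comm, ← sub_eq_zero, ← map_sub, cohomologyClass_eq_zero_iff]
    refine mem_coboundaries_of_idem_mul_idem (SetLike.coe_mem _) fun σ => ?_
    set F : HochschildCochain k (CategoryAlgebra k P) n :=
      f.1 - categoryPsi k P n (categoryRho k P n f.1) with hF
    have h0 : categoryRho k P n F = 0 := by rw [hF, map_sub, categoryRho_categoryPsi, sub_self]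
    have h1 := congrFun h0 σ
    have := Amalgam.idem_mul_idem_eq_coeffSum (k := k) (nerveEdge σ 0 (Fin.last n) (Fin.zero_le _))
      (fun ψ h1 h2 => Arrow.ext h1 h2 (Subsingleton.elim _ _))
      (F fun i => basis k P (nerveArrows P n σ i))
    refine this.trans ?_
    rw [categoryRho_apply] at h1
    change coeffSum k (nerveObj σ 0) (nerveObj σ (Fin.last n)) _ • _ = _
    rw [h1, Pi.zero_apply, zero_smul]

end Poset

end

/-! ### Assembly of the theorem -/

theorem mainTheorem1 {k : Type w} [CommRing k] {P : Type u} [PartialOrder P] [Fintype P]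
    (G : P → Type v) [∀ i, Group (G i)] :
    -- `Ψ` is an isomorphism from the simplicial cochain complex of the nerve of the amalgam onto
    -- the complex of autopoietic Hochschild cochains,
    (∀ n : ℕ,
      Function.Injective (categoryPsi k (Amalgam G) n) ∧
      LinearMap.range (categoryPsi k (Amalgam G) n) = categoryAutopoietic k (Amalgam G) n ∧
      ∀ γ, hochschildD k (CategoryAlgebra k (Amalgam G)) n (categoryPsi k (Amalgam G) n γ) =
        categoryPsi k (Amalgam G) (n + 1) (simplicialD k (nerve (Amalgam G)) n γ)) ∧
    -- which is unital, sends the cup product to the Gerstenhaber product,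
    (categoryPsi k (Amalgam G) 0 (fun _ => 1) Fin.elim0 = 1) ∧
    (∀ (p q : ℕ) (α : SimplicialCochain k (nerve (Amalgam G)) p)
      (β : SimplicialCochain k (nerve (Amalgam G)) q),
      categoryPsi k (Amalgam G) (p + q) (simplicialCup α β) =
        gerstenhaberProduct (categoryPsi k (Amalgam G) p α)
          (categoryPsi k (Amalgam G) q β)) ∧
    -- and sends the cup-one product to the pre-Lie product.
    (∀ (p q : ℕ) (α : SimplicialCochain k (nerve (Amalgam G)) (p + 1))
      (β : SimplicialCochain k (nerve (Amalgam G)) (q + 1))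
      (a : Fin (p + q + 1) → CategoryAlgebra k (Amalgam G)),
      categoryPsi k (Amalgam G) (p + q + 1) (simplicialCupOne α β) a =
        preLie (categoryPsi k (Amalgam G) (p + 1) α) (categoryPsi k (Amalgam G) (q + 1) β) a) ∧
    -- For each group, `Ψ` identifies the simplicial cochain complex of `BG_i` with the complex of
    -- strictly autopoietic cochains of `k[G_i]`, and `H^n(BG_i)` with a submodule of `HH^n(k[G_i])`.
    (∀ (i : P) (n : ℕ),
      Function.Injective (groupPsi k (G i) n) ∧
      LinearMap.range (groupPsi k (G i) n) =
        strictlyAutopoietic k (MonoidAlgebra.basis (G i) k) n ∧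
      (∀ γ, hochschildD k (MonoidAlgebra k (G i)) n (groupPsi k (G i) n γ) =
        groupPsi k (G i) (n + 1) (simplicialD k (nerve (GroupCategory (G i))) n γ)) ∧
      ∀ γ ∈ cocycles (simplicialD k (nerve (GroupCategory (G i)))) n,
        groupPsi k (G i) n γ ∈ coboundaries (hochschildD k (MonoidAlgebra k (G i))) n →
        γ ∈ coboundaries (simplicialD k (nerve (GroupCategory (G i)))) n) ∧
    -- The isomorphism; its restriction to the first summand is induced by `Ψ`, and is
    -- multiplicative.
    (∃ Θ : ∀ n : ℕ,
      (SimplicialCohomology k (nerve (Amalgam G)) n ×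
        (∀ i : P, HochschildCohomology k (MonoidAlgebra k (G i)) n ⧸
          strictlyAutopoieticClasses k (MonoidAlgebra.basis (G i) k) n)) ≃ₗ[k]
        HochschildCohomology k (CategoryAlgebra k (Amalgam G)) n,
      (∀ (n : ℕ) (γ : cocycles (simplicialD k (nerve (Amalgam G))) n),
        ∃ h : categoryPsi k (Amalgam G) n γ ∈
            cocycles (hochschildD k (CategoryAlgebra k (Amalgam G))) n,
          Θ n (cohomologyClass _ n γ, 0) = cohomologyClass _ n ⟨_, h⟩) ∧
      ∀ (p q : ℕ) (α : cocycles (simplicialD k (nerve (Amalgam G))) p)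
        (β : cocycles (simplicialD k (nerve (Amalgam G))) q),
        ∃ (h : simplicialCup α.1 β.1 ∈ cocycles (simplicialD k (nerve (Amalgam G))) (p + q))
          (h' : gerstenhaberProduct (categoryPsi k (Amalgam G) p α)
              (categoryPsi k (Amalgam G) q β) ∈
            cocycles (hochschildD k (CategoryAlgebra k (Amalgam G))) (p + q)),
          Θ (p + q) (cohomologyClass _ (p + q) ⟨_, h⟩, 0) =
            cohomologyClass _ (p + q) ⟨_, h'⟩) ∧
    -- For the poset algebra `k[P]`, the map `Ψ` induces an isomorphism.
    (∃ Θ : ∀ n : ℕ, SimplicialCohomology k (nerve P) n ≃ₗ[k]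
      HochschildCohomology k (CategoryAlgebra k P) n,
    ∀ (n : ℕ) (γ : cocycles (simplicialD k (nerve P)) n),
      ∃ h : categoryPsi k P n γ ∈ cocycles (hochschildD k (CategoryAlgebra k P)) n,
        Θ n (cohomologyClass _ n γ) = cohomologyClass _ n ⟨_, h⟩) := by
  refine ⟨fun n => ⟨categoryPsi_injective n, range_categoryPsi n, hochschildD_categoryPsi n⟩,
    categoryPsi_one, categoryPsi_simplicialCup,
    categoryPsi_simplicialCupOne,
    fun i n => ⟨groupPsi_injective n, range_groupPsi n, hochschildD_groupPsi n,
      fun γ _ h => mem_coboundaries_of_groupPsi h⟩, ?_, ?_⟩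
  -- The isomorphism is the inverse of the decomposition; its value on the first summand is read off
  -- from `decomposition_categoryPsi`.
  · let Θ := fun n => (LinearEquiv.ofBijective (Amalgam.decomposition k G n)
      ⟨Amalgam.decomposition_injective n, Amalgam.decomposition_surjective n⟩).symm
    have hΘ : ∀ (n : ℕ) (γ : cocycles (simplicialD k (nerve (Amalgam G))) n),
        Θ n (cohomologyClass _ n γ, 0) =
          cohomologyClass _ n ⟨_, map_mem_cocycles hochschildD_categoryPsi γ.2⟩ := fun n γ =>
      (LinearEquiv.symm_apply_eq _).2 (Amalgam.decomposition_categoryPsi n γ).symm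
    refine ⟨Θ, fun n γ => ⟨_, hΘ n γ⟩, fun p q α β => ?_⟩
    have h := simplicialCup_mem_cocycles α.2 β.2
    refine ⟨h, categoryPsi_simplicialCup p q α.1 β.1 ▸ map_mem_cocycles hochschildD_categoryPsi h,
      (hΘ (p + q) ⟨_, h⟩).trans (congrArg _ (Subtype.ext (categoryPsi_simplicialCup p q α.1 β.1)))⟩
  · exact ⟨fun n => LinearEquiv.ofBijective _ (categoryPsi_poset_bijective n),
      fun n γ => ⟨map_mem_cocycles hochschildD_categoryPsi γ.2, rfl⟩⟩
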